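/- **Theorem (existence of a self-similar solution).** For real parameters $\alpha>0$, $m>0$, $\kappa>0$, $a>0$ consider the problem of finding a positive classical solution $f\in C^4([0,\infty))$, $f>0$, of $$\alpha\,(f-yf_y)+(f^m f_{yyy})_y=0\quad\text{for } y\in(0,\infty),\qquad f(0)=1,\ f_y(0)=0,\ f_{yy}(0)=\kappa,\ f_{yyy}(0)=0,\qquad \lim_{y\to\infty}\frac{f(y)}{y}=a. \tag{P}$$ (i) Let $m\in(0,4)$ and $\alpha=\frac1{4-m}$. Then there exist $\kappa\in(0,\sqrt{12\alpha})$ and $a>0$ such that problem (P) has a solution. (ii) Let $m=4$, let $b>0$ and $\alpha=b$. Then there exist $\kappa\in(0,\sqrt{12\alpha})$ and $a>0$ such that problem (P) has a solution $f$ that satisfies $$f(y)=ay+\operatorname{Re}\big[K\,y^{1+z_0}\big]+o\big(y^{1+\operatorname{Re}z_0}\big)\quad\text{as } y\to\infty$$ for some $K,z_0\in\mathbb C$ with $\operatorname{Re}z_0<-1$. Here $z_0$ is the root of $(1-z^2)(2+z)+\frac{b}{a^4}$ with the largest real part among the roots with negative real part and, for definiteness, with $\operatorname{Im}z_0\ge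 0$. -/

import Mathlib

open Set Filter Topology Asymptotics

/-- `f` (only its values on `[0,∞)` matter) is a positive classical solution, `C⁴` up to `y = 0`, of
`α (f - y f') + (f ^ m f''')' = 0` on `(0,∞)` with `f 0 = 1`, `f' 0 = 0`, `f'' 0 = κ`, `f''' 0 = 0`
(one-sided derivatives at `0`) and `f y / y → a` as `y → ∞`. -/
structure IsSelfSimilarProfile (α m κ a : ℝ) (f : ℝ → ℝ) : Prop where
  contDiffOn : ContDiffOn ℝ 4 f (Ici 0)
  pos : ∀ y : ℝ, 0 ≤ y → 0 < f y
  ode : ∀ y : ℝ, 0 < y →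
    α * (f y - y * deriv f y) + deriv (fun s : ℝ => f s ^ m * iteratedDeriv 3 f s) y = 0
  init_zero : f 0 = 1
  init_one : iteratedDerivWithin 1 f (Ici 0) 0 = 0
  init_two : iteratedDerivWithin 2 f (Ici 0) 0 = κ
  init_three : iteratedDerivWithin 3 f (Ici 0) 0 = 0
  linear_growth : Tendsto (fun y : ℝ => f y / y) atTop (𝓝 a)

/-- `z₀` is the root of `(1 - z ^ 2) (2 + z) + c` with the largest negative real part, normalized
by `0 ≤ Im z₀`. -/
structure IsLeadingRoot (c : ℝ) (z₀ : ℂ) : Prop where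
  root : (1 - z₀ ^ 2) * (2 + z₀) + (c : ℂ) = 0
  re_neg : z₀.re < 0
  re_max : ∀ z : ℂ, (1 - z ^ 2) * (2 + z) + (c : ℂ) = 0 → z.re < 0 → z.re ≤ z₀.re
  im_nonneg : 0 ≤ z₀.im

/-! Replacing `f` by `y ↦ f (l * y)` with `l ^ 4 = α` reduces to `α = 1`. With `p = f'`, `u = f''`,
`g = f ^ m * f'''`, `r = f ^ (-m)` and `h = y * p - f`, the equation becomes `f' = p`, `p' = u`,
`u' = r * g`, `g' = h`, and `h' = y * u`. Here `h` drives `g`, `g` drives `u` and `u` drives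
`h`, so the octants where all three are positive or all three negative are invariant.

Shoot in `κ = f'' 0`. For `κ` near `0` the slope `p` becomes negative, and for `κ ≥ √12` the
trajectory enters the positive octant. Both events are open in `κ` and they exclude each other, so
by connectedness some `κ ∈ (0, √12)` produces neither. Along such a trajectory the function
`y * (h * u - r * g ^ 2 / 2) - 3 / 4 * h ^ 2 / y + u * g / 2` is nonpositive and its
derivative is at least `y ^ 2 * u ^ 2`, so `u` is integrable by Cauchy–Schwarz and `p` converges.
Comparison with the end of the first phase, on which `h < 0 < u` and `g < 0`, shows that the limit
`a` is positive.

For `m = 4` the system for `f / y`, `h / y`, `y * u`, `g / y ^ 2` is autonomous in `s = log y`, and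
its linearization at the limit has, besides `0`, the eigenvalues solving
`(z ^ 2 - 1) * (z + 2) = a⁻⁴`. One of them is positive. The other two are nonreal as soon as `a⁻⁴`
exceeds the local maximum `0.6311…` of the left-hand side, and then their real part is less than
`-1`; this is where the explicit bound `a ^ 4 ≤ 1.58` comes from. The deviations from the linear
profile decay at some exponential rate in `s`. The nonlinearity is quadratic and convergence
excludes the unstable mode, so the rate can be doubled until it is two thirds of that of the stable
pair; one more step then isolates the stable mode with a remainder of smaller order. -/

section GlobalFlow

variable {E : Type*} [NormedAddCommGroup E] [NormedSpace ℝ E]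

/-- The radial retraction of a normed space onto the closed ball of radius `R > 0` about `0`, used
to truncate vector fields. -/
noncomputable def radialRetraction (R : ℝ) (x : E) : E :=
  (R / max R ‖x‖) • x

lemma lipschitzWith_radialRetraction {R : ℝ} (hR : 0 < R) :
    LipschitzWith 2 (radialRetraction R : E → E) := by
  refine LipschitzWith.of_dist_le_mul fun x y => ?_
  have ha : 0 < max R ‖x‖ := lt_max_of_lt_left hR
  have hb : 0 < max R ‖y‖ := lt_max_of_lt_left hR
  set a := max R ‖x‖
  set b := max R ‖y‖
  have h_sub : |b - a| ≤ ‖x - y‖ := by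
    calc |b - a| ≤ |‖y‖ - ‖x‖| := by
          simpa only [a, b, max_comm R] using abs_max_sub_max_le_abs ‖y‖ ‖x‖ R
      _ ≤ ‖x - y‖ := by rw [norm_sub_rev]; exact abs_norm_sub_norm_le y x
  have h_split : (R / a) • x - (R / b) • y = (R / a) • (x - y) + (R / a * ((b - a) / b)) • y := by
    rw [smul_sub, sub_add, ← sub_smul]
    congr 2
    field_simp
    ring
  rw [dist_eq_norm, dist_eq_norm, radialRetraction, radialRetraction, h_split, NNReal.coe_ofNat]
  have hRa : |R / a| ≤ 1 := by
    rw [abs_of_pos (by positivity)]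
    exact (div_le_one ha).mpr (le_max_left _ _)
  have h_fst : ‖(R / a) • (x - y)‖ ≤ 1 * ‖x - y‖ := by
    rw [norm_smul, Real.norm_eq_abs]
    gcongr
  have h_snd : ‖(R / a * ((b - a) / b)) • y‖ ≤ 1 * ‖x - y‖ := by
    rw [norm_smul, norm_mul, Real.norm_eq_abs, norm_div, Real.norm_eq_abs,
      Real.norm_of_nonneg hb.le, mul_assoc, div_mul_eq_mul_div]
    gcongr
    rw [div_le_iff₀ hb]
    exact mul_le_mul h_sub (le_max_right _ _) (norm_nonneg _) (norm_nonneg _)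
  linarith [norm_add_le ((R / a) • (x - y)) ((R / a * ((b - a) / b)) • y)]

lemma norm_radialRetraction_le {R : ℝ} (hR : 0 < R) (x : E) :
    ‖radialRetraction R x‖ ≤ min R ‖x‖ := by
  have ha : 0 < max R ‖x‖ := lt_max_of_lt_left hR
  rw [radialRetraction, norm_smul, Real.norm_of_nonneg (by positivity), div_mul_eq_mul_div,
    div_le_iff₀ ha, min_mul_max]

lemma radialRetraction_eq_self {R : ℝ} (hR : 0 < R) {x : E} (hx : ‖x‖ ≤ R) :
    radialRetraction R x = x := by
  rw [radialRetraction, max_eq_left hx, div_self hR.ne', one_smul]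

/-- A time-dependent vector field on `[0,∞)` that is continuous in time, Lipschitz in space on
bounded sets, and bounded by a multiple of `‖x‖`, the constants being uniform on bounded time
intervals. Such a field generates a global forward flow. -/
structure IsLinearGrowthField (v : ℝ → E → E) : Prop where
  continuous_time : ∀ x, Continuous fun t => v t x
  lipschitz : ∀ T R : ℝ, ∃ K : NNReal, ∀ t ∈ Icc 0 T,
    LipschitzOnWith K (v t) (Metric.closedBall 0 R)
  growth : ∀ T : ℝ, ∃ C : ℝ, 0 ≤ C ∧ ∀ t ∈ Icc 0 T, ∀ x, ‖v t x‖ ≤ C * ‖x‖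

/-- `X` is an integral curve of `v` on the time interval `[0, T]`. -/
def IsTrajectoryOn (v : ℝ → E → E) (X : ℝ → E) (T : ℝ) : Prop :=
  ∀ t ∈ Icc 0 T, HasDerivWithinAt X (v t (X t)) (Icc 0 T) t

variable {v : ℝ → E → E} {X Y : ℝ → E} {C T : ℝ}

namespace IsTrajectoryOn

lemma mono (hX : IsTrajectoryOn v X T) {S : ℝ} (hS : S ≤ T) : IsTrajectoryOn v X S :=
  fun t ht => (hX t ⟨ht.1, ht.2.trans hS⟩).mono (Icc_subset_Icc_right hS)

lemma congr (hX : IsTrajectoryOn v X T) (hXY : EqOn Y X (Icc 0 T)) : IsTrajectoryOn v Y T :=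
  fun t ht => by rw [hXY ht]; exact (hX t ht).congr hXY (hXY ht)

lemma continuousOn (hX : IsTrajectoryOn v X T) : ContinuousOn X (Icc 0 T) :=
  fun t ht => (hX t ht).continuousWithinAt

lemma hasDerivWithinAt_Ici (hX : IsTrajectoryOn v X T) {t : ℝ} (ht : t ∈ Ico 0 T) :
    HasDerivWithinAt X (v t (X t)) (Ici t) t :=
  ((hX t (Ico_subset_Icc_self ht)).mono (Icc_subset_Icc_left ht.1)).mono_of_mem_nhdsWithin
    (Icc_mem_nhdsGE ht.2)

lemma norm_le (hX : IsTrajectoryOn v X T) (hC : ∀ t ∈ Icc 0 T, ∀ x, ‖v t x‖ ≤ C * ‖x‖)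
    (hC0 : 0 ≤ C) {t : ℝ} (ht : t ∈ Icc 0 T) : ‖X t‖ ≤ ‖X 0‖ * Real.exp (C * T) := by
  have h_gronwall := norm_le_gronwallBound_of_norm_deriv_right_le (K := C) (ε := 0)
    hX.continuousOn (fun s hs => hX.hasDerivWithinAt_Ici hs) le_rfl
    (fun s hs => by simpa using hC s (Ico_subset_Icc_self hs) (X s)) t ht
  rw [gronwallBound_ε0] at h_gronwall
  refine h_gronwall.trans ?_
  gcongr
  linarith [ht.2]

lemma dist_le (hX : IsTrajectoryOn v X T) (hY : IsTrajectoryOn v Y T) {K : NNReal} {s : Set E}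
    (hv : ∀ t ∈ Icc 0 T, LipschitzOnWith K (v t) s) (hXs : MapsTo X (Icc 0 T) s)
    (hYs : MapsTo Y (Icc 0 T) s) {t : ℝ} (ht : t ∈ Icc 0 T) :
    dist (X t) (Y t) ≤ Real.exp (K * T) * dist (X 0) (Y 0) := by
  have h_gronwall := dist_le_of_trajectories_ODE_of_mem (s := fun _ => s)
    (fun t ht => hv t (Ico_subset_Icc_self ht))
    hX.continuousOn (fun t ht => hX.hasDerivWithinAt_Ici ht)
    (fun t ht => hXs (Ico_subset_Icc_self ht))
    hY.continuousOn (fun t ht => hY.hasDerivWithinAt_Ici ht)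
    (fun t ht => hYs (Ico_subset_Icc_self ht)) le_rfl t ht
  rw [mul_comm] at h_gronwall
  refine h_gronwall.trans ?_
  gcongr
  linarith [ht.2]

end IsTrajectoryOn

lemma IsLinearGrowthField.exists_dist_le (hv : IsLinearGrowthField v) (T R : ℝ) :
    ∃ L : ℝ, 0 < L ∧ ∀ X Y : ℝ → E, ‖X 0‖ ≤ R → ‖Y 0‖ ≤ R → IsTrajectoryOn v X T →
      IsTrajectoryOn v Y T → ∀ t ∈ Icc 0 T, dist (X t) (Y t) ≤ L * dist (X 0) (Y 0) := by
  obtain ⟨C, hC0, hC⟩ := hv.growth T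
  obtain ⟨K, hK⟩ := hv.lipschitz T (R * Real.exp (C * T))
  have h_mem : ∀ Z : ℝ → E, ‖Z 0‖ ≤ R → IsTrajectoryOn v Z T →
      MapsTo Z (Icc 0 T) (Metric.closedBall 0 (R * Real.exp (C * T))) := fun Z hZ0 hZ t ht => by
    rw [mem_closedBall_zero_iff]
    exact (hZ.norm_le hC hC0 ht).trans (by gcongr)
  exact ⟨Real.exp (K * T), Real.exp_pos _, fun X Y hX0 hY0 hX hY t ht =>
    hX.dist_le hY hK (h_mem X hX0 hX) (h_mem Y hY0 hY) ht⟩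

/- The a priori bound `norm_le` keeps solutions of the field composed with the retraction onto a
large ball inside that ball, where both fields agree. -/
lemma IsLinearGrowthField.exists_isTrajectoryOn [CompleteSpace E] (hv : IsLinearGrowthField v)
    (x₀ : E) (hT : 0 ≤ T) : ∃ X : ℝ → E, X 0 = x₀ ∧ IsTrajectoryOn v X T := by
  obtain ⟨C, hC0, hC⟩ := hv.growth T
  set R : ℝ := ‖x₀‖ * Real.exp (C * T) + 1 with hR
  have hR0 : 0 < R := by positivity
  obtain ⟨K, hK⟩ := hv.lipschitz T R
  let P : E → E := radialRetraction R
  have hPR : ∀ x, ‖P x‖ ≤ R := fun x => (norm_radialRetraction_le hR0 x).trans (min_le_left _ _)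
  have hP : ∀ x, ‖P x‖ ≤ ‖x‖ := fun x => (norm_radialRetraction_le hR0 x).trans (min_le_right _ _)
  have h_picard : IsPicardLindelof (fun t x => v t (P x)) (tmin := 0) (tmax := T)
      ⟨0, le_rfl, hT⟩ x₀ (C * R * T).toNNReal 0 (C * R).toNNReal (K * 2) := by
    refine ⟨fun t ht => ?_, fun x _ => (hv.continuous_time _).continuousOn, fun t ht x _ => ?_, ?_⟩
    · exact (hK t ht).comp (lipschitzWith_radialRetraction hR0).lipschitzOnWith
        fun x _ => mem_closedBall_zero_iff.mpr (hPR x)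
    · rw [Real.coe_toNNReal _ (by positivity)]
      exact (hC t ht _).trans (by gcongr; exact hPR x)
    · rw [Real.coe_toNNReal _ (by positivity), Real.coe_toNNReal _ (by positivity)]
      simp [hT]
  obtain ⟨X, hX0, hX⟩ := h_picard.exists_eq_forall_mem_Icc_hasDerivWithinAt₀
  have hX0 : X 0 = x₀ := hX0
  have hX : IsTrajectoryOn (fun t x => v t (P x)) X T := hX
  refine ⟨X, hX0, fun t ht => ?_⟩
  have h_norm : ‖X t‖ ≤ R := by
    have := hX.norm_le (fun s hs x => (hC s hs _).trans (by gcongr; exact hP x)) hC0 ht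
    rw [hX0] at this
    linarith [hR]
  have h_deriv : HasDerivWithinAt X (v t (P (X t))) (Icc 0 T) t := hX t ht
  rwa [show P (X t) = X t from radialRetraction_eq_self hR0 h_norm] at h_deriv

lemma exists_eqOn_Ici_hasDerivAt {X' : ℝ → E} {a : ℝ}
    (hX : ∀ t ∈ Ici a, HasDerivWithinAt X (X' t) (Ici a) t) :
    ∃ Y : ℝ → E, EqOn Y X (Ici a) ∧ ∀ t ∈ Ici a, HasDerivAt Y (X' t) t := by
  classical
  let Y : ℝ → E := fun t => if a ≤ t then X t else X a + (t - a) • X' a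
  have hY : EqOn Y X (Ici a) := fun t ht => if_pos ht
  refine ⟨Y, hY, fun t ht => ?_⟩
  have h_right : HasDerivWithinAt Y (X' t) (Ici a) t := (hX t ht).congr hY (hY ht)
  rcases (mem_Ici.mp ht).eq_or_lt with rfl | hlt
  · have h_line : HasDerivAt (fun t : ℝ => X a + (t - a) • X' a) (X' a) a := by
      simpa using (((hasDerivAt_id a).sub_const a).smul_const (X' a)).const_add (X a)
    have h_left : HasDerivWithinAt Y (X' a) (Iic a) a := by
      refine h_line.hasDerivWithinAt.congr (fun s hs => ?_) (by simp [Y])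
      rcases (mem_Iic.mp hs).eq_or_lt with rfl | hs
      · simp [Y]
      · exact if_neg hs.not_ge
    simpa using h_right.union h_left
  · exact h_right.hasDerivAt (Ici_mem_nhds hlt)

lemma exists_hasDerivAt_of_forall_isTrajectoryOn {Z : ℕ → ℝ → E}
    (hZ : ∀ n : ℕ, IsTrajectoryOn v (Z n) n)
    (h_eq : ∀ n k : ℕ, n ≤ k → EqOn (Z n) (Z k) (Icc 0 n)) :
    ∃ X : ℝ → E, (∀ n : ℕ, EqOn X (Z n) (Icc 0 n)) ∧ ∀ t, 0 ≤ t → HasDerivAt X (v t (X t)) t := by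
  let W : ℝ → E := fun t => Z ⌈t⌉₊ t
  have hWZ : ∀ n : ℕ, EqOn W (Z n) (Icc 0 n) := fun n t ht =>
    h_eq _ n (Nat.ceil_le.mpr ht.2) ⟨ht.1, Nat.le_ceil t⟩
  have hW : ∀ t ∈ Ici (0 : ℝ), HasDerivWithinAt W (v t (W t)) (Ici 0) t := fun t ht => by
    obtain ⟨n, hn⟩ := exists_nat_gt t
    refine ((hZ n).congr (hWZ n) t ⟨ht, hn.le⟩).mono_of_mem_nhdsWithin ?_
    exact mem_nhdsWithin.mpr ⟨Iio n, isOpen_Iio, hn, fun s hs => ⟨hs.2, (mem_Iio.mp hs.1).le⟩⟩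
  obtain ⟨X, hXW, hX⟩ := exists_eqOn_Ici_hasDerivAt hW
  refine ⟨X, fun n t ht => (hXW ht.1).trans (hWZ n ht), fun t ht => ?_⟩
  rw [hXW ht]
  exact hX t ht

lemma IsLinearGrowthField.exists_flow [CompleteSpace E] (hv : IsLinearGrowthField v) :
    ∃ X : E → ℝ → E, (∀ x, X x 0 = x) ∧ (∀ x t, 0 ≤ t → HasDerivAt (X x) (v t (X x t)) t) ∧
      ∀ T R : ℝ, ∃ L : ℝ, 0 < L ∧ ∀ x y, ‖x‖ ≤ R → ‖y‖ ≤ R → ∀ t ∈ Icc 0 T,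
        dist (X x t) (X y t) ≤ L * dist x y := by
  choose Z hZ0 hZ using fun (x : E) (n : ℕ) => hv.exists_isTrajectoryOn x n.cast_nonneg
  have h_unique : ∀ x (n k : ℕ), n ≤ k → EqOn (Z x n) (Z x k) (Icc 0 n) := fun x n k hnk t ht => by
    obtain ⟨L, -, hL⟩ := hv.exists_dist_le n ‖x‖
    have := hL (Z x n) (Z x k) (by rw [hZ0]) (by rw [hZ0]) (hZ x n)
      ((hZ x k).mono (Nat.cast_le.mpr hnk)) t ht
    rw [hZ0, hZ0, dist_self, mul_zero] at this
    exact dist_le_zero.mp this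
  choose X hXZ hX using fun x => exists_hasDerivAt_of_forall_isTrajectoryOn (hZ x) (h_unique x)
  have hX0 : ∀ x, X x 0 = x := fun x => by rw [hXZ x 0 (by simp), hZ0]
  refine ⟨X, hX0, hX, fun T R => ?_⟩
  obtain ⟨L, hL0, hL⟩ := hv.exists_dist_le T R
  refine ⟨L, hL0, fun x y hx hy t ht => ?_⟩
  have h_traj : ∀ z, IsTrajectoryOn v (X z) T := fun z t ht => (hX z t ht.1).hasDerivWithinAt
  simpa only [hX0] using
    hL (X x) (X y) (by rwa [hX0]) (by rwa [hX0]) (h_traj x) (h_traj y) t ht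

end GlobalFlow

section ProfileField

lemma abs_rpow_neg_sub_le {m x y : ℝ} (hm : 0 ≤ m) (hx : 1 ≤ x) (hy : 1 ≤ y) :
    |x ^ (-m) - y ^ (-m)| ≤ m * |x - y| := by
  refine (convex_Ici (1 : ℝ)).norm_image_sub_le_of_norm_hasDerivWithin_le
    (f := fun x : ℝ => x ^ (-m)) (f' := fun x => -m * x ^ (-m - 1))
    (fun z hz => ?_) (fun z hz => ?_) hy hx
  · exact (Real.hasDerivAt_rpow_const
      (Or.inl (zero_lt_one.trans_le (mem_Ici.mp hz)).ne')).hasDerivWithinAt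
  · have hz0 : 0 < z := zero_lt_one.trans_le hz
    rw [norm_mul, norm_neg, Real.norm_of_nonneg hm, Real.norm_of_nonneg (by positivity)]
    exact mul_le_of_le_one_right hm (Real.rpow_le_one_of_one_le_of_nonpos hz (by linarith))

lemma abs_mul_rpow_neg_sub_le {m a b x y : ℝ} (hm : 0 ≤ m) (hx : 1 ≤ x) (hy : 1 ≤ y) :
    |a * x ^ (-m) - b * y ^ (-m)| ≤ |a - b| + |b| * (m * |x - y|) := by
  have hx1 : x ^ (-m) ≤ 1 := Real.rpow_le_one_of_one_le_of_nonpos hx (by linarith)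
  have hx0 : 0 ≤ x ^ (-m) := by positivity
  calc |a * x ^ (-m) - b * y ^ (-m)| = |(a - b) * x ^ (-m) + b * (x ^ (-m) - y ^ (-m))| := by
        ring_nf
    _ ≤ |a - b| * x ^ (-m) + |b| * |x ^ (-m) - y ^ (-m)| := by
        refine (abs_add_le _ _).trans_eq ?_
        rw [abs_mul, abs_mul, abs_of_nonneg hx0]
    _ ≤ |a - b| + |b| * (m * |x - y|) := by
        gcongr
        · exact mul_le_of_le_one_right (abs_nonneg _) hx1
        · exact abs_rpow_neg_sub_le hm hx hy

lemma abs_mul_sub_sub_le (t a b x y : ℝ) :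
    |(t * a - x) - (t * b - y)| ≤ |t| * |a - b| + |x - y| := by
  calc |(t * a - x) - (t * b - y)| = |t * (a - b) - (x - y)| := by ring_nf
    _ ≤ |t * (a - b)| + |x - y| := abs_sub _ _
    _ = |t| * |a - b| + |x - y| := by rw [abs_mul]

lemma norm_prod_four_le_iff {X : ℝ × ℝ × ℝ × ℝ} {r : ℝ} :
    ‖X‖ ≤ r ↔ |X.1| ≤ r ∧ |X.2.1| ≤ r ∧ |X.2.2.1| ≤ r ∧ |X.2.2.2| ≤ r := by
  simp only [Prod.norm_def, Real.norm_eq_abs, max_le_iff]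

/-- The first-order system for `(f, f', f'', f ^ m f''')` when `α = 1`, with `f ^ (-m)` replaced by
`1` where `f < 1`. The modification makes the flow global; it is invisible along nondecreasing
solutions, for which `f ≥ f 0 = 1`. -/
noncomputable def profileField (m t : ℝ) (X : ℝ × ℝ × ℝ × ℝ) : ℝ × ℝ × ℝ × ℝ :=
  (X.2.1, X.2.2.1, X.2.2.2 * (max X.1 1) ^ (-m), t * X.2.1 - X.1)

variable {m : ℝ}

lemma norm_profileField_sub_le (hm : 0 ≤ m) (t : ℝ) (X Y : ℝ × ℝ × ℝ × ℝ) :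
    ‖profileField m t X - profileField m t Y‖ ≤ (1 + |t| + ‖Y‖ * m) * ‖X - Y‖ := by
  obtain ⟨h₁, h₂, h₃, h₄⟩ := norm_prod_four_le_iff.mp (le_refl ‖X - Y‖)
  obtain ⟨-, -, -, hY⟩ := norm_prod_four_le_iff.mp (le_refl ‖Y‖)
  have h_max : |max X.1 1 - max Y.1 1| ≤ ‖X - Y‖ := (abs_max_sub_max_le_abs _ _ _).trans h₁
  have h_le : ‖X - Y‖ ≤ (1 + |t| + ‖Y‖ * m) * ‖X - Y‖ :=
    le_mul_of_one_le_left (norm_nonneg _)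
      (by linarith [abs_nonneg t, mul_nonneg (norm_nonneg Y) hm])
  refine norm_prod_four_le_iff.mpr ⟨h₂.trans h_le, h₃.trans h_le, ?_, ?_⟩
  · calc |X.2.2.2 * (max X.1 1) ^ (-m) - Y.2.2.2 * (max Y.1 1) ^ (-m)|
        ≤ |X.2.2.2 - Y.2.2.2| + |Y.2.2.2| * (m * |max X.1 1 - max Y.1 1|) :=
          abs_mul_rpow_neg_sub_le hm (le_max_right _ _) (le_max_right _ _)
      _ ≤ ‖X - Y‖ + ‖Y‖ * (m * ‖X - Y‖) := by gcongr; exact h₄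
      _ ≤ (1 + |t| + ‖Y‖ * m) * ‖X - Y‖ := by
          linarith [mul_nonneg (abs_nonneg t) (norm_nonneg (X - Y))]
  · calc |(t * X.2.1 - X.1) - (t * Y.2.1 - Y.1)|
        ≤ |t| * |X.2.1 - Y.2.1| + |X.1 - Y.1| := abs_mul_sub_sub_le _ _ _ _ _
      _ ≤ |t| * ‖X - Y‖ + ‖X - Y‖ := by gcongr; exacts [h₂, h₁]
      _ ≤ (1 + |t| + ‖Y‖ * m) * ‖X - Y‖ := by
          linarith [mul_nonneg (mul_nonneg (norm_nonneg Y) hm) (norm_nonneg (X - Y))]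

lemma profileField_zero (m t : ℝ) : profileField m t 0 = 0 := by
  simp [profileField]

lemma profileField_isLinearGrowthField (hm : 0 ≤ m) : IsLinearGrowthField (profileField m) where
  continuous_time x := by unfold profileField; fun_prop
  lipschitz T R := by
    refine ⟨(1 + T + R * m).toNNReal, fun t ht => LipschitzOnWith.of_dist_le_mul fun X _ Y hY => ?_⟩
    rw [mem_closedBall_zero_iff] at hY
    have hT : |t| ≤ T := by rw [abs_of_nonneg ht.1]; exact ht.2
    rw [dist_eq_norm, dist_eq_norm]
    refine (norm_profileField_sub_le hm t X Y).trans ?_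
    gcongr
    refine le_trans ?_ (Real.le_coe_toNNReal _)
    gcongr
  growth T := by
    refine ⟨1 + |T|, by positivity, fun t ht X => ?_⟩
    have hT : |t| ≤ |T| := abs_le_abs_of_nonneg ht.1 ht.2
    have h := norm_profileField_sub_le hm t X 0
    simp only [profileField_zero, sub_zero, norm_zero, zero_mul, add_zero] at h
    exact h.trans (by gcongr)

/-- `(f, p, u, g)` is a trajectory of `profileField m` on `[0,∞)` starting from `(1, 0, κ, 0)`. In
the problem with `α = 1` this means `p = f'`, `u = f''`, `g = f ^ m f'''`, and `h = t f' - f` and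
`r = f ^ (-m)` are the two nonlinear combinations through which the system is coupled. -/
structure IsProfileTrajectory (m κ : ℝ) (f p u g h r : ℝ → ℝ) : Prop where
  h_eq : ∀ t, h t = t * p t - f t
  r_eq : ∀ t, r t = (max (f t) 1) ^ (-m)
  hasDerivAt_f : ∀ {t}, 0 ≤ t → HasDerivAt f (p t) t
  hasDerivAt_p : ∀ {t}, 0 ≤ t → HasDerivAt p (u t) t
  hasDerivAt_u : ∀ {t}, 0 ≤ t → HasDerivAt u (g t * r t) t
  hasDerivAt_g : ∀ {t}, 0 ≤ t → HasDerivAt g (h t) t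
  f_zero : f 0 = 1
  p_zero : p 0 = 0
  u_zero : u 0 = κ
  g_zero : g 0 = 0

/-- The trajectories of `profileField m` starting from `(1, 0, κ, 0)`, as a family depending
continuously on the shooting parameter `κ`. -/
structure IsProfileFlow (m : ℝ) (f p u g h r : ℝ → ℝ → ℝ) : Prop where
  trajectory : ∀ κ, IsProfileTrajectory m κ (f κ) (p κ) (u κ) (g κ) (h κ) (r κ)
  tendsto_f : ∀ T κ, TendstoUniformlyOn f (f κ) (𝓝 κ) (Icc 0 T)
  tendsto_p : ∀ T κ, TendstoUniformlyOn p (p κ) (𝓝 κ) (Icc 0 T)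
  tendsto_u : ∀ T κ, TendstoUniformlyOn u (u κ) (𝓝 κ) (Icc 0 T)
  tendsto_g : ∀ T κ, TendstoUniformlyOn g (g κ) (𝓝 κ) (Icc 0 T)

lemma exists_isProfileFlow (hm : 0 ≤ m) : ∃ f p u g h r : ℝ → ℝ → ℝ,
    IsProfileFlow m f p u g h r := by
  obtain ⟨X, hX0, hX, hX_dist⟩ := (profileField_isLinearGrowthField hm).exists_flow
  let x : ℝ → ℝ × ℝ × ℝ × ℝ := fun κ => (1, 0, κ, 0)
  have hx : ∀ κ, X (x κ) 0 = (1, 0, κ, 0) := fun κ => hX0 (x κ)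
  have h_unif : ∀ T κ, TendstoUniformlyOn (fun κ => X (x κ)) (X (x κ)) (𝓝 κ) (Icc 0 T) := by
    refine fun T κ₀ => Metric.tendstoUniformlyOn_iff.mpr fun ε hε => ?_
    obtain ⟨L, hL0, hL⟩ := hX_dist T (|κ₀| + 1)
    have h_norm : ∀ κ, |κ| ≤ |κ₀| + 1 → ‖x κ‖ ≤ |κ₀| + 1 := fun κ hκ =>
      norm_prod_four_le_iff.mpr ⟨by simp [x], by simpa [x] using by positivity, hκ,
        by simpa [x] using by positivity⟩
    filter_upwards [Metric.ball_mem_nhds κ₀ (show 0 < min 1 (ε / L) by positivity)] with κ hκ t ht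
    rw [Metric.mem_ball, Real.dist_eq, lt_min_iff, lt_div_iff₀' hL0] at hκ
    have h_dist_x : dist (x κ) (x κ₀) = |κ - κ₀| := by
      simp [x, Prod.dist_eq, Real.dist_eq]
    rw [dist_comm]
    refine (hL (x κ) (x κ₀) (h_norm κ ?_) (h_norm κ₀ (by linarith)) t ht).trans_lt
      (by rw [h_dist_x]; exact hκ.2)
    linarith [abs_sub_abs_le_abs_sub κ κ₀, hκ.1]
  have h_snd := fun T κ => uniformContinuous_snd.comp_tendstoUniformlyOn (h_unif T κ)
  have h_snd_snd := fun T κ => uniformContinuous_snd.comp_tendstoUniformlyOn (h_snd T κ)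
  exact ⟨fun κ t => (X (x κ) t).1, fun κ t => (X (x κ) t).2.1, fun κ t => (X (x κ) t).2.2.1,
    fun κ t => (X (x κ) t).2.2.2, _, _,
    { trajectory := fun κ =>
        { h_eq := fun _ => rfl
          r_eq := fun _ => rfl
          hasDerivAt_f := fun ht => (hX (x κ) _ ht).fst
          hasDerivAt_p := fun ht => (hX (x κ) _ ht).snd.fst
          hasDerivAt_u := fun ht => (hX (x κ) _ ht).snd.snd.fst
          hasDerivAt_g := fun ht => (hX (x κ) _ ht).snd.snd.snd
          f_zero := by simp only [hx]
          p_zero := by simp only [hx]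
          u_zero := by simp only [hx]
          g_zero := by simp only [hx] }
      tendsto_f := fun T κ => uniformContinuous_fst.comp_tendstoUniformlyOn (h_unif T κ)
      tendsto_p := fun T κ => uniformContinuous_fst.comp_tendstoUniformlyOn (h_snd T κ)
      tendsto_u := fun T κ => uniformContinuous_fst.comp_tendstoUniformlyOn (h_snd_snd T κ)
      tendsto_g := fun T κ => uniformContinuous_snd.comp_tendstoUniformlyOn (h_snd_snd T κ) }⟩

end ProfileField

section Calculus

variable {φ φ' ψ ψ' : ℝ → ℝ} {a b c t : ℝ}

lemma le_of_hasDerivAt_nonneg (hab : a ≤ b) (hd : ∀ t ∈ Icc a b, HasDerivAt φ (φ' t) t)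
    (h : ∀ t ∈ Ioo a b, 0 ≤ φ' t) : φ a ≤ φ b := by
  refine monotoneOn_of_hasDerivWithinAt_nonneg (f' := φ') (convex_Icc a b)
    (fun t ht => (hd t ht).continuousAt.continuousWithinAt)
    (fun t ht => (hd t (interior_subset ht)).hasDerivWithinAt) ?_
    (left_mem_Icc.mpr hab) (right_mem_Icc.mpr hab) hab
  rwa [interior_Icc]

lemma lt_of_hasDerivAt_pos (hab : a < b) (hd : ∀ t ∈ Icc a b, HasDerivAt φ (φ' t) t)
    (h : ∀ t ∈ Ioo a b, 0 < φ' t) : φ a < φ b := by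
  refine strictMonoOn_of_hasDerivWithinAt_pos (f' := φ') (convex_Icc a b)
    (fun t ht => (hd t ht).continuousAt.continuousWithinAt)
    (fun t ht => (hd t (interior_subset ht)).hasDerivWithinAt) ?_
    (left_mem_Icc.mpr hab.le) (right_mem_Icc.mpr hab.le) hab
  rwa [interior_Icc]

lemma sub_le_sub_of_hasDerivAt_le (hab : a ≤ b) (hφ : ∀ t ∈ Icc a b, HasDerivAt φ (φ' t) t)
    (hψ : ∀ t ∈ Icc a b, HasDerivAt ψ (ψ' t) t) (h : ∀ t ∈ Ioo a b, φ' t ≤ ψ' t) :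
    φ b - φ a ≤ ψ b - ψ a := by
  have := le_of_hasDerivAt_nonneg hab (fun t ht => (hψ t ht).sub (hφ t ht))
    fun t ht => sub_nonneg.mpr (h t ht)
  simp only [Pi.sub_apply] at this
  linarith

lemma abs_sub_le_of_abs_hasDerivAt_le (hab : a ≤ b) (hφ : ∀ t ∈ Icc a b, HasDerivAt φ (φ' t) t)
    (hψ : ∀ t ∈ Icc a b, HasDerivAt ψ (ψ' t) t) (h : ∀ t ∈ Ioo a b, |φ' t| ≤ ψ' t) :
    |φ b - φ a| ≤ ψ b - ψ a := by
  have h_neg := sub_le_sub_of_hasDerivAt_le hab (fun t ht => (hφ t ht).neg) hψ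
    fun t ht => (neg_le_abs _).trans (h t ht)
  simp only [Pi.neg_apply] at h_neg
  exact abs_sub_le_iff.mpr ⟨sub_le_sub_of_hasDerivAt_le hab hφ hψ
    fun t ht => (le_abs_self _).trans (h t ht), by linarith⟩

lemma add_mul_le_of_le_hasDerivAt (hab : a ≤ b) (hd : ∀ t ∈ Icc a b, HasDerivAt φ (φ' t) t)
    (h : ∀ t ∈ Ioo a b, c ≤ φ' t) : φ a + c * (b - a) ≤ φ b := by
  have := sub_le_sub_of_hasDerivAt_le hab (fun t _ => (hasDerivAt_id t).const_mul c) hd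
    (by simpa only [mul_one] using h)
  simp only [id_eq] at this
  linarith

lemma exists_pos_of_le_hasDerivAt (hc : 0 < c) (hd : ∀ t ≥ a, HasDerivAt φ (φ' t) t)
    (h : ∀ t ≥ a, c ≤ φ' t) : ∃ t ≥ a, 0 < φ t := by
  have h_nonneg : 0 ≤ (|φ a| + 1) / c := by positivity
  have h_le := add_mul_le_of_le_hasDerivAt (b := a + (|φ a| + 1) / c) (by linarith)
    (fun t ht => hd t ht.1) fun t ht => h t ht.1.le
  rw [add_sub_cancel_left, mul_div_cancel₀ _ hc.ne'] at h_le
  exact ⟨a + (|φ a| + 1) / c, by linarith, by linarith [neg_abs_le (φ a)]⟩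

lemma eventually_pos_of_eventually_deriv_pos (ha : 0 ≤ φ a)
    (hd : ∀ t ≥ a, HasDerivAt φ (φ' t) t) (h : ∀ᶠ t in 𝓝[>] a, 0 < φ' t) :
    ∀ᶠ t in 𝓝[>] a, 0 < φ t := by
  obtain ⟨b, hab, hb⟩ := mem_nhdsGT_iff_exists_Ioo_subset.mp h
  filter_upwards [Ioo_mem_nhdsGT hab] with t ht
  exact ha.trans_lt (lt_of_hasDerivAt_pos ht.1 (fun s hs => hd s hs.1)
    fun s hs => hb ⟨hs.1, hs.2.trans ht.2⟩)

lemma exists_first_zero (hφ : ContinuousOn φ (Icc a b)) (hab : a ≤ b) (ha : 0 < φ a)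
    (hb : φ b ≤ 0) : ∃ c ∈ Ioc a b, φ c = 0 ∧ ∀ t ∈ Ico a c, 0 < φ t := by
  have exists_zero : ∀ t ∈ Icc a b, φ t ≤ 0 → ∃ s ∈ Icc a t, φ s = 0 := fun t ht hle =>
    intermediate_value_Icc' ht.1 (hφ.mono (Icc_subset_Icc_right ht.2)) ⟨hle, ha.le⟩
  obtain ⟨c, ⟨hc, hφc⟩, hmin⟩ :=
    (hφ.preimage_isClosed_of_isClosed isClosed_Icc (isClosed_singleton (x := (0 : ℝ)))
      |> isCompact_Icc.of_isClosed_subset <| inter_subset_left).exists_isLeast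
      (exists_zero b (right_mem_Icc.mpr hab) hb)
  refine ⟨c, ⟨hc.1.lt_of_ne ?_, hc.2⟩, hφc, fun t ht => ?_⟩
  · rintro rfl
    exact ha.ne' hφc
  · by_contra! hle
    obtain ⟨s, hs, hφs⟩ := exists_zero t ⟨ht.1, ht.2.le.trans hc.2⟩ hle
    exact (hmin ⟨⟨hs.1, hs.2.trans (ht.2.le.trans hc.2)⟩, hφs⟩).not_gt (hs.2.trans_lt ht.2)

lemma pos_of_bootstrap (hφ : ContinuousOn φ (Icc a b)) (ha : 0 < φ a)
    (step : ∀ t ∈ Ioc a b, (∀ s ∈ Ico a t, 0 < φ s) → 0 < φ t) : ∀ t ∈ Icc a b, 0 < φ t := by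
  intro t ht
  by_contra! hle
  obtain ⟨c, hc, hφc, hpos⟩ :=
    exists_first_zero (hφ.mono (Icc_subset_Icc_right ht.2)) ht.1 ha hle
  exact (step c ⟨hc.1, hc.2.trans ht.2⟩ hpos).ne' hφc

lemma pos_of_continuousOn_ne_zero (hφ : ContinuousOn φ (Ici a)) (ha : 0 < φ a)
    (hne : ∀ t ≥ a, φ t ≠ 0) (hat : a ≤ t) : 0 < φ t := by
  by_contra! hle
  obtain ⟨c, hc, hφc, -⟩ := exists_first_zero (hφ.mono Icc_subset_Ici_self) hat ha hle
  exact hne c hc.1.le hφc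

lemma neg_of_continuousOn_ne_zero (hφ : ContinuousOn φ (Ici a)) (ha : φ a < 0)
    (hne : ∀ t ≥ a, φ t ≠ 0) (hat : a ≤ t) : φ t < 0 :=
  neg_pos.mp <| pos_of_continuousOn_ne_zero (φ := -φ) hφ.neg (neg_pos.mpr ha)
    (fun s hs => neg_ne_zero.mpr (hne s hs)) hat

lemma tendsto_div_id_of_tendsto_deriv {l : ℝ} (hd : ∀ t ≥ a, HasDerivAt φ (φ' t) t)
    (h : Tendsto φ' atTop (𝓝 l)) : Tendsto (fun t => φ t / t) atTop (𝓝 l) := by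
  suffices h_sub : (fun t => φ t - l * t) =o[atTop] id by
    have h_div := h_sub.tendsto_div_nhds_zero.add_const l
    rw [zero_add] at h_div
    refine h_div.congr' ?_
    filter_upwards [eventually_gt_atTop 0] with t ht
    rw [id_eq, sub_div, mul_div_cancel_right₀ _ ht.ne', sub_add_cancel]
  refine isLittleO_iff.mpr fun ε hε => ?_
  obtain ⟨N, hN⟩ := Metric.tendsto_atTop.mp h (ε / 2) (half_pos hε)
  set M := max N (max a 0)
  have hM : N ≤ M ∧ a ≤ M ∧ 0 ≤ M := by simp [M]
  have h_const := (isLittleO_const_id_atTop (φ M - l * M)).def (half_pos hε)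
  filter_upwards [h_const, eventually_ge_atTop M] with t h_const ht
  have h_mean := Convex.norm_image_sub_le_of_norm_hasDerivWithin_le
    (f := fun s => φ s - l * s) (f' := fun s => φ' s - l) (C := ε / 2) (x := M) (y := t)
    (fun s hs => ((hd s (hM.2.1.trans hs.1)).sub
      (by simpa using (hasDerivAt_id s).const_mul l)).hasDerivWithinAt)
    (fun s hs => (hN s (hM.1.trans hs.1)).le) (convex_Icc M t) (left_mem_Icc.mpr ht)
    (right_mem_Icc.mpr ht)
  rw [id_eq, Real.norm_of_nonneg (hM.2.2.trans ht)] at h_const ⊢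
  rw [Real.norm_of_nonneg (sub_nonneg.mpr ht)] at h_mean
  have h_tri := norm_le_norm_add_norm_sub' (φ t - l * t) (φ M - l * M)
  linarith [mul_nonneg (half_pos hε).le hM.2.2]

lemma exists_tendsto_of_monotoneOn_Ici (hφ : MonotoneOn φ (Ici a)) (hc : ∀ t ≥ a, φ t ≤ c) :
    ∃ l, Tendsto φ atTop (𝓝 l) := by
  have mono : Monotone fun t => φ (max t a) := fun s t hst =>
    hφ (le_max_right s a) (le_max_right t a) (max_le_max_right a hst)
  refine ⟨_, (tendsto_atTop_ciSup mono ⟨c, ?_⟩).congr' ?_⟩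
  · rintro _ ⟨t, rfl⟩
    exact hc _ (le_max_right t a)
  · filter_upwards [eventually_ge_atTop a] with t ht
    rw [max_eq_left ht]

lemma exists_tendsto_of_abs_sub_le (h : ∀ t ≥ a, ∀ T ≥ t, |φ T - φ t| ≤ ψ T - ψ t)
    (hc : ∀ t ≥ a, ψ t ≤ c) : ∃ l, Tendsto φ atTop (𝓝 l) := by
  obtain ⟨l₁, hl₁⟩ := exists_tendsto_of_monotoneOn_Ici (fun t ht T _ htT =>
    sub_nonneg.mp ((abs_nonneg _).trans (h t ht T htT))) hc
  obtain ⟨l₂, hl₂⟩ := exists_tendsto_of_monotoneOn_Ici (φ := φ + ψ) (a := a)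
    (c := φ a + 2 * c - ψ a)
    (fun t ht T _ htT => by
      simp only [Pi.add_apply]
      linarith [(abs_le.mp (h t ht T htT)).1])
    fun t ht => by
      simp only [Pi.add_apply]
      linarith [(abs_le.mp (h a le_rfl t ht)).2, hc t ht]
  exact ⟨l₂ - l₁, (hl₂.sub hl₁).congr fun t => by simp⟩

end Calculus

section Triad

/-- The cyclic positive-feedback system `h' = t u`, `u' = r g`, `g' = h` on `[0,∞)` with `r > 0`. -/
structure IsTriad (r h u g : ℝ → ℝ) : Prop where
  r_pos : ∀ {t}, 0 ≤ t → 0 < r t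
  hasDerivAt_h : ∀ {t}, 0 ≤ t → HasDerivAt h (t * u t) t
  hasDerivAt_u : ∀ {t}, 0 ≤ t → HasDerivAt u (g t * r t) t
  hasDerivAt_g : ∀ {t}, 0 ≤ t → HasDerivAt g (h t) t

/-- The Lyapunov function of a triad, nondecreasing on `(0,∞)` as long as `r` is nonincreasing. -/
noncomputable def lyap (u g h r : ℝ → ℝ) (t : ℝ) : ℝ :=
  t * (h t * u t - g t ^ 2 * r t / 2) - 3 / 4 * h t ^ 2 / t + u t * g t / 2

lemma zero_lt_prod_three_iff {x y z : ℝ} :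
    (0 : ℝ × ℝ × ℝ) < (x, y, z) ↔ 0 ≤ x ∧ 0 ≤ y ∧ 0 ≤ z ∧ (0 < x ∨ 0 < y ∨ 0 < z) := by
  simp only [Prod.lt_iff, Prod.le_def, Prod.fst_zero, Prod.snd_zero]
  grind

lemma prod_three_lt_zero_iff {x y z : ℝ} :
    (x, y, z) < (0 : ℝ × ℝ × ℝ) ↔ x ≤ 0 ∧ y ≤ 0 ∧ z ≤ 0 ∧ (x < 0 ∨ y < 0 ∨ z < 0) := by
  simp only [Prod.lt_iff, Prod.le_def, Prod.fst_zero, Prod.snd_zero]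
  grind

namespace IsTriad

variable {r h u g : ℝ → ℝ} {T t : ℝ}

lemma neg (H : IsTriad r h u g) : IsTriad r (-h) (-u) (-g) where
  r_pos := H.r_pos
  hasDerivAt_h ht := by simpa using (H.hasDerivAt_h ht).neg
  hasDerivAt_u ht := by simpa using (H.hasDerivAt_u ht).neg
  hasDerivAt_g ht := by simpa using (H.hasDerivAt_g ht).neg

lemma continuousOn_h (H : IsTriad r h u g) : ContinuousOn h (Ici 0) := fun _ ht =>
  (H.hasDerivAt_h ht).continuousAt.continuousWithinAt

lemma continuousOn_u (H : IsTriad r h u g) : ContinuousOn u (Ici 0) := fun _ ht =>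
  (H.hasDerivAt_u ht).continuousAt.continuousWithinAt

lemma continuousOn_g (H : IsTriad r h u g) : ContinuousOn g (Ici 0) := fun _ ht =>
  (H.hasDerivAt_g ht).continuousAt.continuousWithinAt

lemma le_of_forall_pos (H : IsTriad r h u g) (hT : 0 ≤ T) (hTt : T ≤ t)
    (hpos : ∀ s ∈ Ioo T t, 0 < h s ∧ 0 < u s ∧ 0 < g s) :
    h T ≤ h t ∧ u T ≤ u t ∧ g T ≤ g t := by
  refine ⟨le_of_hasDerivAt_nonneg hTt (fun s hs => H.hasDerivAt_h (hT.trans hs.1)) fun s hs => ?_,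
    le_of_hasDerivAt_nonneg hTt (fun s hs => H.hasDerivAt_u (hT.trans hs.1)) fun s hs => ?_,
    le_of_hasDerivAt_nonneg hTt (fun s hs => H.hasDerivAt_g (hT.trans hs.1)) fun s hs => ?_⟩
  · exact mul_nonneg (hT.trans hs.1.le) (hpos s hs).2.1.le
  · exact mul_nonneg (hpos s hs).2.2.le (H.r_pos (hT.trans hs.1.le)).le
  · exact (hpos s hs).1.le

lemma le_of_pos (H : IsTriad r h u g) (hT : 0 ≤ T) (hh : 0 < h T) (hu : 0 < u T) (hg : 0 < g T)
    (hTt : T ≤ t) : h T ≤ h t ∧ u T ≤ u t ∧ g T ≤ g t := by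
  have h_sub : Icc T t ⊆ Ici 0 := Icc_subset_Ici_self.trans (Ici_subset_Ici.mpr hT)
  have hpos := pos_of_bootstrap (φ := fun s => min (h s) (min (u s) (g s)))
    ((H.continuousOn_h.mono h_sub).inf
      ((H.continuousOn_u.mono h_sub).inf (H.continuousOn_g.mono h_sub)))
    (lt_min hh (lt_min hu hg)) fun s hs hpos => by
      obtain ⟨hh', hu', hg'⟩ := H.le_of_forall_pos hT hs.1.le fun x hx => by
        simpa only [lt_min_iff] using hpos x (Ioo_subset_Ico_self hx)
      exact lt_min (hh.trans_le hh') (lt_min (hu.trans_le hu') (hg.trans_le hg'))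
  exact H.le_of_forall_pos hT hTt fun s hs => by
    simpa only [lt_min_iff] using hpos s (Ioo_subset_Icc_self hs)

lemma eventually_pos (H : IsTriad r h u g) (hT : 0 ≤ T)
    (h_lt : (0 : ℝ × ℝ × ℝ) < (h T, u T, g T)) :
    ∀ᶠ t in 𝓝[>] T, 0 < h t ∧ 0 < u t ∧ 0 < g t := by
  obtain ⟨hh, hu, hg, h_or⟩ := zero_lt_prod_three_iff.mp h_lt
  have nonneg : ∀ t ≥ T, 0 ≤ t := fun t ht => hT.trans ht
  have pos : ∀ᶠ t in 𝓝[>] T, 0 < t := by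
    filter_upwards [self_mem_nhdsWithin] with t ht using hT.trans_lt ht
  have h_of_u : (∀ᶠ t in 𝓝[>] T, 0 < u t) → ∀ᶠ t in 𝓝[>] T, 0 < h t := fun hu' =>
    eventually_pos_of_eventually_deriv_pos hh (fun t ht => H.hasDerivAt_h (nonneg t ht)) <| by
      filter_upwards [hu', pos] with t hut ht using mul_pos ht hut
  have u_of_g : (∀ᶠ t in 𝓝[>] T, 0 < g t) → ∀ᶠ t in 𝓝[>] T, 0 < u t := fun hg' =>
    eventually_pos_of_eventually_deriv_pos hu (fun t ht => H.hasDerivAt_u (nonneg t ht)) <| by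
      filter_upwards [hg', pos] with t hgt ht using mul_pos hgt (H.r_pos ht.le)
  have g_of_h : (∀ᶠ t in 𝓝[>] T, 0 < h t) → ∀ᶠ t in 𝓝[>] T, 0 < g t :=
    eventually_pos_of_eventually_deriv_pos hg (fun t ht => H.hasDerivAt_g (nonneg t ht))
  have near : ∀ {φ : ℝ → ℝ}, ContinuousAt φ T → 0 < φ T → ∀ᶠ t in 𝓝[>] T, 0 < φ t :=
    fun hφ hpos => nhdsWithin_le_nhds (hφ.eventually_const_lt hpos)
  rcases h_or with hpos | hpos | hpos
  · have hh' := near (H.hasDerivAt_h hT).continuousAt hpos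
    exact hh'.and ((u_of_g (g_of_h hh')).and (g_of_h hh'))
  · have hu' := near (H.hasDerivAt_u hT).continuousAt hpos
    exact (h_of_u hu').and (hu'.and (g_of_h (h_of_u hu')))
  · have hg' := near (H.hasDerivAt_g hT).continuousAt hpos
    exact (h_of_u (u_of_g hg')).and ((u_of_g hg').and hg')

lemma pos_of_nonneg (H : IsTriad r h u g) (hT : 0 ≤ T)
    (h_lt : (0 : ℝ × ℝ × ℝ) < (h T, u T, g T)) (hTt : T < t) :
    0 < h t ∧ 0 < u t ∧ 0 < g t := by
  obtain ⟨s, ⟨hh, hu, hg⟩, hs⟩ := ((H.eventually_pos hT h_lt).and (Ioo_mem_nhdsGT hTt)).exists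
  obtain ⟨hh', hu', hg'⟩ := H.le_of_pos (hT.trans hs.1.le) hh hu hg hs.2.le
  exact ⟨hh.trans_le hh', hu.trans_le hu', hg.trans_le hg'⟩

lemma neg_of_nonpos (H : IsTriad r h u g) (hT : 0 ≤ T)
    (h_lt : (h T, u T, g T) < (0 : ℝ × ℝ × ℝ)) (hTt : T < t) :
    h t < 0 ∧ u t < 0 ∧ g t < 0 := by
  simpa using H.neg.pos_of_nonneg hT (by simpa using neg_pos.mpr h_lt) hTt

lemma ne_zero_of_lyap_pos (H : IsTriad r h u g) (ht : 0 < t)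
    (hpos : ¬ (0 : ℝ × ℝ × ℝ) < (h t, u t, g t)) (hneg : ¬ (h t, u t, g t) < (0 : ℝ × ℝ × ℝ))
    (hl : 0 < lyap u g h r t) : h t ≠ 0 ∧ u t ≠ 0 ∧ g t ≠ 0 := by
  rw [← neg_pos, Prod.neg_mk, Prod.neg_mk] at hneg
  rw [zero_lt_prod_three_iff] at hpos hneg
  have hr := H.r_pos ht.le
  have h_gg : 0 ≤ t * (g t ^ 2 * r t / 2) := by positivity
  have h_hh : 0 ≤ 3 / 4 * h t ^ 2 / t := by positivity
  unfold lyap at hl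
  refine ⟨fun h0 => ?_, fun u0 => ?_, fun g0 => ?_⟩
  · rw [h0] at hl h_hh
    have h_ug : 0 < u t * g t := by linarith
    rcases pos_and_pos_or_neg_and_neg_of_mul_pos h_ug with ⟨hu, hg⟩ | ⟨hu, hg⟩
    · exact hpos ⟨h0.ge, hu.le, hg.le, .inr (.inl hu)⟩
    · exact hneg ⟨by simp [h0], by linarith, by linarith, .inr (.inl (by linarith))⟩
  · rw [u0] at hl
    linarith
  · rw [g0] at hl
    have h_hu : 0 < h t * u t := pos_of_mul_pos_right (by linarith : 0 < t * (h t * u t)) ht.le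
    rcases pos_and_pos_or_neg_and_neg_of_mul_pos h_hu with ⟨hh, hu⟩ | ⟨hh, hu⟩
    · exact hpos ⟨hh.le, hu.le, g0.ge, .inl hh⟩
    · exact hneg ⟨by linarith, by linarith, by simp [g0], .inl (by linarith)⟩

lemma h_mul_g_pos_of_u_pos (H : IsTriad r h u g) (hT : 0 < T)
    (hne : ∀ t ≥ T, h t ≠ 0 ∧ u t ≠ 0 ∧ g t ≠ 0) (hu : 0 < u T) : 0 < h T * g T := by
  have h_sub : Ici T ⊆ Ici 0 := Ici_subset_Ici.mpr hT.le
  have nonneg : ∀ t ≥ T, 0 ≤ t := fun t ht => hT.le.trans ht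
  have u_pos : ∀ t ≥ T, 0 < u t := fun t =>
    pos_of_continuousOn_ne_zero (H.continuousOn_u.mono h_sub) hu fun s hs => (hne s hs).2.1
  by_contra! hle
  rcases mul_neg_iff.mp (hle.lt_of_ne (mul_ne_zero (hne T le_rfl).1 (hne T le_rfl).2.2)) with
    ⟨hh, hg⟩ | ⟨hh, hg⟩
  · have h_le : ∀ t ≥ T, h T ≤ h t := fun t ht =>
      le_of_hasDerivAt_nonneg ht (fun s hs => H.hasDerivAt_h (nonneg s hs.1)) fun s hs =>
        (mul_pos (hT.trans hs.1) (u_pos s hs.1.le)).le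
    obtain ⟨t, ht, hgt⟩ := exists_pos_of_le_hasDerivAt hh
      (fun s hs => H.hasDerivAt_g (nonneg s hs)) h_le
    exact hgt.not_gt (neg_of_continuousOn_ne_zero (H.continuousOn_g.mono h_sub) hg
      (fun s hs => (hne s hs).2.2) ht)
  · have g_pos : ∀ t ≥ T, 0 < g t := fun t =>
      pos_of_continuousOn_ne_zero (H.continuousOn_g.mono h_sub) hg fun s hs => (hne s hs).2.2
    have u_le : ∀ t ≥ T, u T ≤ u t := fun t ht =>
      le_of_hasDerivAt_nonneg ht (fun s hs => H.hasDerivAt_u (nonneg s hs.1)) fun s hs =>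
        (mul_pos (g_pos s hs.1.le) (H.r_pos (nonneg s hs.1.le))).le
    obtain ⟨t, ht, hht⟩ := exists_pos_of_le_hasDerivAt (mul_pos hT hu)
      (fun s hs => H.hasDerivAt_h (nonneg s hs))
      fun s hs => mul_le_mul hs (u_le s hs) hu.le (nonneg s hs)
    exact hht.not_gt (neg_of_continuousOn_ne_zero (H.continuousOn_h.mono h_sub) hh
      (fun s hs => (hne s hs).1) ht)

lemma h_mul_g_pos (H : IsTriad r h u g) (hT : 0 < T)
    (hne : ∀ t ≥ T, h t ≠ 0 ∧ u t ≠ 0 ∧ g t ≠ 0) : 0 < h T * g T := by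
  rcases (hne T le_rfl).2.1.lt_or_gt with hu | hu
  · simpa using H.neg.h_mul_g_pos_of_u_pos hT (by simpa using hne) (by simpa using hu)
  · exact H.h_mul_g_pos_of_u_pos hT hne hu

lemma exists_lyap_nonpos (H : IsTriad r h u g) (hT : 0 < T)
    (hpos : ∀ t ≥ T, ¬ (0 : ℝ × ℝ × ℝ) < (h t, u t, g t))
    (hneg : ∀ t ≥ T, ¬ (h t, u t, g t) < (0 : ℝ × ℝ × ℝ)) :
    ∃ t ≥ T, lyap u g h r t ≤ 0 := by
  by_contra! hl
  have hne : ∀ t ≥ T, h t ≠ 0 ∧ u t ≠ 0 ∧ g t ≠ 0 := fun t ht =>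
    H.ne_zero_of_lyap_pos (hT.trans_le ht) (hpos t ht) (hneg t ht) (hl t ht)
  have lyap_T := hl T le_rfl
  have not_opposite : ¬ (h T * u T < 0 ∧ u T * g T < 0) := fun ⟨h_hu, h_ug⟩ => by
    have hr := H.r_pos hT.le
    have h_gg : 0 ≤ T * (g T ^ 2 * r T / 2) := by positivity
    have h_hh : 0 ≤ 3 / 4 * h T ^ 2 / T := by positivity
    unfold lyap at lyap_T
    linarith [mul_neg_of_pos_of_neg hT h_hu, h_ug]
  have hpos_T := hpos T le_rfl
  have hneg_T := hneg T le_rfl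
  rw [← neg_pos, Prod.neg_mk, Prod.neg_mk] at hneg_T
  rw [zero_lt_prod_three_iff] at hpos_T hneg_T
  rcases pos_and_pos_or_neg_and_neg_of_mul_pos (H.h_mul_g_pos hT hne) with ⟨hh, hg⟩ | ⟨hh, hg⟩ <;>
    rcases (hne T le_rfl).2.1.lt_or_gt with hu | hu
  · exact not_opposite ⟨mul_neg_of_pos_of_neg hh hu, mul_neg_of_neg_of_pos hu hg⟩
  · exact hpos_T ⟨hh.le, hu.le, hg.le, .inl hh⟩
  · exact hneg_T ⟨by linarith, by linarith, by linarith, .inl (by linarith)⟩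
  · exact not_opposite ⟨mul_neg_of_neg_of_pos hh hu, mul_neg_of_pos_of_neg hu hg⟩

end IsTriad

end Triad

section Shooting

variable {m κ t : ℝ}

namespace IsProfileTrajectory

variable {f p u g h r : ℝ → ℝ}

lemma r_pos (H : IsProfileTrajectory m κ f p u g h r) (t : ℝ) : 0 < r t := by
  rw [H.r_eq]
  positivity

lemma r_le_one (H : IsProfileTrajectory m κ f p u g h r) (hm : 0 ≤ m) (t : ℝ) : r t ≤ 1 := by
  rw [H.r_eq]
  exact Real.rpow_le_one_of_one_le_of_nonpos (le_max_right _ _) (neg_nonpos.mpr hm)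

lemma hasDerivAt_h (H : IsProfileTrajectory m κ f p u g h r) (ht : 0 ≤ t) :
    HasDerivAt h (t * u t) t := by
  rw [funext H.h_eq]
  exact (((hasDerivAt_id t).mul (H.hasDerivAt_p ht)).sub (H.hasDerivAt_f ht)).congr_deriv (by simp)

lemma h_zero (H : IsProfileTrajectory m κ f p u g h r) : h 0 = -1 := by
  rw [H.h_eq, H.f_zero]
  ring

lemma isTriad (H : IsProfileTrajectory m κ f p u g h r) : IsTriad r h u g where
  r_pos _ := H.r_pos _
  hasDerivAt_h := H.hasDerivAt_h
  hasDerivAt_u := H.hasDerivAt_u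
  hasDerivAt_g := H.hasDerivAt_g

lemma continuousOn_p (H : IsProfileTrajectory m κ f p u g h r) : ContinuousOn p (Ici 0) :=
  fun _ ht => (H.hasDerivAt_p ht).continuousAt.continuousWithinAt

lemma p_pos_of_forall_u_pos (H : IsProfileTrajectory m κ f p u g h r) (ht : 0 < t)
    (hu : ∀ s ∈ Ioo 0 t, 0 < u s) : 0 < p t := by
  simpa only [H.p_zero] using lt_of_hasDerivAt_pos ht (fun s hs => H.hasDerivAt_p hs.1) hu

lemma neg_one_le_h (H : IsProfileTrajectory m κ f p u g h r) (ht : 0 ≤ t)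
    (hu : ∀ s ∈ Ioo 0 t, 0 < u s) : -1 ≤ h t := by
  rw [← H.h_zero]
  exact le_of_hasDerivAt_nonneg ht (fun s hs => H.hasDerivAt_h hs.1)
    fun s hs => mul_nonneg hs.1.le (hu s hs).le

lemma neg_le_g (H : IsProfileTrajectory m κ f p u g h r) (ht : 0 ≤ t)
    (hu : ∀ s ∈ Ioo 0 t, 0 < u s) : -t ≤ g t := by
  have := add_mul_le_of_le_hasDerivAt ht (fun s hs => H.hasDerivAt_g hs.1)
    fun s hs => H.neg_one_le_h hs.1.le fun x hx => hu x ⟨hx.1, hx.2.trans hs.2⟩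
  rw [H.g_zero] at this
  linarith

lemma sub_sq_le_u (H : IsProfileTrajectory m κ f p u g h r) (hm : 0 ≤ m) (ht : 0 ≤ t)
    (hu : ∀ s ∈ Ioo 0 t, 0 < u s) : κ - t ^ 2 / 2 ≤ u t := by
  have := sub_le_sub_of_hasDerivAt_le ht
    (fun s _ => ((hasDerivAt_pow 2 s).div_const 2).neg) (fun s hs => H.hasDerivAt_u hs.1)
    fun s hs => by
      have hg := H.neg_le_g hs.1.le fun x hx => hu x ⟨hx.1, hx.2.trans hs.2⟩
      have hs0 := hs.1
      calc -((2 : ℕ) * s ^ (2 - 1) / 2) = -s := by norm_num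
        _ ≤ -s * r s := le_mul_of_le_one_right (by linarith) (H.r_le_one hm s)
        _ ≤ g s * r s := mul_le_mul_of_nonneg_right hg (H.r_pos s).le
  simp only [Pi.neg_apply, H.u_zero] at this
  linarith

lemma u_pos_of_sq_lt (H : IsProfileTrajectory m κ f p u g h r) (hm : 0 ≤ m) (ht : 0 ≤ t)
    (htκ : t ^ 2 < 2 * κ) : 0 < u t := by
  refine pos_of_bootstrap (H.isTriad.continuousOn_u.mono Icc_subset_Ici_self)
    (by linarith [H.u_zero, sq_nonneg t]) (fun s hs hus => ?_) t (right_mem_Icc.mpr ht)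
  have h_sq : s ^ 2 ≤ t ^ 2 := pow_le_pow_left₀ hs.1.le hs.2 2
  linarith [H.sub_sq_le_u hm hs.1.le fun x hx => hus x (Ioo_subset_Ico_self hx)]

lemma quartic_le_h (H : IsProfileTrajectory m κ f p u g h r) (hm : 0 ≤ m) (ht : 0 ≤ t)
    (htκ : t ^ 2 < 2 * κ) : -1 + κ * t ^ 2 / 2 - t ^ 4 / 8 ≤ h t := by
  have := sub_le_sub_of_hasDerivAt_le ht (fun s _ => ((hasDerivAt_pow 2 s).const_mul (κ / 2)).sub
    ((hasDerivAt_pow 4 s).div_const 8)) (fun s hs => H.hasDerivAt_h hs.1) fun s hs => by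
      have hu := H.sub_sq_le_u hm hs.1.le fun x hx => H.u_pos_of_sq_lt hm hx.1.le
        ((pow_le_pow_left₀ hx.1.le (hx.2.trans hs.2).le 2).trans_lt htκ)
      norm_num
      linarith [mul_le_mul_of_nonneg_left hu hs.1.le]
  simp only [Pi.sub_apply, H.h_zero] at this
  linarith

lemma quintic_le_g (H : IsProfileTrajectory m κ f p u g h r) (hm : 0 ≤ m) (ht : 0 ≤ t)
    (htκ : t ^ 2 < 2 * κ) : -t + κ * t ^ 3 / 6 - t ^ 5 / 40 ≤ g t := by
  have := sub_le_sub_of_hasDerivAt_le ht (fun s _ => (((hasDerivAt_pow 3 s).const_mul (κ / 6)).sub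
    ((hasDerivAt_pow 5 s).div_const 40)).sub (hasDerivAt_id s))
    (fun s hs => H.hasDerivAt_g hs.1) fun s hs => by
      have hh := H.quartic_le_h hm hs.1.le ((pow_le_pow_left₀ hs.1.le hs.2.le 2).trans_lt htκ)
      norm_num
      linarith
  simp only [Pi.sub_apply, id_eq, H.g_zero] at this
  linarith

end IsProfileTrajectory

/-- The trajectory reaches the positive octant of `(h, u, g)` at a time up to which `p` has stayed
positive. In the shooting argument this is the failure opposite to `p` becoming negative. -/
def EntersOctant (p u g h : ℝ → ℝ) : Prop :=
  ∃ T > 0, (∀ t ∈ Ioc 0 T, 0 < p t) ∧ 0 < h T ∧ 0 < u T ∧ 0 < g T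

namespace IsProfileTrajectory

variable {f p u g h r : ℝ → ℝ}

lemma entersOctant (H : IsProfileTrajectory m κ f p u g h r) (hm : 0 ≤ m) (hκ : 0 < κ)
    (hκ2 : 12 ≤ κ ^ 2) : EntersOctant p u g h := by
  obtain ⟨T, hT, rfl⟩ : ∃ T > 0, T ^ 2 = κ := ⟨√κ, Real.sqrt_pos.mpr hκ, Real.sq_sqrt hκ.le⟩
  have hTκ : T ^ 2 < 2 * T ^ 2 := by linarith
  refine ⟨T, hT, fun t ht => H.p_pos_of_forall_u_pos ht.1 fun s hs => ?_, ?_,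
    H.u_pos_of_sq_lt hm hT.le hTκ, ?_⟩
  · exact H.u_pos_of_sq_lt hm hs.1.le
      ((pow_le_pow_left₀ hs.1.le (hs.2.le.trans ht.2) 2).trans_lt hTκ)
  · linarith [H.quartic_le_h hm hT.le hTκ]
  · linarith [H.quintic_le_g hm hT.le hTκ, mul_le_mul_of_nonneg_left hκ2 hT.le]

lemma p_nonneg_of_entersOctant (H : IsProfileTrajectory m κ f p u g h r)
    (hoct : EntersOctant p u g h) (ht : 0 ≤ t) : 0 ≤ p t := by
  obtain ⟨T, hT, hp, hh, hu, hg⟩ := hoct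
  rcases ht.eq_or_lt with rfl | ht
  · exact H.p_zero.ge
  rcases le_or_gt t T with htT | htT
  · exact (hp t ⟨ht, htT⟩).le
  · refine (hp T ⟨hT, le_rfl⟩).le.trans (le_of_hasDerivAt_nonneg htT.le
      (fun s hs => H.hasDerivAt_p (hT.le.trans hs.1)) fun s hs => ?_)
    exact hu.le.trans (H.isTriad.le_of_pos hT.le hh hu hg hs.1.le).2.1

lemma exists_p_neg (H : IsProfileTrajectory m 0 f p u g h r) : ∃ t ≥ 0, p t < 0 := by
  have u_neg : ∀ t > 0, u t < 0 := fun t ht =>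
    (H.isTriad.neg_of_nonpos le_rfl (prod_three_lt_zero_iff.mpr
      (by simp [H.h_zero, H.u_zero, H.g_zero])) ht).2.1
  refine ⟨1, zero_le_one, ?_⟩
  have := lt_of_hasDerivAt_pos one_pos (fun s hs => (H.hasDerivAt_p hs.1).neg)
    fun s hs => neg_pos.mpr (u_neg s hs.1)
  simpa [H.p_zero] using this

end IsProfileTrajectory

lemma eventually_forall_pos_of_tendstoUniformlyOn {ι X : Type*} [TopologicalSpace X] {F : ι → X → ℝ}
    {φ : X → ℝ} {l : Filter ι} {K : Set X} (hF : TendstoUniformlyOn F φ l K) (hK : IsCompact K)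
    (hφ : ContinuousOn φ K) (hpos : ∀ x ∈ K, 0 < φ x) : ∀ᶠ i in l, ∀ x ∈ K, 0 < F i x := by
  obtain ⟨ε, hε, hle⟩ := hK.exists_forall_le' hφ hpos
  filter_upwards [Metric.tendstoUniformlyOn_iff.mp hF ε hε] with i hi x hx
  linarith [hle x hx, (abs_lt.mp (hi x hx)).2]

namespace IsProfileFlow

variable {f p u g h r : ℝ → ℝ → ℝ}

lemma isOpen_setOf_exists_p_neg (H : IsProfileFlow m f p u g h r) :
    IsOpen {κ | ∃ t ≥ 0, p κ t < 0} := by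
  rw [isOpen_iff_mem_nhds]
  rintro κ₀ ⟨t, ht, hp⟩
  filter_upwards [((H.tendsto_p t κ₀).tendsto_at (right_mem_Icc.mpr ht)).eventually_lt_const hp]
    with κ hκ using ⟨t, ht, hκ⟩

lemma eventually_octant (H : IsProfileFlow m f p u g h r) (ht : 0 ≤ t) (hh : 0 < h κ t)
    (hu : 0 < u κ t) (hg : 0 < g κ t) : ∀ᶠ κ' in 𝓝 κ, 0 < h κ' t ∧ 0 < u κ' t ∧ 0 < g κ' t := by
  have mem : t ∈ Icc 0 t := right_mem_Icc.mpr ht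
  have h_tendsto : Tendsto (h · t) (𝓝 κ) (𝓝 (h κ t)) := by
    simp only [(H.trajectory _).h_eq]
    exact (((H.tendsto_p t κ).tendsto_at mem).const_mul t).sub ((H.tendsto_f t κ).tendsto_at mem)
  exact (h_tendsto.eventually_const_lt hh).and
    ((((H.tendsto_u t κ).tendsto_at mem).eventually_const_lt hu).and
      (((H.tendsto_g t κ).tendsto_at mem).eventually_const_lt hg))

lemma eventually_forall_p_pos (H : IsProfileFlow m f p u g h r) (hκ : 0 < κ) {T : ℝ} (hT : 0 < T)
    (hp : ∀ t ∈ Ioc 0 T, 0 < p κ t) : ∀ᶠ κ' in 𝓝 κ, ∀ t ∈ Ioc 0 T, 0 < p κ' t := by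
  have u_cont : ContinuousOn (u κ) (Ici 0) := (H.trajectory κ).isTriad.continuousOn_u
  obtain ⟨d, hd, hud⟩ : ∃ d ∈ Ioc 0 T, ∀ t ∈ Icc 0 d, 0 < u κ t := by
    have near : ∀ᶠ t in 𝓝[≥] 0, 0 < u κ t :=
      (u_cont 0 (mem_Ici.mpr le_rfl)).eventually_const_lt (by rwa [(H.trajectory κ).u_zero])
    obtain ⟨b, hb, hub⟩ := mem_nhdsGE_iff_exists_Icc_subset.mp near
    exact ⟨min b T, ⟨lt_min hb hT, min_le_right _ _⟩, fun t ht =>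
      hub ⟨ht.1, ht.2.trans (min_le_left _ _)⟩⟩
  have u_pos := eventually_forall_pos_of_tendstoUniformlyOn (H.tendsto_u d κ) isCompact_Icc
    (u_cont.mono Icc_subset_Ici_self) hud
  have p_pos := eventually_forall_pos_of_tendstoUniformlyOn
    ((H.tendsto_p T κ).mono (Icc_subset_Icc_left hd.1.le)) isCompact_Icc
    ((H.trajectory κ).continuousOn_p.mono fun t ht => hd.1.le.trans ht.1)
    fun t ht => hp t ⟨hd.1.trans_le ht.1, ht.2⟩
  filter_upwards [u_pos, p_pos] with κ' hu' hp' t ht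
  rcases le_or_gt t d with htd | htd
  · exact (H.trajectory κ').p_pos_of_forall_u_pos ht.1
      fun s hs => hu' s ⟨hs.1.le, hs.2.le.trans htd⟩
  · exact hp' t ⟨htd.le, ht.2⟩

lemma isOpen_setOf_entersOctant (H : IsProfileFlow m f p u g h r) :
    IsOpen {κ | 0 < κ ∧ EntersOctant (p κ) (u κ) (g κ) (h κ)} := by
  rw [isOpen_iff_mem_nhds]
  rintro κ₀ ⟨hκ₀, T, hT, hp, hh, hu, hg⟩
  filter_upwards [lt_mem_nhds hκ₀, H.eventually_forall_p_pos hκ₀ hT hp,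
    H.eventually_octant hT.le hh hu hg] with κ hκ hpκ hoct using ⟨hκ, T, hT, hpκ, hoct⟩

lemma exists_p_nonneg_not_entersOctant (H : IsProfileFlow m f p u g h r) (hm : 0 ≤ m) :
    ∃ κ ∈ Ioo 0 (√12), (∀ t, 0 ≤ t → 0 ≤ p κ t) ∧ ¬ EntersOctant (p κ) (u κ) (g κ) (h κ) := by
  set A : Set ℝ := {κ | ∃ t ≥ 0, p κ t < 0}
  set B : Set ℝ := {κ | 0 < κ ∧ EntersOctant (p κ) (u κ) (g κ) (h κ)}
  have disjoint : Disjoint A B := disjoint_left.mpr fun κ ⟨t, ht, hp⟩ hB =>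
    hp.not_ge ((H.trajectory κ).p_nonneg_of_entersOctant hB.2 ht)
  have zero_mem : 0 ∈ A := (H.trajectory 0).exists_p_neg
  have sqrt_mem : √12 ∈ B := ⟨by positivity, (H.trajectory _).entersOctant hm (by positivity)
    (Real.sq_sqrt (by norm_num)).ge⟩
  have not_cover : ¬ Icc 0 (√12) ⊆ A ∪ B := fun hcover => by
    rcases isPreconnected_Icc.subset_or_subset H.isOpen_setOf_exists_p_neg
      H.isOpen_setOf_entersOctant disjoint hcover with hA | hB
    · exact disjoint_left.mp disjoint (hA (right_mem_Icc.mpr (Real.sqrt_nonneg _))) sqrt_mem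
    · exact disjoint_left.mp disjoint zero_mem (hB (left_mem_Icc.mpr (Real.sqrt_nonneg _)))
  obtain ⟨κ, hκ, hκAB⟩ := not_subset.mp not_cover
  obtain ⟨hκA, hκB⟩ := not_or.mp hκAB
  have hκ0 : 0 < κ := hκ.1.lt_of_ne fun h0 => hκA (h0 ▸ zero_mem)
  exact ⟨κ, ⟨hκ0, hκ.2.lt_of_ne fun h12 => hκB (h12 ▸ sqrt_mem)⟩,
    fun t ht => not_lt.mp fun hp => hκA ⟨t, ht, hp⟩, fun hoct => hκB ⟨hκ0, hoct⟩⟩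

end IsProfileFlow

end Shooting

section Neutral

variable {m κ t T l : ℝ} {f p u g h r : ℝ → ℝ}

/-- The trajectory selected by the shooting argument: it fails in neither direction, so that `p`
stays nonnegative and the positive octant of `(h, u, g)` is never entered. -/
structure IsNeutral (m κ : ℝ) (f p u g h r : ℝ → ℝ) : Prop extends
    IsProfileTrajectory m κ f p u g h r where
  m_pos : 0 < m
  κ_pos : 0 < κ
  p_nonneg : ∀ {t}, 0 ≤ t → 0 ≤ p t
  not_entersOctant : ¬ EntersOctant p u g h

lemma exists_isNeutral (hm : 0 < m) :
    ∃ κ ∈ Ioo 0 (√12), ∃ f p u g h r : ℝ → ℝ, IsNeutral m κ f p u g h r := by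
  obtain ⟨f, p, u, g, h, r, H⟩ := exists_isProfileFlow hm.le
  obtain ⟨κ, hκ, p_nonneg, not_oct⟩ := H.exists_p_nonneg_not_entersOctant hm.le
  exact ⟨κ, hκ, f κ, p κ, u κ, g κ, h κ, r κ, H.trajectory κ, hm, hκ.1, fun ht => p_nonneg _ ht,
    not_oct⟩

lemma abs_le_sq_mul_sq_div_add (hl : 0 < l) (ht : 0 < t) (x : ℝ) :
    |x| ≤ t ^ 2 * x ^ 2 / (2 * l) + l / 2 * (t ^ 2)⁻¹ := by
  have h_sq : t ^ 2 * x ^ 2 / (2 * l) + l / 2 * (t ^ 2)⁻¹ - |x|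
      = (t * |x| - l / t) ^ 2 / (2 * l) := by
    rw [← sq_abs x]
    field_simp
    ring
  rw [← sub_nonneg, h_sq]
  positivity

namespace IsNeutral

lemma f_mono (H : IsNeutral m κ f p u g h r) (ht : 0 ≤ t) (htT : t ≤ T) : f t ≤ f T :=
  le_of_hasDerivAt_nonneg htT (fun _ hs => H.hasDerivAt_f (ht.trans hs.1))
    fun _ hs => H.p_nonneg (ht.trans hs.1.le)

lemma one_le_f (H : IsNeutral m κ f p u g h r) (ht : 0 ≤ t) : 1 ≤ f t :=
  H.f_zero ▸ H.f_mono le_rfl ht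

lemma f_pos (H : IsNeutral m κ f p u g h r) (ht : 0 ≤ t) : 0 < f t :=
  zero_lt_one.trans_le (H.one_le_f ht)

lemma r_eq_rpow (H : IsNeutral m κ f p u g h r) (ht : 0 ≤ t) : r t = f t ^ (-m) := by
  rw [H.r_eq, max_eq_left (H.one_le_f ht)]

lemma r_anti (H : IsNeutral m κ f p u g h r) (ht : 0 ≤ t) (htT : t ≤ T) : r T ≤ r t := by
  rw [H.r_eq_rpow ht, H.r_eq_rpow (ht.trans htT)]
  exact Real.rpow_le_rpow_of_nonpos (H.f_pos ht) (H.f_mono ht htT) (neg_nonpos.mpr H.m_pos.le)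

lemma hasDerivAt_r (H : IsNeutral m κ f p u g h r) (ht : 0 < t) :
    HasDerivAt r (-(m * r t * (p t / f t))) t := by
  have f_pos := H.f_pos ht.le
  have r_eq : r =ᶠ[𝓝 t] fun s => f s ^ (-m) := by
    filter_upwards [lt_mem_nhds ht] with s hs using H.r_eq_rpow hs.le
  refine (((H.hasDerivAt_f ht.le).rpow_const (p := -m) (Or.inl f_pos.ne')).congr_of_eventuallyEq
    r_eq).congr_deriv ?_
  rw [Real.rpow_sub_one f_pos.ne', H.r_eq_rpow ht.le]
  ring

lemma hasDerivAt_lyap (H : IsNeutral m κ f p u g h r) (ht : 0 < t) :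
    HasDerivAt (lyap u g h r)
      (t ^ 2 * u t ^ 2 + 3 / 4 * (h t ^ 2 / t ^ 2) + m / 2 * t * r t * (p t / f t) * g t ^ 2)
      t := by
  have hh := H.hasDerivAt_h ht.le
  have hu := H.hasDerivAt_u ht.le
  have hg := H.hasDerivAt_g ht.le
  have hr := H.hasDerivAt_r ht
  refine ((((hasDerivAt_id t).mul ((hh.mul hu).sub (((hg.pow 2).mul hr).div_const 2))).sub
    ((((hh.pow 2).const_mul (3 / 4)).div (hasDerivAt_id t) ht.ne'))).add
    ((hu.mul hg).div_const 2)).congr_deriv ?_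
  simp only [id, Pi.mul_apply, Pi.pow_apply, Pi.sub_apply]
  field_simp
  ring

lemma sq_mul_sq_add_le_lyap_deriv (H : IsNeutral m κ f p u g h r) (ht : 0 ≤ t) :
    t ^ 2 * u t ^ 2 + 3 / 4 * (h t ^ 2 / t ^ 2) ≤
      t ^ 2 * u t ^ 2 + 3 / 4 * (h t ^ 2 / t ^ 2) + m / 2 * t * r t * (p t / f t) * g t ^ 2 := by
  have hm := H.m_pos
  have hr := H.r_pos t
  have hp := H.p_nonneg ht
  have hf := H.f_pos ht
  exact le_add_of_nonneg_right (by positivity)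

lemma lyap_mono (H : IsNeutral m κ f p u g h r) (ht : 0 < t) (htT : t ≤ T) :
    lyap u g h r t ≤ lyap u g h r T :=
  le_of_hasDerivAt_nonneg htT (fun s hs => H.hasDerivAt_lyap (ht.trans_le hs.1)) fun s hs =>
    le_trans (by positivity) (H.sq_mul_sq_add_le_lyap_deriv (ht.trans hs.1).le)

lemma abs_p_sub_le (H : IsNeutral m κ f p u g h r) (ht : 0 < t) (htT : t ≤ T) (hl : 0 < l) :
    |p T - p t| ≤ (lyap u g h r T - lyap u g h r t) / (2 * l) + l / 2 * (1 / t - 1 / T) := by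
  have := abs_sub_le_of_abs_hasDerivAt_le htT (fun s hs => H.hasDerivAt_p (ht.le.trans hs.1))
    (fun s hs => ((H.hasDerivAt_lyap (ht.trans_le hs.1)).div_const (2 * l)).sub
      ((hasDerivAt_inv (ht.trans_le hs.1).ne').const_mul (l / 2))) fun s hs => by
      have hs0 : 0 < s := ht.trans hs.1
      have h_lyap : s ^ 2 * u s ^ 2 / (2 * l) ≤ _ / (2 * l) := div_le_div_of_nonneg_right
        ((le_add_of_nonneg_right (by positivity)).trans (H.sq_mul_sq_add_le_lyap_deriv hs0.le))
        (by positivity)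
      linarith [abs_le_sq_mul_sq_div_add hl hs0 (u s)]
  simp only [Pi.sub_apply] at this
  refine this.trans_eq ?_
  ring

end IsNeutral

/-- Up to time `T` the trajectory stays in the octant `h < 0 < u`, `g < 0` in which it starts. -/
structure IsFirstPhase (u g h : ℝ → ℝ) (T : ℝ) : Prop where
  pos : 0 < T
  h_neg : ∀ {t}, t ∈ Ioo 0 T → h t < 0
  u_pos : ∀ {t}, t ∈ Ioo 0 T → 0 < u t
  g_neg : ∀ {t}, t ∈ Ioo 0 T → g t < 0

namespace IsFirstPhase

lemma mono (P : IsFirstPhase u g h T) (ht : 0 < t) (htT : t ≤ T) : IsFirstPhase u g h t where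
  pos := ht
  h_neg hs := P.h_neg ⟨hs.1, hs.2.trans_le htT⟩
  u_pos hs := P.u_pos ⟨hs.1, hs.2.trans_le htT⟩
  g_neg hs := P.g_neg ⟨hs.1, hs.2.trans_le htT⟩

lemma le_of_h_eq_zero (P : IsFirstPhase u g h T) (ht : 0 < t) (hh : h t = 0) : T ≤ t :=
  not_lt.mp fun hlt => (P.h_neg ⟨ht, hlt⟩).ne hh

end IsFirstPhase

namespace IsProfileTrajectory

lemma g_neg_of_forall_h_neg (H : IsProfileTrajectory m κ f p u g h r) (ht : 0 < t)
    (hh : ∀ s ∈ Ioo 0 t, h s < 0) : g t < 0 := by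
  simpa only [Pi.neg_apply, H.g_zero, neg_zero, neg_pos] using
    lt_of_hasDerivAt_pos ht (fun s hs => (H.hasDerivAt_g hs.1).neg)
      fun s hs => neg_pos.mpr (hh s hs)

lemma firstPhase_g_neg (H : IsProfileTrajectory m κ f p u g h r) (P : IsFirstPhase u g h T) :
    g T < 0 :=
  H.g_neg_of_forall_h_neg P.pos fun _ => P.h_neg

lemma firstPhase_g_le (H : IsProfileTrajectory m κ f p u g h r) (P : IsFirstPhase u g h T) :
    g T ≤ T * h T := by
  have := sub_le_sub_of_hasDerivAt_le P.pos.le (fun s hs => H.hasDerivAt_g hs.1)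
    (fun s hs => (hasDerivAt_id s).mul (H.hasDerivAt_h hs.1)) fun s hs => by
      have := hs.1
      have := P.u_pos hs
      simp only [id_eq, one_mul, le_add_iff_nonneg_right]
      positivity
  simp only [Pi.mul_apply, id_eq, H.g_zero] at this
  linarith

lemma firstPhase_g_mul_le (H : IsProfileTrajectory m κ f p u g h r) (P : IsFirstPhase u g h T)
    (ht : 0 < t) (htT : t ≤ T) : g t * T ≤ g T * t := by
  have := le_of_hasDerivAt_nonneg (φ := fun s => g s / s) htT
    (fun s hs => (H.hasDerivAt_g (ht.le.trans hs.1)).div (hasDerivAt_id s) (ht.trans_le hs.1).ne')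
    fun s hs => by
      have := H.firstPhase_g_le (P.mono (ht.trans hs.1) hs.2.le)
      simp only [mul_one]
      exact div_nonneg (by linarith) (sq_nonneg s)
  rwa [div_le_div_iff₀ ht (ht.trans_le htT)] at this

lemma firstPhase_sq_mul_u_le (H : IsProfileTrajectory m κ f p u g h r) (P : IsFirstPhase u g h T) :
    T ^ 2 * u T / 2 ≤ 1 + h T := by
  have := sub_le_sub_of_hasDerivAt_le P.pos.le
    (fun s hs => ((hasDerivAt_pow 2 s).mul (H.hasDerivAt_u hs.1)).div_const 2)
    (fun s hs => H.hasDerivAt_h hs.1) fun s hs => by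
      have := mul_nonneg (sq_nonneg s) (mul_pos (neg_pos.mpr (P.g_neg hs)) (H.r_pos s)).le
      norm_num
      linarith
  simp only [Pi.mul_apply, H.h_zero] at this
  linarith

lemma firstPhase_neg_g_le (H : IsProfileTrajectory m κ f p u g h r) (P : IsFirstPhase u g h T) :
    -g T + T * h T ≤ 2 / 3 * T * (1 + h T) := by
  have := sub_le_sub_of_hasDerivAt_le P.pos.le
    (fun s hs => ((hasDerivAt_id s).mul (H.hasDerivAt_h hs.1)).sub (H.hasDerivAt_g hs.1))
    (fun s hs => ((hasDerivAt_id s).mul ((H.hasDerivAt_h hs.1).const_add 1)).const_mul (2 / 3))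
    fun s hs => by
      have := H.firstPhase_sq_mul_u_le (P.mono hs.1 hs.2.le)
      simp only [id_eq, one_mul]
      linarith
  simp only [Pi.sub_apply, Pi.mul_apply, id_eq, H.g_zero] at this
  linarith

lemma firstPhase_mul_u_le_p (H : IsProfileTrajectory m κ f p u g h r) (P : IsFirstPhase u g h T) :
    T * u T ≤ p T := by
  have := sub_le_sub_of_hasDerivAt_le P.pos.le
    (fun s hs => (hasDerivAt_id s).mul (H.hasDerivAt_u hs.1)) (fun s hs => H.hasDerivAt_p hs.1)
    fun s hs => by
      have := mul_nonneg hs.1.le (mul_pos (neg_pos.mpr (P.g_neg hs)) (H.r_pos s)).le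
      simp only [id_eq, one_mul]
      linarith
  simp only [Pi.mul_apply, id_eq, H.p_zero] at this
  linarith

lemma firstPhase_two_mul_le (H : IsProfileTrajectory m κ f p u g h r) (P : IsFirstPhase u g h T) :
    2 * (1 + h T) ≤ T * p T := by
  have := sub_le_sub_of_hasDerivAt_le P.pos.le (fun s hs => (H.hasDerivAt_h hs.1).const_mul 2)
    (fun s hs => (hasDerivAt_id s).mul (H.hasDerivAt_p hs.1)) fun s hs => by
      have := H.firstPhase_mul_u_le_p (P.mono hs.1 hs.2.le)
      simp only [id_eq, one_mul]
      linarith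
  simp only [Pi.mul_apply, id_eq, H.h_zero] at this
  linarith

end IsProfileTrajectory

namespace IsNeutral

lemma firstPhase_g_mul_r_mul_le (H : IsNeutral m κ f p u g h r) (P : IsFirstPhase u g h T)
    (ht : 0 < t) (htT : t ≤ T) : g t * r t * T ≤ g T * r T * t := by
  calc g t * r t * T = g t * T * r t := by ring
    _ ≤ g T * t * r t := mul_le_mul_of_nonneg_right (H.firstPhase_g_mul_le P ht htT) (H.r_pos t).le
    _ ≤ g T * t * r T := mul_le_mul_of_nonpos_left (H.r_anti ht.le htT)
      (mul_nonpos_of_nonpos_of_nonneg (H.firstPhase_g_neg P).le ht.le)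
    _ = g T * r T * t := by ring

-- `u` is convex as a function of `t ^ 2`.
lemma firstPhase_tangent_le_u (H : IsNeutral m κ f p u g h r) (P : IsFirstPhase u g h T)
    (ht : 0 ≤ t) (htT : t ≤ T) : u T - g T * r T / (2 * T) * (T ^ 2 - t ^ 2) ≤ u t := by
  have := sub_le_sub_of_hasDerivAt_le htT (fun s hs => H.hasDerivAt_u (ht.trans hs.1))
    (fun s _ => (hasDerivAt_pow 2 s).const_mul (g T * r T / (2 * T))) fun s hs => by
      have := H.firstPhase_g_mul_r_mul_le P (ht.trans_lt hs.1) hs.2.le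
      rw [← le_div_iff₀ P.pos] at this
      refine this.trans_eq ?_
      norm_num
      field_simp
  linarith

lemma firstPhase_u_add_le (H : IsNeutral m κ f p u g h r) (P : IsFirstPhase u g h T) :
    u T * T ^ 2 / 2 - g T * r T * T ^ 3 / 8 ≤ 1 + h T := by
  have hT := P.pos
  set σ := g T * r T / (2 * T)
  have hσ : g T * r T = 2 * σ * T := by simp only [σ]; field_simp
  have := sub_le_sub_of_hasDerivAt_le hT.le (fun s _ => ((hasDerivAt_pow 2 s).const_mul
    ((u T - σ * T ^ 2) / 2)).add ((hasDerivAt_pow 4 s).const_mul (σ / 4)))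
    (fun s hs => H.hasDerivAt_h hs.1) fun s hs => by
      have := mul_le_mul_of_nonneg_left (H.firstPhase_tangent_le_u P hs.1.le hs.2.le) hs.1.le
      norm_num
      linarith
  simp only [Pi.add_apply, H.h_zero] at this
  rw [hσ]
  linarith

end IsNeutral

namespace IsProfileTrajectory

lemma firstPhase_p_pos (H : IsProfileTrajectory m κ f p u g h r) (P : IsFirstPhase u g h T) :
    0 < p T :=
  H.p_pos_of_forall_u_pos P.pos fun _ => P.u_pos

end IsProfileTrajectory

lemma lyap_of_h_eq_zero (hT : T ≠ 0) (hh : h T = 0) :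
    lyap u g h r T = -(T * (g T ^ 2 * r T / 2 - u T * g T / (2 * T))) := by
  simp only [lyap, hh]
  field_simp
  ring

namespace IsNeutral

-- By `firstPhase_u_add_le` the left-hand side is at most `8 / (3 * T ^ 2)`, while `2 ≤ T * p T`.
lemma firstPhase_neg_lyap_div_le (H : IsNeutral m κ f p u g h r) (P : IsFirstPhase u g h T)
    (hh : h T = 0) (hu : 0 ≤ u T) :
    g T ^ 2 * r T / 2 - u T * g T / (2 * T) ≤ 2 / 3 * p T ^ 2 := by
  have hT := P.pos
  have h_neg_g := H.firstPhase_neg_g_le P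
  have h_two := H.firstPhase_two_mul_le P
  have h_convex := H.firstPhase_u_add_le P
  have g_neg := H.firstPhase_g_neg P
  simp only [hh] at h_neg_g h_two h_convex
  have hgr : 0 ≤ -g T * r T := mul_nonneg (neg_pos.mpr g_neg).le (H.r_pos T).le
  have h_sq : g T ^ 2 * r T / 2 ≤ T / 3 * (-g T * r T) := by
    linarith [mul_le_mul_of_nonneg_right h_neg_g hgr]
  have h_mul : - (u T * g T / (2 * T)) ≤ u T / 3 := by
    rw [← neg_div, div_le_iff₀ (by positivity)]
    linarith [mul_le_mul_of_nonneg_left h_neg_g hu]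
  have h_eight : T ^ 2 * (g T ^ 2 * r T / 2 - u T * g T / (2 * T)) ≤ 8 / 3 := by
    have := mul_le_mul_of_nonneg_left (add_le_add h_sq h_mul) (sq_nonneg T)
    have : 0 ≤ u T * T ^ 2 := by positivity
    linarith
  have h_four : 2 ^ 2 ≤ (T * p T) ^ 2 := pow_le_pow_left₀ zero_le_two (by linarith) 2
  refine le_of_mul_le_mul_left (a := T ^ 2) ?_ (by positivity)
  linarith

lemma abs_p_sub_le_sqrt (H : IsNeutral m κ f p u g h r) {E Y : ℝ} (hT : 0 < T) (hTY : T ≤ Y)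
    (hE : lyap u g h r T = -(T * E)) (hY : lyap u g h r Y ≤ 0) : |p Y - p T| ≤ √E := by
  have hY0 : 0 < Y := hT.trans_le hTY
  refine le_of_forall_pos_le_add fun ε hε => ?_
  have hEs : E ≤ (√E + ε) ^ 2 := by
    rw [← Real.sqrt_le_left (by positivity)]
    linarith
  set s := √E + ε
  have hs : 0 < s := by positivity
  have h_lyap : (lyap u g h r Y - lyap u g h r T) / (2 * (T * s)) ≤ s / 2 := by
    rw [div_le_iff₀ (by positivity), hE]
    linarith [mul_le_mul_of_nonneg_left hEs hT.le]
  have h_inv : T * s / 2 * (1 / T - 1 / Y) ≤ s / 2 := by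
    rw [mul_sub, show T * s / 2 * (1 / T) = s / 2 by field_simp]
    exact sub_le_self _ (by positivity)
  linarith [H.abs_p_sub_le hT hTY (l := T * s) (by positivity)]

end IsNeutral

end Neutral

section SlopeLimit

variable {m κ t T : ℝ} {f p u g h r : ℝ → ℝ}

namespace IsProfileTrajectory

lemma isFirstPhase_of_forall_h_neg (H : IsProfileTrajectory m κ f p u g h r) (hT : 0 < T)
    (hh : ∀ t ∈ Ioo 0 T, h t < 0) (hn : ∀ t ∈ Ioo 0 T, ¬ (h t, u t, g t) < 0) :
    IsFirstPhase u g h T where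
  pos := hT
  h_neg ht := hh _ ht
  u_pos {t} ht := by
    have hg := H.g_neg_of_forall_h_neg ht.1 fun s hs => hh s ⟨hs.1, hs.2.trans ht.2⟩
    exact not_le.mp fun hu => hn t ht <| prod_three_lt_zero_iff.mpr
      ⟨(hh t ht).le, hu, hg.le, Or.inr (Or.inr hg)⟩
  g_neg ht := H.g_neg_of_forall_h_neg ht.1 fun s hs => hh s ⟨hs.1, hs.2.trans ht.2⟩

lemma isFirstPhase_or_exists_h_eq_zero (H : IsProfileTrajectory m κ f p u g h r) (hT : 0 < T)
    (hn : ∀ t ∈ Ioo 0 T, ¬ (h t, u t, g t) < 0) :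
    IsFirstPhase u g h T ∨ ∃ y ∈ Ioo 0 T, IsFirstPhase u g h y ∧ h y = 0 ∧ 0 < u y := by
  by_cases! hh : ∀ t ∈ Ioo 0 T, h t < 0
  · exact Or.inl (H.isFirstPhase_of_forall_h_neg hT hh hn)
  obtain ⟨t, ht, h_nonneg⟩ := hh
  obtain ⟨y, hy, hy_zero, hy_pos⟩ := exists_first_zero
    (H.isTriad.continuousOn_h.neg.mono Icc_subset_Ici_self) ht.1.le
    (by simp [H.h_zero]) (by simpa using h_nonneg)
  have hyT : y < T := hy.2.trans_lt ht.2
  have P : IsFirstPhase u g h y := H.isFirstPhase_of_forall_h_neg hy.1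
    (fun s hs => neg_pos.mp (hy_pos s (Ioo_subset_Ico_self hs)))
    fun s hs => hn s ⟨hs.1, hs.2.trans hyT⟩
  have hg := H.firstPhase_g_neg P
  refine Or.inr ⟨y, ⟨hy.1, hyT⟩, P, by simpa using hy_zero, not_le.mp fun hu => ?_⟩
  exact hn y ⟨hy.1, hyT⟩ <| prod_three_lt_zero_iff.mpr
    ⟨by simpa using hy_zero.ge, hu, hg.le, Or.inr (Or.inr hg)⟩

end IsProfileTrajectory

namespace IsNeutral

lemma firstPhase_p_div_ten_le (H : IsNeutral m κ f p u g h r) (P : IsFirstPhase u g h T)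
    (hh : h T = 0) (hu : 0 ≤ u T) (hTt : T ≤ t) (ht : lyap u g h r t ≤ 0) : p T / 10 ≤ p t := by
  have p_pos := H.firstPhase_p_pos P
  have h_sqrt : √(g T ^ 2 * r T / 2 - u T * g T / (2 * T)) ≤ 9 / 10 * p T := by
    rw [Real.sqrt_le_left (by positivity)]
    linarith [H.firstPhase_neg_lyap_div_le P hh hu, sq_nonneg (p T)]
  linarith [(abs_le.mp (H.abs_p_sub_le_sqrt P.pos hTt (lyap_of_h_eq_zero P.pos.ne' hh) ht)).1]

lemma lyap_nonpos_of_u_eq_zero (H : IsNeutral m κ f p u g h r) (ht : 0 ≤ t) (hu : u t = 0) :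
    lyap u g h r t ≤ 0 := by
  have hr := H.r_pos t
  have h_g : 0 ≤ t * (g t ^ 2 * r t / 2) := by positivity
  have h_h : 0 ≤ 3 / 4 * h t ^ 2 / t := by positivity
  simp only [lyap, hu]
  linarith

lemma p_ne_zero (H : IsNeutral m κ f p u g h r) (ht : 0 < t) : p t ≠ 0 := fun hp => by
  have u_zero : u t = 0 := by
    refine IsLocalMin.hasDerivAt_eq_zero ?_ (H.hasDerivAt_p ht.le)
    filter_upwards [lt_mem_nhds ht] with s hs
    exact hp ▸ H.p_nonneg hs.le
  have not_neg : ∀ s ∈ Ioo 0 t, ¬ (h s, u s, g s) < 0 := fun s hs hlt =>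
    (H.isTriad.neg_of_nonpos hs.1.le hlt hs.2).2.1.ne u_zero
  rcases H.isFirstPhase_or_exists_h_eq_zero ht not_neg with P | ⟨y, hy, P, hh, hu⟩
  · exact (H.firstPhase_p_pos P).ne' hp
  · linarith [H.firstPhase_p_pos P, H.firstPhase_p_div_ten_le P hh hu.le hy.2.le
      (H.lyap_nonpos_of_u_eq_zero ht.le u_zero)]

lemma p_pos (H : IsNeutral m κ f p u g h r) (ht : 0 < t) : 0 < p t :=
  (H.p_nonneg ht.le).lt_of_ne (H.p_ne_zero ht).symm

lemma not_pos (H : IsNeutral m κ f p u g h r) (ht : 0 < t) : ¬ 0 < (h t, u t, g t) := fun hlt =>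
  H.not_entersOctant ⟨t + 1, by linarith, fun _ hs => H.p_pos hs.1,
    H.isTriad.pos_of_nonneg ht.le hlt (lt_add_one t)⟩

lemma not_neg (H : IsNeutral m κ f p u g h r) (ht : 0 < t) : ¬ (h t, u t, g t) < 0 := fun hlt => by
  obtain ⟨hh, hu, hg⟩ := H.isTriad.neg_of_nonpos ht.le hlt (lt_add_one t)
  have nonneg : ∀ s ≥ t + 1, 0 ≤ s := fun s hs => by linarith
  obtain ⟨s, hs, hp⟩ := exists_pos_of_le_hasDerivAt (neg_pos.mpr hu)
    (fun s hs => (H.hasDerivAt_p (nonneg s hs)).neg) fun s hs =>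
      (H.isTriad.neg.le_of_pos (nonneg _ le_rfl) (neg_pos.mpr hh) (neg_pos.mpr hu)
        (neg_pos.mpr hg) hs).2.1
  exact (H.p_nonneg (nonneg s hs)).not_gt (neg_pos.mp hp)

lemma lyap_nonpos (H : IsNeutral m κ f p u g h r) (ht : 0 < t) : lyap u g h r t ≤ 0 := by
  obtain ⟨s, hs, hle⟩ := H.isTriad.exists_lyap_nonpos ht (fun s hs => H.not_pos (ht.trans_le hs))
    fun s hs => H.not_neg (ht.trans_le hs)
  exact (H.lyap_mono ht hs).trans hle

lemma forall_isFirstPhase_or_exists_h_eq_zero (H : IsNeutral m κ f p u g h r) :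
    (∀ T > 0, IsFirstPhase u g h T) ∨ ∃ T, IsFirstPhase u g h T ∧ h T = 0 ∧ 0 < u T := by
  by_cases! hP : ∀ T > 0, IsFirstPhase u g h T
  · exact Or.inl hP
  obtain ⟨T, hT, hTP⟩ := hP
  rcases H.isFirstPhase_or_exists_h_eq_zero hT fun t ht => H.not_neg ht.1 with P | ⟨y, -, P⟩
  · exact absurd P hTP
  · exact Or.inr ⟨y, P⟩

lemma exists_eventually_le_p (H : IsNeutral m κ f p u g h r) :
    ∃ c > 0, ∀ᶠ t in atTop, c ≤ p t := by
  rcases H.forall_isFirstPhase_or_exists_h_eq_zero with hP | ⟨T, P, hh, hu⟩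
  · refine ⟨p 1, H.p_pos one_pos, ?_⟩
    filter_upwards [eventually_ge_atTop 1] with t ht
    exact le_of_hasDerivAt_nonneg ht (fun s hs => H.hasDerivAt_p (zero_le_one.trans hs.1))
      fun s hs => ((hP t (by linarith)).u_pos ⟨zero_lt_one.trans hs.1, hs.2⟩).le
  · refine ⟨p T / 10, by linarith [H.p_pos P.pos], ?_⟩
    filter_upwards [eventually_ge_atTop T] with t ht
    exact H.firstPhase_p_div_ten_le P hh hu.le ht (H.lyap_nonpos (P.pos.trans_le ht))

lemma exists_tendsto_p (H : IsNeutral m κ f p u g h r) : ∃ a > 0, Tendsto p atTop (𝓝 a) := by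
  obtain ⟨a, ha⟩ : ∃ a, Tendsto p atTop (𝓝 a) := by
    refine exists_tendsto_of_abs_sub_le (a := 1) (c := 0)
      (ψ := fun t => lyap u g h r t / 2 - 1 / t / 2) (fun t ht T hT => ?_) fun t ht => ?_
    · exact (H.abs_p_sub_le (zero_lt_one.trans_le ht) hT one_pos).trans_eq (by ring)
    · have ht0 : 0 < t := zero_lt_one.trans_le ht
      linarith [H.lyap_nonpos ht0, one_div_pos.mpr ht0]
  obtain ⟨c, hc, hle⟩ := H.exists_eventually_le_p
  exact ⟨a, hc.trans_le (ge_of_tendsto ha hle), ha⟩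

end IsNeutral

end SlopeLimit

section FirstPhaseEnd

variable {m κ s t T C : ℝ} {f p u g h r : ℝ → ℝ}

lemma IsTriad.hasDerivAt_u_add_g_div (H : IsTriad r h u g) (ht : 0 < t) :
    HasDerivAt (fun s => u s + C * (g s / s ^ 3))
      (C * h t / t ^ 3 + (3 * C / t ^ 4 - r t) * (-g t)) t := by
  refine ((H.hasDerivAt_u ht.le).add (((H.hasDerivAt_g ht.le).div (hasDerivAt_pow 3 t)
    (pow_ne_zero 3 ht.ne')).const_mul C)).congr_deriv ?_
  push_cast
  field_simp
  ring

lemma IsTriad.h_le_of_forall_u_nonneg (H : IsTriad r h u g) (hs : 0 ≤ s) (hst : s ≤ t)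
    (hu : ∀ x ∈ Ioo s t, 0 ≤ u x) : h s ≤ h t :=
  le_of_hasDerivAt_nonneg hst (fun _ hx => H.hasDerivAt_h (hs.trans hx.1))
    fun x hx => mul_nonneg (hs.trans hx.1.le) (hu x hx)

namespace IsProfileTrajectory

lemma hasDerivAt_f_div (H : IsProfileTrajectory m κ f p u g h r) (ht : 0 < t) :
    HasDerivAt (fun s => f s / s) (h t / t ^ 2) t := by
  refine ((H.hasDerivAt_f ht.le).div (hasDerivAt_id t) ht.ne').congr_deriv ?_
  rw [H.h_eq]
  simp only [id]
  ring

lemma f_div_le_of_h_nonneg (H : IsProfileTrajectory m κ f p u g h r) (ht : 0 < t) (htT : t ≤ T)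
    (hh : ∀ s ∈ Ioo t T, 0 ≤ h s) : f t / t ≤ f T / T :=
  le_of_hasDerivAt_nonneg htT (fun s hs => H.hasDerivAt_f_div (ht.trans_le hs.1)) fun s hs =>
    div_nonneg (hh s hs) (by positivity)

end IsProfileTrajectory

namespace IsNeutral

lemma pow_le_of_h_nonneg (H : IsNeutral m κ f p u g h r) {n : ℕ} (hC : 0 ≤ C) (ht : 0 < t)
    (htT : t ≤ T) (hh : ∀ s ∈ Ioo t T, 0 ≤ h s) (hle : t ^ n ≤ C * f t ^ n) :
    T ^ n ≤ C * f T ^ n := by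
  have hT : 0 < T := ht.trans_le htT
  have hf := H.f_pos ht.le
  calc T ^ n = t ^ n * (T / t) ^ n := by rw [← mul_pow, mul_div_cancel₀ _ ht.ne']
    _ ≤ C * f t ^ n * (T / t) ^ n := by gcongr
    _ = C * (f t / t * T) ^ n := by rw [mul_assoc, ← mul_pow, div_mul_eq_mul_div, mul_div_assoc]
    _ ≤ C * (f T / T * T) ^ n := mul_le_mul_of_nonneg_left (pow_le_pow_left₀ (by positivity)
      (mul_le_mul_of_nonneg_right (H.f_div_le_of_h_nonneg ht htT hh) hT.le) n) hC
    _ = C * f T ^ n := by rw [div_mul_cancel₀ _ hT.ne']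

lemma r_eq_inv_pow_four (H : IsNeutral 4 κ f p u g h r) (ht : 0 ≤ t) : r t = (f t ^ 4)⁻¹ := by
  rw [H.r_eq_rpow ht, Real.rpow_neg (H.f_pos ht).le]
  norm_cast

lemma r_le_div_pow_four (H : IsNeutral 4 κ f p u g h r) (ht : 0 < t) (hle : t ^ 4 ≤ C * f t ^ 4) :
    r t ≤ C / t ^ 4 := by
  have hf := H.f_pos ht.le
  rw [H.r_eq_inv_pow_four ht.le, le_div_iff₀ (by positivity), inv_mul_le_iff₀ (by positivity)]
  linarith

-- While `g ≤ 0 ≤ h`, the function `u + C g / t ^ 3` is nondecreasing, hence stays positive.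
lemma u_pos_of_lt_cube_mul_u (H : IsNeutral 4 κ f p u g h r) (hC : 0 < C) (hT : 0 < T)
    (hhT : 0 ≤ h T) (hgT : C * (-g T) < T ^ 3 * u T) (hle : T ^ 4 ≤ 3 * C * f T ^ 4)
    (hg : ∀ s ∈ Icc T t, g s ≤ 0) : ∀ s ∈ Icc T t, 0 < u s := by
  rcases lt_or_ge t T with htT | hTt
  · simp [Icc_eq_empty_of_lt htT]
  have start_pos : 0 < u T + C * (g T / T ^ 3) := by
    rw [show u T + C * (g T / T ^ 3) = (T ^ 3 * u T - C * (-g T)) / T ^ 3 by field_simp; ring]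
    exact div_pos (by linarith) (by positivity)
  have div_nonpos : ∀ s ∈ Icc T t, C * (g s / s ^ 3) ≤ 0 := fun s hs =>
    mul_nonpos_of_nonneg_of_nonpos hC.le
      (div_nonpos_of_nonpos_of_nonneg (hg s hs) (pow_nonneg (hT.le.trans hs.1) 3))
  refine pos_of_bootstrap (H.isTriad.continuousOn_u.mono fun x hx => hT.le.trans hx.1)
    (by linarith [div_nonpos T ⟨le_rfl, hTt⟩]) fun s hs hus => ?_
  have h_nonneg : ∀ x ∈ Icc T s, 0 ≤ h x := fun x hx => hhT.trans <|
    H.isTriad.h_le_of_forall_u_nonneg hT.le hx.1 fun y hy =>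
      (hus y ⟨hy.1.le, hy.2.trans_le hx.2⟩).le
  have mono := le_of_hasDerivAt_nonneg hs.1.le
    (fun x hx => H.isTriad.hasDerivAt_u_add_g_div (C := C) (hT.trans_le hx.1)) fun x hx => by
      have hx0 : 0 < x := hT.trans hx.1
      have hr := H.r_le_div_pow_four hx0 <| H.pow_le_of_h_nonneg (by positivity) hT hx.1.le
        (fun y hy => h_nonneg y ⟨hy.1.le, hy.2.le.trans hx.2.le⟩) hle
      have hh := h_nonneg x ⟨hx.1.le, hx.2.le⟩
      exact add_nonneg (by positivity) (mul_nonneg (sub_nonneg.mpr hr)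
        (neg_nonneg.mpr (hg x ⟨hx.1.le, hx.2.le.trans hs.2⟩)))
  linarith [div_nonpos s ⟨hs.1.le, hs.2⟩]

lemma exists_g_nonneg (H : IsNeutral m κ f p u g h r) (hT : 0 ≤ T) (hhT : 0 ≤ h T)
    (hu : ∀ t ≥ T, 0 < u t) : ∃ t ≥ T, 0 ≤ g t := by
  have nonneg : ∀ t ≥ T, 0 ≤ t := fun t ht => hT.trans ht
  have h_pos : 0 < h (T + 1) := hhT.trans_lt <|
    lt_of_hasDerivAt_pos (lt_add_one T) (fun s hs => H.hasDerivAt_h (nonneg s hs.1)) fun s hs =>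
      mul_pos (hT.trans_lt hs.1) (hu s hs.1.le)
  obtain ⟨t, ht, hgt⟩ := exists_pos_of_le_hasDerivAt h_pos
    (fun s hs => H.hasDerivAt_g (by linarith)) fun s hs =>
      H.isTriad.h_le_of_forall_u_nonneg (by linarith) hs fun x hx => (hu x (by linarith [hx.1])).le
  exact ⟨t, by linarith, hgt.le⟩

lemma cube_mul_u_le (H : IsNeutral 4 κ f p u g h r) (hC : 0 < C) (hT : 0 < T)
    (hhT : h T = 0) (hgT : g T < 0) (hle : T ^ 4 ≤ 3 * C * f T ^ 4) :
    T ^ 3 * u T ≤ C * (-g T) := by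
  by_contra! hlt
  have u_pos := fun t => H.u_pos_of_lt_cube_mul_u (t := t) hC hT hhT.ge hlt hle
  have exists_nonneg : ∃ t ≥ T, 0 ≤ g t := by
    by_contra! hg
    obtain ⟨t, ht, hgt⟩ := H.exists_g_nonneg hT.le hhT.ge fun t ht =>
      u_pos t (fun s hs => (hg s hs.1).le) t ⟨ht, le_rfl⟩
    exact hgt.not_gt (hg t ht)
  obtain ⟨t, ht, hgt⟩ := exists_nonneg
  obtain ⟨Y, hY, gY_zero, hgY⟩ := exists_first_zero (φ := -g)
    (H.isTriad.continuousOn_g.neg.mono fun s hs => hT.le.trans hs.1) ht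
    (by simpa using hgT) (by simpa using hgt)
  simp only [Pi.neg_apply, neg_eq_zero, neg_pos] at gY_zero hgY
  have hu := u_pos Y fun s hs => hs.2.lt_or_eq.elim (fun hsY => (hgY s ⟨hs.1, hsY⟩).le)
    fun hsY => (hsY ▸ gY_zero).le
  have huY := hu Y ⟨hY.1.le, le_rfl⟩
  have hhY : h T ≤ h Y := H.isTriad.h_le_of_forall_u_nonneg hT.le hY.1.le
    fun x hx => (hu x (Ioo_subset_Icc_self hx)).le
  exact H.not_pos (hT.trans hY.1) <| zero_lt_prod_three_iff.mpr
    ⟨hhT ▸ hhY, huY.le, gY_zero.ge, Or.inr (Or.inl huY)⟩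

end IsNeutral

end FirstPhaseEnd

section FirstPhaseDecay

variable {m κ s t T : ℝ} {f p u g h r : ℝ → ℝ}

namespace IsProfileTrajectory

lemma firstPhase_u_le (H : IsProfileTrajectory m κ f p u g h r) (P : IsFirstPhase u g h T) :
    u T ≤ κ := by
  have := le_of_hasDerivAt_nonneg P.pos.le (fun s hs => (H.hasDerivAt_u hs.1).neg)
    fun s hs => neg_nonneg.mpr (mul_nonpos_of_nonpos_of_nonneg (P.g_neg hs).le (H.r_pos s).le)
  simp only [Pi.neg_apply, H.u_zero] at this
  linarith

lemma firstPhase_h_le (H : IsProfileTrajectory m κ f p u g h r) (P : IsFirstPhase u g h T) :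
    h T ≤ -1 + κ * T ^ 2 / 2 := by
  have := sub_le_sub_of_hasDerivAt_le P.pos.le (fun s hs => H.hasDerivAt_h hs.1)
    (fun s _ => (hasDerivAt_pow 2 s).const_mul (κ / 2)) fun s hs => by
      have := mul_le_mul_of_nonneg_left (H.firstPhase_u_le (P.mono hs.1 hs.2.le)) hs.1.le
      norm_num
      linarith
  rw [H.h_zero] at this
  linarith

end IsProfileTrajectory

namespace IsNeutral

lemma isFirstPhase_of_mul_sq_le (H : IsNeutral m κ f p u g h r) (hT : 0 < T)
    (hκ : κ * T ^ 2 ≤ 2) : IsFirstPhase u g h T := by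
  rcases H.forall_isFirstPhase_or_exists_h_eq_zero with hP | ⟨S, P, hh, -⟩
  · exact hP T hT
  · refine P.mono hT (le_of_sq_le_sq ?_ P.pos.le)
    refine le_of_mul_le_mul_left (a := κ) ?_ H.κ_pos
    linarith [H.firstPhase_h_le P]

lemma firstPhase_two_mul_sub_u (H : IsNeutral m κ f p u g h r) (P : IsFirstPhase u g h T) :
    0 ≤ 2 * (κ - u T) + T * (g T * r T) := by
  have hT := P.pos
  have := sub_le_sub_of_hasDerivAt_le hT.le (fun s hs => H.hasDerivAt_u hs.1)
    (fun s _ => ((hasDerivAt_pow 2 s).div_const 2).const_mul (g T * r T / T)) fun s hs => by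
      have := H.firstPhase_g_mul_r_mul_le P hs.1 hs.2.le
      rw [← le_div_iff₀ hT] at this
      exact this.trans_eq (by norm_num; ring)
  have h_half : g T * r T / T * (T ^ 2 / 2) = T * (g T * r T) / 2 := by field_simp
  rw [H.u_zero, h_half] at this
  linarith

-- `u` is convex as a function of `t ^ 2`.
lemma firstPhase_u_le_chord (H : IsNeutral m κ f p u g h r) (P : IsFirstPhase u g h T)
    (hs : 0 < s) (hsT : s ≤ T) : u s ≤ κ - (κ - u T) / T ^ 2 * s ^ 2 := by
  have slope_le : (u T - κ) / T ^ 2 ≥ (u s - κ) / s ^ 2 := by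
    refine le_of_hasDerivAt_nonneg hsT (fun x hx => ((H.hasDerivAt_u (hs.le.trans hx.1)).sub_const
      κ).div (hasDerivAt_pow 2 x) (pow_ne_zero 2 (hs.trans_le hx.1).ne')) fun x hx => ?_
    have hx0 := hs.trans hx.1
    refine div_nonneg ?_ (by positivity)
    calc (0 : ℝ) ≤ x * (2 * (κ - u x) + x * (g x * r x)) :=
        mul_nonneg hx0.le (H.firstPhase_two_mul_sub_u (P.mono hx0 hx.2.le))
      _ = g x * r x * x ^ 2 - (u x - κ) * ((2 : ℕ) * x ^ (2 - 1)) := by norm_num; ring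
  rw [ge_iff_le, div_le_iff₀ (by positivity)] at slope_le
  rw [← neg_sub (u T), neg_div]
  linarith

lemma firstPhase_p_le (H : IsNeutral m κ f p u g h r) (P : IsFirstPhase u g h T) :
    p T ≤ (2 * κ + u T) / 3 * T := by
  have hT := P.pos
  have := sub_le_sub_of_hasDerivAt_le hT.le (fun s hs => H.hasDerivAt_p hs.1)
    (fun s _ => ((hasDerivAt_id s).const_mul κ).sub
      (((hasDerivAt_pow 3 s).div_const 3).const_mul ((κ - u T) / T ^ 2))) fun s hs => by
      refine (H.firstPhase_u_le_chord P hs.1 hs.2.le).trans_eq ?_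
      norm_num
  have h_third : (κ - u T) / T ^ 2 * (T ^ 3 / 3) = (κ - u T) / 3 * T := by field_simp
  simp only [Pi.sub_apply, id_eq, H.p_zero, h_third] at this
  linarith

end IsNeutral

/-- An auxiliary functional that grows linearly in the first phase once it is positive and
`f t / t` is large. Hence it is never positive there, which yields the decay of `t ^ 2 * u t`. -/
noncomputable def decayFunctional (u g h : ℝ → ℝ) (t : ℝ) : ℝ :=
  0.14 * (h t / t) + t * u t + 0.29 * (g t / t ^ 2)

lemma IsTriad.hasDerivAt_decayFunctional_div (H : IsTriad r h u g) (ht : 0 < t) :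
    HasDerivAt (fun s => decayFunctional u g h s / s)
      ((0.14 * decayFunctional u g h t + 0.0096 * (-h t / t)
        + (-g t) * (t ^ 2 * (0.87 / t ^ 4 - r t) + 0.0406 / t ^ 2)) / t ^ 2) t := by
  have h_deriv : HasDerivAt (decayFunctional u g h) _ t :=
    ((((H.hasDerivAt_h ht.le).div (hasDerivAt_id t) ht.ne').const_mul 0.14).add
      ((hasDerivAt_id t).mul (H.hasDerivAt_u ht.le))).add
      (((H.hasDerivAt_g ht.le).div (hasDerivAt_pow 2 t) (pow_ne_zero 2 ht.ne')).const_mul 0.29)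
  refine (h_deriv.div (hasDerivAt_id t) ht.ne').congr_deriv ?_
  simp only [decayFunctional, id_eq]
  push_cast
  field_simp
  ring

lemma IsFirstPhase.decayFunctional_div_le (P : IsFirstPhase u g h T) (H : IsTriad r h u g)
    (hs : 0 < s) (hsT : s ≤ T) (hr : ∀ t ∈ Ioo s T, r t ≤ 0.87 / t ^ 4)
    (hL : 0 < decayFunctional u g h s) :
    decayFunctional u g h s / s ≤ decayFunctional u g h T / T := by
  have grow : ∀ x ∈ Icc s T, (∀ t ∈ Ico s x, 0 < decayFunctional u g h t / t) →
      decayFunctional u g h s / s ≤ decayFunctional u g h x / x := fun x hx hpos => by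
    refine le_of_hasDerivAt_nonneg hx.1
      (fun t ht => H.hasDerivAt_decayFunctional_div (hs.trans_le ht.1)) fun t ht => ?_
    have ht0 : 0 < t := hs.trans ht.1
    have htT : t ∈ Ioo s T := ⟨ht.1, ht.2.trans_le hx.2⟩
    have h_L := (div_pos_iff_of_pos_right ht0).mp (hpos t ⟨ht.1.le, ht.2⟩)
    have h_r := sub_nonneg.mpr (hr t htT)
    have h_h := neg_pos.mpr (P.h_neg ⟨ht0, htT.2⟩)
    have h_g := neg_pos.mpr (P.g_neg ⟨ht0, htT.2⟩)
    positivity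
  have pos := pos_of_bootstrap (φ := fun t => decayFunctional u g h t / t) (b := T)
    (fun t ht => (H.hasDerivAt_decayFunctional_div (hs.trans_le ht.1)).continuousAt
      |>.continuousWithinAt) (div_pos hL hs) fun t ht hpos =>
        (div_pos hL hs).trans_le (grow t (Ioc_subset_Icc_self ht) hpos)
  exact grow T (right_mem_Icc.mpr hsT) fun t ht => pos t (Ico_subset_Icc_self ht)

namespace IsNeutral

lemma firstPhase_r_le (H : IsNeutral 4 κ f p u g h r)
    (hf : ∀ T, IsFirstPhase u g h T → T ^ 4 ≤ 0.87 * f T ^ 4) (P : IsFirstPhase u g h T)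
    (ht : t ∈ Ioo 0 T) : r t ≤ 0.87 / t ^ 4 :=
  H.r_le_div_pow_four ht.1 (hf t (P.mono ht.1 ht.2.le))

lemma firstPhase_decayFunctional_nonpos (H : IsNeutral 4 κ f p u g h r)
    (hf : ∀ T, IsFirstPhase u g h T → T ^ 4 ≤ 0.87 * f T ^ 4) (P : IsFirstPhase u g h T) :
    decayFunctional u g h T ≤ 0 := by
  by_contra! hL
  have hT := P.pos
  have hc : 0 < decayFunctional u g h T / T := div_pos hL hT
  have grow : ∀ S ≥ T, IsFirstPhase u g h S →
      decayFunctional u g h T / T ≤ decayFunctional u g h S / S := fun S hS PS =>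
    PS.decayFunctional_div_le H.isTriad hT hS
      (fun t ht => H.firstPhase_r_le hf PS ⟨hT.trans ht.1, ht.2⟩) hL
  rcases H.forall_isFirstPhase_or_exists_h_eq_zero with hP | ⟨S, PS, hh, -⟩
  · obtain ⟨S, hST, hcS⟩ := ((eventually_ge_atTop T).and
      ((tendsto_pow_atTop two_ne_zero).const_mul_atTop hc |>.eventually_gt_atTop 2)).exists
    have hS := hT.trans_le hST
    have PS' := hP (S + 1) (by linarith)
    have S_mem : S ∈ Ioo 0 (S + 1) := ⟨hS, lt_add_one S⟩
    have le_u : decayFunctional u g h S / S ≤ u S := by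
      have h_h := div_neg_of_neg_of_pos (PS'.h_neg S_mem) hS
      have h_g := div_neg_of_neg_of_pos (PS'.g_neg S_mem) (pow_pos hS 2)
      rw [div_le_iff₀ hS, decayFunctional]
      linarith
    have := mul_le_mul_of_nonneg_right ((grow S hST (hP S hS)).trans le_u) (sq_nonneg S)
    linarith [H.firstPhase_sq_mul_u_le (hP S hS), PS'.h_neg S_mem]
  · have hS := PS.pos
    have L_pos : 0 < decayFunctional u g h S :=
      (div_pos_iff_of_pos_right hS).mp (hc.trans_le (grow S (P.le_of_h_eq_zero hS hh) PS))
    have h_cube := H.cube_mul_u_le (C := 0.29) (by norm_num) hS hh (H.firstPhase_g_neg PS)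
      (by norm_num; linarith [hf S PS])
    have h_eq : S ^ 2 * decayFunctional u g h S = S ^ 3 * u S - 0.29 * (-g S) := by
      simp only [decayFunctional, hh]
      field_simp
      ring
    linarith [mul_pos (pow_pos hS 2) L_pos]

lemma firstPhase_sq_mul_u_le_of_pow_le (H : IsNeutral 4 κ f p u g h r)
    (hf : ∀ T, IsFirstPhase u g h T → T ^ 4 ≤ 0.87 * f T ^ 4) (P : IsFirstPhase u g h T) :
    T ^ 2 * u T ≤ 0.43 := by
  have hT := P.pos
  have h_nonpos : T ^ 2 * u T + 0.14 * h T + 0.29 * (g T / T) ≤ 0 := by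
    refine (mul_nonpos_of_nonneg_of_nonpos hT.le
      (H.firstPhase_decayFunctional_nonpos hf P)).trans_eq' ?_
    rw [decayFunctional]
    field_simp
    ring
  have h_g : -1 ≤ g T / T := by
    rw [le_div_iff₀ hT]
    linarith [H.neg_le_g hT.le fun _ => P.u_pos]
  linarith [H.neg_one_le_h hT.le fun _ => P.u_pos]

end IsNeutral

end FirstPhaseDecay

section FirstPhaseSlope

variable {m κ b c s t T : ℝ} {f p u g h r : ℝ → ℝ}

namespace IsProfileTrajectory

lemma p_le_of_sq_mul_u_le (H : IsProfileTrajectory m κ f p u g h r) (hs : 0 < s) (hsT : s ≤ T)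
    (hu : ∀ t ∈ Ioo s T, t ^ 2 * u t ≤ c) : p T ≤ p s + c * (s⁻¹ - T⁻¹) := by
  have := sub_le_sub_of_hasDerivAt_le hsT (fun t ht => H.hasDerivAt_p (hs.le.trans ht.1))
    (fun t ht => (hasDerivAt_inv (hs.trans_le ht.1).ne').const_mul (-c)) fun t ht => by
      have := hs.trans ht.1
      rw [neg_mul_neg, ← div_eq_mul_inv, le_div_iff₀ (by positivity), mul_comm]
      exact hu t ht
  linarith

lemma quartic_le_f (H : IsProfileTrajectory m κ f p u g h r) (hm : 0 ≤ m) (ht : 0 ≤ t)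
    (hu : ∀ s ∈ Ioo 0 t, 0 < u s) : 1 + κ * t ^ 2 / 2 - t ^ 4 / 24 ≤ f t := by
  have cubic_le_p : ∀ s ∈ Ioo 0 t, κ * s - s ^ 3 / 6 ≤ p s := fun s hs => by
    have := sub_le_sub_of_hasDerivAt_le hs.1.le (fun x _ => ((hasDerivAt_id x).const_mul κ).sub
      ((hasDerivAt_pow 3 x).div_const 6)) (fun x hx => H.hasDerivAt_p hx.1) fun x hx => by
        have := H.sub_sq_le_u hm hx.1.le fun y hy => hu y ⟨hy.1, hy.2.trans (hx.2.trans hs.2)⟩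
        norm_num
        linarith
    simp only [Pi.sub_apply, id_eq, H.p_zero] at this
    linarith
  have := sub_le_sub_of_hasDerivAt_le ht (fun x _ => ((hasDerivAt_pow 2 x).const_mul (κ / 2)).sub
    ((hasDerivAt_pow 4 x).div_const 24)) (fun x hx => H.hasDerivAt_f hx.1) fun x hx => by
      have := cubic_le_p x hx
      norm_num
      linarith
  simp only [Pi.sub_apply, H.f_zero] at this
  linarith

end IsProfileTrajectory

namespace IsNeutral

lemma firstPhase_one_le_mul_pow (H : IsNeutral m κ f p u g h r) {n : ℕ} (hc : 0 ≤ c)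
    (P : IsFirstPhase u g h s) (hp : ∀ T ≥ s, IsFirstPhase u g h T → p T ≤ b)
    (hf : ∀ T, IsFirstPhase u g h T → T ^ n ≤ c * f T ^ n) : 1 ≤ c * b ^ n := by
  have one_le : ∀ T ≥ s, IsFirstPhase u g h T → 1 ≤ c * (b - h T / T) ^ n := fun T hsT PT => by
    have hT := PT.pos
    have f_div_le : f T / T ≤ b - h T / T := by
      rw [show f T = T * p T - h T by linarith [H.h_eq T], sub_div, mul_div_cancel_left₀ _ hT.ne']
      linarith [hp T hsT PT]
    calc 1 ≤ c * f T ^ n / T ^ n := (one_le_div (by positivity)).mpr (hf T PT)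
      _ = c * (f T / T) ^ n := by rw [div_pow, mul_div_assoc]
      _ ≤ c * (b - h T / T) ^ n := by
        have := H.f_pos hT.le
        gcongr
  rcases H.forall_isFirstPhase_or_exists_h_eq_zero with hP | ⟨T, PT, hh, -⟩
  · have h_div : Tendsto (fun T => h T / T) atTop (𝓝 0) := by
      refine tendsto_of_tendsto_of_tendsto_of_le_of_le' (tendsto_const_nhds.div_atTop tendsto_id)
        tendsto_const_nhds (g := fun T => -1 / T) ?_ ?_ <;>
      filter_upwards [eventually_gt_atTop 0] with T hT
      · gcongr
        exact H.neg_one_le_h hT.le fun _ => (hP T hT).u_pos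
      · exact div_nonpos_of_nonpos_of_nonneg
          ((hP (T + 1) (by linarith)).h_neg ⟨hT, lt_add_one T⟩).le hT.le
    refine ge_of_tendsto (by simpa using ((h_div.const_sub b).pow n).const_mul c) ?_
    filter_upwards [eventually_ge_atTop s] with T hT using one_le T hT (hP T (P.pos.trans_le hT))
  · simpa [hh] using one_le T (P.le_of_h_eq_zero PT.pos hh) PT

lemma firstPhase_le_u_of_sq_le_f (H : IsNeutral 4 κ f p u g h r) (P : IsFirstPhase u g h T)
    (hc : 0 < c) (hf : ∀ t ∈ Ioo 0 T, 1 + c * t ^ 2 ≤ f t) :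
    κ - (1 - ((1 + c * T ^ 2) ^ 3)⁻¹) / (6 * c) ≤ u T := by
  have := sub_le_sub_of_hasDerivAt_le P.pos.le
    (fun t _ => (((((hasDerivAt_pow 2 t).const_mul c).const_add 1).fun_pow 3).fun_inv
      (by positivity)).div_const (6 * c)) (fun t ht => H.hasDerivAt_u ht.1) fun t ht => by
      have ht0 := ht.1
      have : 0 < 1 + c * t ^ 2 := by positivity
      calc _ = -t * ((1 + c * t ^ 2) ^ 4)⁻¹ := by
            push_cast
            field_simp
            norm_num
        _ ≤ -t * r t := by
            rw [neg_mul, neg_mul, neg_le_neg_iff, H.r_eq_inv_pow_four ht.1.le]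
            gcongr
            exact hf t ht
        _ ≤ g t * r t := mul_le_mul_of_nonneg_right
            (H.neg_le_g ht.1.le fun x hx => P.u_pos ⟨hx.1, hx.2.trans ht.2⟩) (H.r_pos t).le
  simp only [H.u_zero, zero_pow two_ne_zero, mul_zero, add_zero, one_pow, inv_one] at this
  rw [sub_div]
  linarith

lemma exists_firstPhase_lt_pow (H : IsNeutral 4 κ f p u g h r) :
    ∃ T, IsFirstPhase u g h T ∧ 0.87 * f T ^ 4 < T ^ 4 := by
  by_contra! hf
  have κ_pos := H.κ_pos
  obtain ⟨τ, hτ, hκτ⟩ : ∃ τ > 0, κ * τ ^ 2 = 1 :=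
    ⟨√κ⁻¹, by positivity, by rw [Real.sq_sqrt (by positivity), mul_inv_cancel₀ κ_pos.ne']⟩
  have inv_τ : τ⁻¹ = κ * τ := inv_eq_of_mul_eq_one_left (by linarith)
  have P : IsFirstPhase u g h τ := H.isFirstPhase_of_mul_sq_le hτ (by linarith)
  have sq_mul_u_le := fun T (PT : IsFirstPhase u g h T) => H.firstPhase_sq_mul_u_le_of_pow_le hf PT
  have u_le : u τ ≤ 0.43 * κ := by
    have := mul_le_mul_of_nonneg_left (sq_mul_u_le τ P) κ_pos.le
    rw [← mul_assoc, hκτ] at this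
    linarith
  have p_le : ∀ T ≥ τ, IsFirstPhase u g h T → p T ≤ 1.24 * (κ * τ) := fun T hT PT => by
    have p_τ_le : p τ ≤ (2 * κ + 0.43 * κ) / 3 * τ := (H.firstPhase_p_le P).trans (by gcongr)
    have := H.p_le_of_sq_mul_u_le hτ hT fun t ht => sq_mul_u_le t (PT.mono (hτ.trans ht.1) ht.2.le)
    rw [inv_τ] at this
    linarith [inv_pos.mpr PT.pos]
  have one_le : 1 ≤ 0.87 * 1.24 ^ 4 * κ ^ 2 := by
    calc 1 ≤ 0.87 * (1.24 * (κ * τ)) ^ 4 := H.firstPhase_one_le_mul_pow (by norm_num) P p_le hf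
      _ = 0.87 * 1.24 ^ 4 * κ ^ 2 * (κ * τ ^ 2) ^ 2 := by ring
      _ = 0.87 * 1.24 ^ 4 * κ ^ 2 := by rw [hκτ, one_pow, mul_one]
  have le_f : ∀ t ∈ Ioo 0 τ, 1 + 0.4 * κ * t ^ 2 ≤ f t := fun t ht => by
    have quartic := H.quartic_le_f zero_le_four ht.1.le fun s hs => P.u_pos ⟨hs.1, hs.2.trans ht.2⟩
    have sq_le : t ^ 2 ≤ 2.4 * κ := by
      calc t ^ 2 ≤ 1 * τ ^ 2 := (pow_le_pow_left₀ ht.1.le ht.2.le 2).trans_eq (one_mul _).symm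
        _ ≤ 0.87 * 1.24 ^ 4 * κ ^ 2 * τ ^ 2 := mul_le_mul_of_nonneg_right one_le (sq_nonneg τ)
        _ = 0.87 * 1.24 ^ 4 * κ * (κ * τ ^ 2) := by ring
        _ ≤ 2.4 * κ := by rw [hκτ]; linarith
    linarith [mul_le_mul_of_nonneg_left sq_le (sq_nonneg t)]
  have := (H.firstPhase_le_u_of_sq_le_f P (by positivity) le_f).trans u_le
  rw [mul_assoc, hκτ, sub_le_iff_le_add, ← sub_le_iff_le_add', le_div_iff₀ (by positivity)] at this
  norm_num at this one_le
  linarith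

end IsNeutral

end FirstPhaseSlope

section Decay

variable {m κ a c t T : ℝ} {f p u g h r : ℝ → ℝ}

lemma tendsto_zero_of_sq_le_div {φ : ℝ → ℝ} {C : ℝ} (h : ∀ᶠ t in atTop, φ t ^ 2 ≤ C / t) :
    Tendsto φ atTop (𝓝 0) := by
  have h_div : Tendsto (fun t : ℝ => C / t) atTop (𝓝 0) :=
    tendsto_const_nhds.div_atTop tendsto_id
  have h_sq : Tendsto (fun t => φ t ^ 2) atTop (𝓝 0) :=
    squeeze_zero' (Eventually.of_forall fun t => sq_nonneg _) h h_div
  have h_abs := h_sq.sqrt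
  simp only [Real.sqrt_sq_eq_abs, Real.sqrt_zero] at h_abs
  exact (tendsto_zero_iff_abs_tendsto_zero φ).mpr h_abs

namespace IsProfileTrajectory

lemma tendsto_f_div (H : IsProfileTrajectory m κ f p u g h r) (ha : Tendsto p atTop (𝓝 a)) :
    Tendsto (fun t => f t / t) atTop (𝓝 a) :=
  tendsto_div_id_of_tendsto_deriv (a := 0) (fun _ ht => H.hasDerivAt_f ht) ha

lemma f_div_le_of_h_nonpos (H : IsProfileTrajectory m κ f p u g h r) (ht : 0 < t) (htT : t ≤ T)
    (hh : ∀ s ∈ Ioo t T, h s ≤ 0) : f T / T ≤ f t / t := by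
  have := sub_le_sub_of_hasDerivAt_le htT (fun s hs => H.hasDerivAt_f_div (ht.trans_le hs.1))
    (fun s _ => hasDerivAt_const s (0 : ℝ)) fun s hs =>
      div_nonpos_of_nonpos_of_nonneg (hh s hs) (sq_nonneg s)
  linarith

end IsProfileTrajectory

namespace IsNeutral

lemma h_sq_div_sub_lyap_le (H : IsNeutral m κ f p u g h r) (ht : 0 < t) (htT : t ≤ T) :
    h T ^ 2 / T - lyap u g h r T ≤ h t ^ 2 / t - lyap u g h r t := by
  have := sub_le_sub_of_hasDerivAt_le htT
    (fun s hs => ((H.hasDerivAt_h (ht.le.trans hs.1)).fun_pow 2).fun_div (hasDerivAt_id' s)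
      (ht.trans_le hs.1).ne')
    (fun s hs => H.hasDerivAt_lyap (ht.trans_le hs.1)) fun s hs => by
      have hs0 := ht.trans hs.1
      refine le_trans ?_ (H.sq_mul_sq_add_le_lyap_deriv hs0.le)
      have h_eq : ((2 : ℕ) * h s ^ (2 - 1) * (s * u s) * s - h s ^ 2 * 1) / s ^ 2
          = s ^ 2 * u s ^ 2 - (h s / s - s * u s) ^ 2 := by
        push_cast
        field_simp
        ring
      rw [h_eq]
      have : 0 ≤ 3 / 4 * (h s ^ 2 / s ^ 2) := by positivity
      linarith [sq_nonneg (h s / s - s * u s)]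
  linarith

lemma g_sq_div_sub_lyap_le (H : IsNeutral m κ f p u g h r) (ht : 0 < t) (htT : t ≤ T) :
    g T ^ 2 / T ^ 3 - lyap u g h r T ≤ g t ^ 2 / t ^ 3 - lyap u g h r t := by
  have := sub_le_sub_of_hasDerivAt_le htT
    (fun s hs => ((H.hasDerivAt_g (ht.le.trans hs.1)).fun_pow 2).fun_div (hasDerivAt_pow 3 s)
      (pow_ne_zero 3 (ht.trans_le hs.1).ne'))
    (fun s hs => H.hasDerivAt_lyap (ht.trans_le hs.1)) fun s hs => by
      have hs0 := ht.trans hs.1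
      refine le_trans ?_ (H.sq_mul_sq_add_le_lyap_deriv hs0.le)
      have h_eq : ((2 : ℕ) * g s ^ (2 - 1) * h s * s ^ 3 - g s ^ 2 * ((3 : ℕ) * s ^ (3 - 1))) /
          (s ^ 3) ^ 2 = h s ^ 2 / s ^ 2 / 3 - 3 * (g s / s ^ 2 - h s / s / 3) ^ 2 := by
        push_cast
        field_simp
        ring
      rw [h_eq]
      have : 0 ≤ h s ^ 2 / s ^ 2 := by positivity
      have : 0 ≤ s ^ 2 * u s ^ 2 := by positivity
      linarith [sq_nonneg (g s / s ^ 2 - h s / s / 3)]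
  linarith

lemma pow_four_mul_le (H : IsNeutral 4 κ f p u g h r) (ht : 0 < t) (hc : 0 ≤ c) (hcp : c ≤ p t)
    (hcf : c ≤ f t / t) :
    c ^ 4 * (t ^ 4 * g t ^ 2 * r t ^ 2) ≤ t * r t * (p t / f t) * g t ^ 2 := by
  have hf := H.f_pos ht.le
  have hr := H.r_eq_inv_pow_four ht.le
  have h_pow : c ^ 4 ≤ (f t / t) ^ 3 * p t := by
    rw [pow_succ]
    gcongr
  have h_eq : t * r t * (p t / f t) * g t ^ 2
      = (f t / t) ^ 3 * p t * (t ^ 4 * g t ^ 2 * r t ^ 2) := by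
    rw [hr]
    field_simp
  rw [h_eq]
  gcongr

lemma cube_mul_u_sq_sub_lyap_le (H : IsNeutral 4 κ f p u g h r) (ht : 0 < t) (htT : t ≤ T)
    (hc : 0 ≤ c) (hcp : ∀ s ∈ Ioo t T, c ≤ p s) (hcf : ∀ s ∈ Ioo t T, c ≤ f s / s) :
    c ^ 4 * (T ^ 3 * u T ^ 2) - (4 * c ^ 4 + 1) * lyap u g h r T ≤
      c ^ 4 * (t ^ 3 * u t ^ 2) - (4 * c ^ 4 + 1) * lyap u g h r t := by
  have := sub_le_sub_of_hasDerivAt_le htT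
    (fun s hs => ((hasDerivAt_pow 3 s).fun_mul
      ((H.hasDerivAt_u (ht.le.trans hs.1)).fun_pow 2)).const_mul (c ^ 4))
    (fun s hs => (H.hasDerivAt_lyap (ht.trans_le hs.1)).const_mul (4 * c ^ 4 + 1)) fun s hs => by
      have hs0 := ht.trans hs.1
      have hp := hc.trans (hcp s hs)
      have hf := H.f_pos hs0.le
      have hr := H.r_pos s
      have h_sq : s ^ 3 * (2 * u s * (g s * r s)) ≤
          s ^ 2 * u s ^ 2 + s ^ 4 * g s ^ 2 * r s ^ 2 := by
        linarith [sq_nonneg (s * u s - s ^ 2 * g s * r s)]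
      have h_gr := H.pow_four_mul_le hs0 hc (hcp s hs) (hcf s hs)
      set Q := s * r s * (p s / f s) * g s ^ 2 with hQ
      have hQ0 : 0 ≤ Q := by positivity
      calc c ^ 4 * ((3 : ℕ) * s ^ (3 - 1) * u s ^ 2 + s ^ 3 * ((2 : ℕ) * u s ^ (2 - 1) *
            (g s * r s)))
          = c ^ 4 * (3 * s ^ 2 * u s ^ 2 + s ^ 3 * (2 * u s * (g s * r s))) := by norm_num
        _ ≤ c ^ 4 * (3 * s ^ 2 * u s ^ 2 + (s ^ 2 * u s ^ 2 + s ^ 4 * g s ^ 2 * r s ^ 2)) := by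
          gcongr
        _ ≤ 4 * c ^ 4 * (s ^ 2 * u s ^ 2) + Q := by linarith
        _ ≤ (4 * c ^ 4 + 1) * (s ^ 2 * u s ^ 2) + (4 * c ^ 4 + 1) * (2 * Q) := by
          have : 0 ≤ s ^ 2 * u s ^ 2 := by positivity
          have : 0 ≤ c ^ 4 * Q := by positivity
          linarith
        _ = (4 * c ^ 4 + 1) * (s ^ 2 * u s ^ 2 + 4 / 2 * s * r s * (p s / f s) * g s ^ 2) := by
          rw [hQ]
          ring
        _ ≤ _ := by
          gcongr
          have : 0 ≤ h s ^ 2 / s ^ 2 := by positivity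
          linarith
  linarith

lemma exists_forall_sq_le_div (H : IsNeutral 4 κ f p u g h r) (ha0 : 0 < a)
    (ha : Tendsto p atTop (𝓝 a)) :
    ∃ C, ∀ᶠ t in atTop,
      (h t / t) ^ 2 ≤ C / t ∧ (t * u t) ^ 2 ≤ C / t ∧ (g t / t ^ 2) ^ 2 ≤ C / t := by
  obtain ⟨T, hT⟩ := eventually_atTop.mp ((eventually_gt_atTop 0).and
    ((ha.eventually (lt_mem_nhds (half_lt_self ha0))).and
      ((H.tendsto_f_div ha).eventually (lt_mem_nhds (half_lt_self ha0)))))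
  have hT0 : 0 < T := (hT T le_rfl).1
  set l := lyap u g h r
  set c := a / 2
  have hc : 0 < c := half_pos ha0
  refine ⟨max (h T ^ 2 / T - l T) (max
    ((c ^ 4 * (T ^ 3 * u T ^ 2) - (4 * c ^ 4 + 1) * l T) / c ^ 4) (g T ^ 2 / T ^ 3 - l T)),
    eventually_atTop.mpr ⟨T, fun t ht => ?_⟩⟩
  have ht0 := hT0.trans_le ht
  have hl : l t ≤ 0 := H.lyap_nonpos ht0
  have h_h : h t ^ 2 / t ≤ h T ^ 2 / T - l T := by linarith [H.h_sq_div_sub_lyap_le hT0 ht]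
  have h_u : t ^ 3 * u t ^ 2 ≤ (c ^ 4 * (T ^ 3 * u T ^ 2) - (4 * c ^ 4 + 1) * l T) / c ^ 4 := by
    rw [le_div_iff₀ (by positivity)]
    have := H.cube_mul_u_sq_sub_lyap_le hT0 ht hc.le (fun s hs => (hT s hs.1.le).2.1.le)
      fun s hs => (hT s hs.1.le).2.2.le
    have : (4 * c ^ 4 + 1) * l t ≤ 0 := mul_nonpos_of_nonneg_of_nonpos (by positivity) hl
    linarith
  have h_g : g t ^ 2 / t ^ 3 ≤ g T ^ 2 / T ^ 3 - l T := by
    linarith [H.g_sq_div_sub_lyap_le hT0 ht]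
  refine ⟨(le_div_iff₀ ht0).mpr ?_, (le_div_iff₀ ht0).mpr ?_, (le_div_iff₀ ht0).mpr ?_⟩
  · calc (h t / t) ^ 2 * t = h t ^ 2 / t := by field_simp
      _ ≤ _ := h_h.trans (le_max_left _ _)
  · calc (t * u t) ^ 2 * t = t ^ 3 * u t ^ 2 := by ring
      _ ≤ _ := h_u.trans ((le_max_left _ _).trans (le_max_right _ _))
  · calc (g t / t ^ 2) ^ 2 * t = g t ^ 2 / t ^ 3 := by field_simp
      _ ≤ _ := h_g.trans ((le_max_right _ _).trans (le_max_right _ _))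

end IsNeutral

end Decay

section AlmostConserved

variable {m κ a t T : ℝ} {f p u g h r : ℝ → ℝ}

namespace IsNeutral

lemma firstPhase_neg_le_p_sub (H : IsNeutral m κ f p u g h r) (P : IsFirstPhase u g h T) :
    -(T ^ 2 * (g T * r T) / 3) ≤ p T - T * u T := by
  have hT := P.pos
  have := sub_le_sub_of_hasDerivAt_le hT.le
    (fun s _ => ((hasDerivAt_pow 3 s).div_const 3).const_mul (-(g T * r T / T)))
    (fun s hs => (H.hasDerivAt_p hs.1).sub ((hasDerivAt_id s).mul (H.hasDerivAt_u hs.1)))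
    fun s hs => by
      have h_gr := H.firstPhase_g_mul_r_mul_le P hs.1 hs.2.le
      rw [← le_div_iff₀ hT] at h_gr
      have := mul_le_mul_of_nonneg_left h_gr hs.1.le
      simp only [id]
      norm_num
      calc s * (g s * r s) ≤ s * (g T * r T * s / T) := this
        _ = g T * r T / T * s ^ 2 := by ring
  have h_eq : -(g T * r T / T) * (T ^ 3 / 3) = -(T ^ 2 * (g T * r T) / 3) := by field_simp
  simp only [Pi.sub_apply, Pi.mul_apply, id_eq, H.p_zero, h_eq] at this
  linarith

lemma firstPhase_neg_g_add_le (H : IsNeutral m κ f p u g h r) (P : IsFirstPhase u g h T) :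
    -g T + T * h T ≤ T ^ 3 * u T / 3 + 1 / 5 * T ^ 2 * (p T - T * u T) := by
  have := sub_le_sub_of_hasDerivAt_le P.pos.le
    (fun s hs => ((hasDerivAt_id s).mul (H.hasDerivAt_h hs.1)).sub (H.hasDerivAt_g hs.1))
    (fun s hs => (((hasDerivAt_pow 3 s).mul (H.hasDerivAt_u hs.1)).div_const 3).add
      (((hasDerivAt_pow 2 s).mul ((H.hasDerivAt_p hs.1).sub ((hasDerivAt_id s).mul
        (H.hasDerivAt_u hs.1)))).const_mul (1 / 5)))
    fun s hs => by
      have := mul_le_mul_of_nonneg_left (H.firstPhase_neg_le_p_sub (P.mono hs.1 hs.2.le)) hs.1.le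
      simp only [id, Pi.sub_apply, Pi.mul_apply]
      norm_num
      linarith
  simp only [Pi.sub_apply, Pi.add_apply, Pi.mul_apply, id_eq, H.g_zero] at this
  linarith

end IsNeutral

/-- A combination whose derivative is cubic in the deviation `h` of the profile from a linear
function; it transports information from the end of the first phase to infinity. -/
noncomputable def almostConserved (f u g h : ℝ → ℝ) (t : ℝ) : ℝ :=
  f t / t - g t / t ^ 2 - 2 * (f t / t) ^ 4 * (t * u t - h t / t)
    + 4 * (f t / t) ^ 3 * (h t / t) ^ 2 + 0.4 * (f t / t) ^ 5

namespace IsNeutral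

lemma hasDerivAt_almostConserved (H : IsNeutral 4 κ f p u g h r) (ht : 0 < t) :
    HasDerivAt (almostConserved f u g h)
      (12 * (f t / t) ^ 2 * (h t ^ 2 / t ^ 2 * (h t / t ^ 2))) t := by
  have h_f := H.hasDerivAt_f_div ht
  have h_h := (H.hasDerivAt_h ht.le).fun_div (hasDerivAt_id' t) ht.ne'
  have h_g := (H.hasDerivAt_g ht.le).fun_div (hasDerivAt_pow 2 t) (pow_ne_zero 2 ht.ne')
  have h_u := (hasDerivAt_id' t).fun_mul (H.hasDerivAt_u ht.le)
  have := (((h_f.fun_sub h_g).fun_sub (((h_f.fun_pow 4).const_mul 2).fun_mul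
    (h_u.fun_sub h_h))).fun_add (((h_f.fun_pow 3).const_mul 4).fun_mul (h_h.fun_pow 2))).fun_add
    ((h_f.fun_pow 5).const_mul 0.4)
  refine this.congr_deriv ?_
  have hf0 := (H.f_pos ht.le).ne'
  rw [H.r_eq_inv_pow_four ht.le]
  push_cast
  field_simp
  ring

lemma tendsto_almostConserved (H : IsNeutral 4 κ f p u g h r) (ha0 : 0 < a)
    (ha : Tendsto p atTop (𝓝 a)) :
    Tendsto (almostConserved f u g h) atTop (𝓝 (a + 0.4 * a ^ 5)) := by
  obtain ⟨C, hC⟩ := H.exists_forall_sq_le_div ha0 ha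
  have h_f := H.tendsto_f_div ha
  have h_h := tendsto_zero_of_sq_le_div (hC.mono fun t ht => ht.1)
  have h_u := tendsto_zero_of_sq_le_div (hC.mono fun t ht => ht.2.1)
  have h_g := tendsto_zero_of_sq_le_div (hC.mono fun t ht => ht.2.2)
  have := (((h_f.sub h_g).sub (((h_f.pow 4).const_mul 2).mul (h_u.sub h_h))).add
    (((h_f.pow 3).const_mul 4).mul (h_h.pow 2))).add ((h_f.pow 5).const_mul 0.4)
  refine (this.congr fun t => rfl).trans_eq ?_
  simp

end IsNeutral

end AlmostConserved

section SlopeBound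

section Arithmetic

variable {V G e w : ℝ}

lemma mul_mul_sub_le_of_sq_mul_le (hV : 0 < V) (hG : 0 ≤ G) (he : e ^ 2 * V ^ 4 ≤ 2 / 3 * G ^ 2)
    (hGV : G * (V ^ 4 - 2 / 45) ≤ 0.2 * V ^ 5) (hw : 2 / 45 < w) (hwV : w ≤ V ^ 4) :
    e * V * (w - 2 / 45) ≤ 0.1633 * w := by
  have : 0 < w - 2 / 45 := sub_pos.mpr hw
  have : 0 < w := lt_trans (by norm_num) hw
  have he' : e * V ^ 2 ≤ 0.8165 * G := by
    refine le_of_sq_le_sq ?_ (by positivity)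
    linarith [sq_nonneg G]
  have hGw : G * (w - 2 / 45) ≤ 0.2 * V * w := by
    refine le_of_mul_le_mul_left (a := V ^ 4) ?_ (by positivity)
    calc V ^ 4 * (G * (w - 2 / 45)) = G * (V ^ 4 * w - 2 / 45 * V ^ 4) := by ring
      _ ≤ G * (V ^ 4 * w - 2 / 45 * w) := by gcongr
      _ = G * (V ^ 4 - 2 / 45) * w := by ring
      _ ≤ 0.2 * V ^ 5 * w := by gcongr
      _ = V ^ 4 * (0.2 * V * w) := by ring
  refine le_of_mul_le_mul_left (a := V) ?_ hV
  calc V * (e * V * (w - 2 / 45)) = e * V ^ 2 * (w - 2 / 45) := by ring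
    _ ≤ 0.8165 * G * (w - 2 / 45) := by gcongr
    _ ≤ V * (0.1633 * w) := by linarith

lemma add_le_of_sq_mul_le (hV : 0 < V) (hV' : V ≤ 0.92) (hG : 0 ≤ G)
    (heV : e ^ 2 ≤ 2 / 3 * V ^ 2) (he : e ^ 2 * V ^ 4 ≤ 2 / 3 * G ^ 2)
    (hGV : G * (V ^ 4 - 2 / 45) ≤ 0.2 * V ^ 5) : V + e ≤ 1.1211 := by
  rcases le_or_gt V 0.61 with h₁ | h₁
  · have : e ≤ 0.8165 * V := le_of_sq_le_sq (by linarith [sq_nonneg V]) (by positivity)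
    linarith
  refine le_of_mul_le_mul_left (a := V) ?_ hV
  rcases le_or_gt V 0.8 with h₂ | h₂
  · have : (0.61 : ℝ) ^ 4 ≤ V ^ 4 := by gcongr
    have := mul_mul_sub_le_of_sq_mul_le (w := 0.138) hV hG he hGV (by norm_num) (by linarith)
    linarith [mul_nonneg (sub_nonneg.mpr h₁.le) (sub_nonneg.mpr h₂)]
  · have : (0.8 : ℝ) ^ 4 ≤ V ^ 4 := by gcongr
    have := mul_mul_sub_le_of_sq_mul_le (w := 0.4096) hV hG he hGV (by norm_num) (by linarith)
    linarith [mul_nonneg (sub_nonneg.mpr h₂.le) (sub_nonneg.mpr hV')]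

lemma add_cube_lt_of_sq_mul_le (hV : 0.92 < V) (hV' : 0.87 * V ^ 4 ≤ 1) (hG : 0 ≤ G)
    (he0 : 0 ≤ e) (he : e ^ 2 * V ^ 4 ≤ 2 / 3 * G ^ 2)
    (hGV : G * (V ^ 4 - 2 / 45) ≤ 0.2 * V ^ 5) :
    1.2 * V + 0.4 * V ^ 5 + 16 * (V + e) ^ 2 * e ^ 3 < 1.1211 + 0.4 * (1.1211 * 1.58) := by
  have hV0 : 0 < V := lt_trans (by norm_num) hV
  rcases le_or_gt V 1.02 with h₁ | h₁
  · have : (0.92 : ℝ) ^ 4 ≤ V ^ 4 := by gcongr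
    have h_mul := mul_mul_sub_le_of_sq_mul_le (w := 0.716) hV0 hG he hGV (by norm_num)
      (by linarith)
    have he' : e ≤ 0.1893 := by
      refine le_of_mul_le_mul_right ?_ hV0
      linarith
    calc 1.2 * V + 0.4 * V ^ 5 + 16 * (V + e) ^ 2 * e ^ 3
        ≤ 1.2 * 1.02 + 0.4 * 1.02 ^ 5 + 16 * (1.02 + 0.1893) ^ 2 * 0.1893 ^ 3 := by gcongr
      _ < _ := by norm_num
  · have : (1.02 : ℝ) ^ 4 ≤ V ^ 4 := by gcongr
    have h_mul := mul_mul_sub_le_of_sq_mul_le (w := 1.082) hV0 hG he hGV (by norm_num)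
      (by linarith)
    have he' : e ≤ 0.167 := by
      refine le_of_mul_le_mul_right ?_ hV0
      linarith
    have hV'' : V ≤ 1.0355 := by
      refine le_of_not_gt fun hlt => ?_
      have : (1.0355 : ℝ) ^ 4 ≤ V ^ 4 := by gcongr
      linarith
    calc 1.2 * V + 0.4 * V ^ 5 + 16 * (V + e) ^ 2 * e ^ 3
        ≤ 1.2 * 1.0355 + 0.4 * 1.0355 ^ 5 + 16 * (1.0355 + 0.167) ^ 2 * 0.167 ^ 3 := by gcongr
      _ < _ := by norm_num

-- `V` is the slope at the end of the first phase and `e` bounds its variation afterwards.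
lemma pow_four_le_of_slope_bounds {a : ℝ} (ha : 0 < a) (hV : 0 < V) (hV4 : 0.87 * V ^ 4 ≤ 1)
    (hG : 0 ≤ G) (he0 : 0 ≤ e) (heV : e ^ 2 ≤ 2 / 3 * V ^ 2) (he : e ^ 2 * V ^ 4 ≤ 2 / 3 * G ^ 2)
    (hGV : G * (V ^ 4 - 2 / 45) ≤ 0.2 * V ^ 5) (haV : a ≤ V + e)
    (h : 1 / 15 ≤ V ^ 4 → a + 0.4 * a ^ 5 ≤ 1.2 * V + 0.4 * V ^ 5 + 16 * (V + e) ^ 2 * e ^ 3) :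
    a ^ 4 ≤ 1.58 := by
  rcases le_or_gt V 0.92 with hV' | hV'
  · calc a ^ 4 ≤ 1.1211 ^ 4 := by
          gcongr
          exact haV.trans (add_le_of_sq_mul_le hV hV' hG heV he hGV)
      _ ≤ 1.58 := by norm_num
  · refine le_of_not_gt fun ha4 => ?_
    have ha' : 1.1211 < a := lt_of_pow_lt_pow_left₀ 4 ha.le (lt_of_le_of_lt (by norm_num) ha4)
    have ha5 : 1.1211 * 1.58 ≤ a ^ 5 := by
      calc 1.1211 * 1.58 ≤ a * a ^ 4 := by gcongr
        _ = a ^ 5 := by ring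
    have hV5 : (0.92 : ℝ) ^ 4 ≤ V ^ 4 := by gcongr
    have := h (by linarith)
    linarith [add_cube_lt_of_sq_mul_le hV' hV4 hG he0 he hGV]

end Arithmetic

variable {κ a t T M : ℝ} {f p u g h r : ℝ → ℝ}

lemma IsProfileTrajectory.f_eq_of_h_eq_zero {m : ℝ} (H : IsProfileTrajectory m κ f p u g h r)
    (hh : h T = 0) : f T = T * p T := by
  linarith [H.h_eq T]

namespace IsNeutral

lemma firstPhase_three_mul_le (H : IsNeutral 4 κ f p u g h r) (P : IsFirstPhase u g h T)
    (hh : h T = 0) : T * u T * (3 * p T ^ 4) ≤ -g T / T ^ 2 := by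
  have hT := P.pos
  have hp := H.firstPhase_p_pos P
  have := H.cube_mul_u_le (C := 1 / (3 * p T ^ 4)) (by positivity) hT hh (H.firstPhase_g_neg P) (by
    rw [H.f_eq_of_h_eq_zero hh]
    apply le_of_eq
    field_simp)
  rw [le_div_iff₀ (by positivity)]
  calc T * u T * (3 * p T ^ 4) * T ^ 2 = T ^ 3 * u T * (3 * p T ^ 4) := by ring
    _ ≤ 1 / (3 * p T ^ 4) * -g T * (3 * p T ^ 4) := by gcongr
    _ = -g T := by field_simp

lemma firstPhase_neg_g_div_le (H : IsNeutral 4 κ f p u g h r) (P : IsFirstPhase u g h T)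
    (hh : h T = 0) : -g T / T ^ 2 ≤ 0.2 * p T + 2 / 15 * (T * u T) := by
  rw [div_le_iff₀ (pow_pos P.pos 2)]
  have := H.firstPhase_neg_g_add_le P
  rw [hh] at this
  linarith

lemma firstPhase_neg_lyap_div_mul (H : IsNeutral 4 κ f p u g h r) (P : IsFirstPhase u g h T)
    (hh : h T = 0) : -lyap u g h r T / T * p T ^ 4 =
      (-g T / T ^ 2) ^ 2 / 2 + -g T / T ^ 2 * (T * u T * p T ^ 4) / 2 := by
  have hT := P.pos
  have hp := H.firstPhase_p_pos P
  rw [lyap_of_h_eq_zero hT.ne' hh, H.r_eq_inv_pow_four hT.le, H.f_eq_of_h_eq_zero hh]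
  field_simp
  ring

lemma firstPhase_almostConserved_le (H : IsNeutral 4 κ f p u g h r) (P : IsFirstPhase u g h T)
    (hh : h T = 0) (hu : 0 ≤ u T) (hp : 1 / 15 ≤ p T ^ 4) :
    almostConserved f u g h T ≤ 1.2 * p T + 0.4 * p T ^ 5 := by
  have hT := P.pos
  calc almostConserved f u g h T
      = p T + -g T / T ^ 2 - 2 * p T ^ 4 * (T * u T) + 0.4 * p T ^ 5 := by
        have : f T / T = p T := by rw [H.f_eq_of_h_eq_zero hh, mul_div_cancel_left₀ _ hT.ne']
        rw [almostConserved, this, hh]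
        ring
    _ ≤ p T + (0.2 * p T + 2 / 15 * (T * u T)) - 2 * (1 / 15) * (T * u T) + 0.4 * p T ^ 5 := by
        gcongr
        exact H.firstPhase_neg_g_div_le P hh
    _ = 1.2 * p T + 0.4 * p T ^ 5 := by ring

lemma h_div_sq_le_sqrt (H : IsNeutral 4 κ f p u g h r) (hT : 0 < T) (hTt : T ≤ t)
    (hh : h T = 0) : h t / t ^ 2 ≤ √(-lyap u g h r T / T) / T := by
  have ht := hT.trans_le hTt
  rw [le_div_iff₀ hT]
  refine (le_abs_self _).trans (Real.abs_le_sqrt ?_)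
  have h_sq : h t ^ 2 / t ≤ -lyap u g h r T := by
    have := H.h_sq_div_sub_lyap_le hT hTt
    rw [hh, zero_pow two_ne_zero, zero_div] at this
    linarith [H.lyap_nonpos ht]
  calc (h t / t ^ 2 * T) ^ 2 = h t ^ 2 / t * (T ^ 2 / t ^ 3) := by field_simp
    _ ≤ h t ^ 2 / t * (T ^ 2 / T ^ 3) := by gcongr
    _ = h t ^ 2 / t / T := by field_simp
    _ ≤ _ := by gcongr

lemma almostConserved_le (H : IsNeutral 4 κ f p u g h r) (hT : 0 < T) (hTt : T ≤ t)
    (hh : h T = 0) (hM : ∀ s ∈ Ioo T t, f s / s ≤ M) :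
    almostConserved f u g h t ≤
      almostConserved f u g h T + 16 * M ^ 2 * √(-lyap u g h r T / T) ^ 3 := by
  set e := √(-lyap u g h r T / T) with he
  have h_lyap : -lyap u g h r T = e ^ 2 * T := by
    rw [he, Real.sq_sqrt (div_nonneg (neg_nonneg.mpr (H.lyap_nonpos hT)) hT.le),
      div_mul_cancel₀ _ hT.ne']
  have := sub_le_sub_of_hasDerivAt_le hTt
    (fun s hs => H.hasDerivAt_almostConserved (hT.trans_le hs.1))
    (fun s hs => (H.hasDerivAt_lyap (hT.trans_le hs.1)).const_mul (16 * M ^ 2 * (e / T)))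
    fun s hs => by
      have hs0 := hT.trans hs.1
      have hf := H.f_pos hs0.le
      have h_div := H.h_div_sq_le_sqrt hT hs.1.le hh
      have h_deriv := H.sq_mul_sq_add_le_lyap_deriv hs0.le
      have : 0 ≤ s ^ 2 * u s ^ 2 := by positivity
      calc 12 * (f s / s) ^ 2 * (h s ^ 2 / s ^ 2 * (h s / s ^ 2))
          ≤ 12 * (f s / s) ^ 2 * (h s ^ 2 / s ^ 2 * (e / T)) := by gcongr
        _ ≤ 12 * M ^ 2 * (h s ^ 2 / s ^ 2 * (e / T)) := by
          gcongr
          exact hM s hs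
        _ = 16 * M ^ 2 * (e / T) * (3 / 4 * (h s ^ 2 / s ^ 2)) := by ring
        _ ≤ _ := by
          gcongr
          linarith
  calc almostConserved f u g h t
      ≤ almostConserved f u g h T
        + 16 * M ^ 2 * (e / T) * (lyap u g h r t + -lyap u g h r T) := by linarith
    _ ≤ almostConserved f u g h T + 16 * M ^ 2 * (e / T) * (0 + e ^ 2 * T) := by
        rw [h_lyap]
        gcongr
        exact H.lyap_nonpos (hT.trans_le hTt)
    _ = _ := by
        field_simp
        ring

lemma f_div_le_of_forall_p_le {m : ℝ} (H : IsNeutral m κ f p u g h r) (hT : 0 < T) (hTt : T ≤ t)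
    (hfT : f T ≤ M * T) (hp : ∀ s ∈ Ioo T t, p s ≤ M) : f t / t ≤ M := by
  rw [div_le_iff₀ (hT.trans_le hTt)]
  have := sub_le_sub_of_hasDerivAt_le hTt (fun s hs => H.hasDerivAt_f (hT.le.trans hs.1))
    (fun s _ => (hasDerivAt_id' s).const_mul M) (by simpa only [mul_one] using hp)
  linarith

lemma limit_pow_four_le_of_h_eq_zero (H : IsNeutral 4 κ f p u g h r) (ha0 : 0 < a)
    (ha : Tendsto p atTop (𝓝 a)) (P : IsFirstPhase u g h T) (hh : h T = 0) (hu : 0 < u T)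
    (hp4 : 0.87 * p T ^ 4 ≤ 1) : a ^ 4 ≤ 1.58 := by
  have hT := P.pos
  have hp := H.firstPhase_p_pos P
  set e := √(-lyap u g h r T / T)
  have he_sq : e ^ 2 = -lyap u g h r T / T :=
    Real.sq_sqrt (div_nonneg (neg_nonneg.mpr (H.lyap_nonpos hT)) hT.le)
  have hp_le : ∀ t ≥ T, p t ≤ p T + e := fun t ht => by
    have := H.abs_p_sub_le_sqrt hT ht (E := -lyap u g h r T / T) (by field_simp)
      (H.lyap_nonpos (hT.trans_le ht))
    linarith [le_abs_self (p t - p T)]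
  have hG0 : 0 < -g T / T ^ 2 := div_pos (neg_pos.mpr (H.firstPhase_g_neg P)) (by positivity)
  have hUG := H.firstPhase_three_mul_le P hh
  refine pow_four_le_of_slope_bounds (V := p T) (G := -g T / T ^ 2) (e := e) ha0 hp hp4 hG0.le
    (Real.sqrt_nonneg _) ?_ ?_ ?_ ?_ fun hV => ?_
  · rw [he_sq, lyap_of_h_eq_zero hT.ne' hh, neg_neg, mul_div_cancel_left₀ _ hT.ne']
    exact H.firstPhase_neg_lyap_div_le P hh hu.le
  · rw [he_sq, H.firstPhase_neg_lyap_div_mul P hh]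
    linarith [mul_le_mul_of_nonneg_left hUG hG0.le]
  · linarith [mul_le_mul_of_nonneg_right (H.firstPhase_neg_g_div_le P hh) (pow_pos hp 4).le]
  · exact le_of_tendsto ha ((eventually_ge_atTop T).mono hp_le)
  · refine le_of_tendsto (H.tendsto_almostConserved ha0 ha)
      ((eventually_ge_atTop T).mono fun t ht => ?_)
    have hfT : f T ≤ (p T + e) * T := by
      rw [H.f_eq_of_h_eq_zero hh]
      linarith [mul_nonneg (Real.sqrt_nonneg _ : 0 ≤ e) hT.le]
    refine (H.almostConserved_le hT ht hh fun s hs => H.f_div_le_of_forall_p_le hT hs.1.le hfT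
      fun x hx => hp_le x hx.1.le).trans ?_
    gcongr
    exact H.firstPhase_almostConserved_le P hh hu.le hV

lemma limit_pow_four_le (H : IsNeutral 4 κ f p u g h r) (ha0 : 0 < a)
    (ha : Tendsto p atTop (𝓝 a)) : a ^ 4 ≤ 1.58 := by
  obtain ⟨S, PS, hS⟩ := H.exists_firstPhase_lt_pow
  have hS0 := PS.pos
  have hfS : 0.87 * (f S / S) ^ 4 ≤ 1 := by
    rw [div_pow, ← mul_div_assoc, div_le_one (by positivity)]
    exact hS.le
  rcases H.forall_isFirstPhase_or_exists_h_eq_zero with hP | ⟨T, P, hh, hu⟩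
  · have ha_le : a ≤ f S / S := le_of_tendsto (H.tendsto_f_div ha) <| by
      filter_upwards [eventually_ge_atTop S] with t ht
      exact H.f_div_le_of_h_nonpos hS0 ht fun s hs =>
        ((hP t (hS0.trans_le ht)).h_neg ⟨hS0.trans hs.1, hs.2⟩).le
    have : a ^ 4 ≤ (f S / S) ^ 4 := by gcongr
    linarith
  · have hST : S ≤ T := PS.le_of_h_eq_zero P.pos hh
    have hp_le : p T ≤ f S / S := by
      refine le_trans ?_ (H.f_div_le_of_h_nonpos hS0 hST fun s hs =>
        (P.h_neg ⟨hS0.trans hs.1, hs.2⟩).le)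
      rw [H.f_eq_of_h_eq_zero hh, mul_div_cancel_left₀ _ P.pos.ne']
    have hp := H.firstPhase_p_pos P
    have : p T ^ 4 ≤ (f S / S) ^ 4 := by gcongr
    exact H.limit_pow_four_le_of_h_eq_zero ha0 ha P hh hu (by linarith)

end IsNeutral

end SlopeBound

section ExponentialBounds

variable {δ : ℝ}

lemma tendsto_exp_mul_atTop_of_neg (hδ : δ < 0) :
    Tendsto (fun s : ℝ => Real.exp (δ * s)) atTop (𝓝 0) :=
  Real.tendsto_exp_atBot.comp (tendsto_id.const_mul_atTop_of_neg hδ)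

variable {E : Type*} [NormedAddCommGroup E] [NormedSpace ℝ E] {y y' : ℝ → E}

lemma norm_sub_le_of_norm_deriv_le_exp {C s t : ℝ} (hδ : δ ≠ 0)
    (hd : ∀ x ∈ Icc s t, HasDerivAt y (y' x) x)
    (hb : ∀ x ∈ Icc s t, ‖y' x‖ ≤ C * Real.exp (δ * x)) (hst : s ≤ t) :
    ‖y t - y s‖ ≤ C / δ * (Real.exp (δ * t) - Real.exp (δ * s)) := by
  have hB (x : ℝ) : HasDerivAt (fun x => C / δ * (Real.exp (δ * x) - Real.exp (δ * s)))
      (C * Real.exp (δ * x)) x := by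
    refine ((((hasDerivAt_id' x).const_mul δ).exp.sub_const _).const_mul (C / δ)).congr_deriv ?_
    field_simp
  exact image_norm_le_of_norm_deriv_right_le_deriv_boundary (f := fun x => y x - y s) (f' := y')
    (fun x hx => ((hd x hx).sub_const _).continuousAt.continuousWithinAt)
    (fun x hx => ((hd x ⟨hx.1, hx.2.le⟩).sub_const _).hasDerivWithinAt) (by simp) hB
    (fun x hx => hb x ⟨hx.1, hx.2.le⟩) ⟨hst, le_rfl⟩

lemma exists_forall_norm_sub_le_of_deriv_isBigO_exp (hδ : δ ≠ 0)
    (hd : ∀ s, HasDerivAt y (y' s) s) (h : y' =O[atTop] fun s => Real.exp (δ * s)) :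
    ∃ C ≥ 0, ∃ S ≥ 0, ∀ s t, S ≤ s → s ≤ t →
      ‖y t - y s‖ ≤ C / δ * (Real.exp (δ * t) - Real.exp (δ * s)) := by
  obtain ⟨C, hC0, hC⟩ := h.exists_nonneg
  obtain ⟨S, hS⟩ := eventually_atTop.mp hC.bound
  refine ⟨C, hC0, max S 0, le_max_right _ _, fun s t hs hst => ?_⟩
  refine norm_sub_le_of_norm_deriv_le_exp hδ (fun x _ => hd x) (fun x hx => ?_) hst
  simpa only [Real.norm_of_nonneg (Real.exp_pos _).le] using
    hS x ((le_max_left S 0).trans (hs.trans hx.1))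

lemma isBigO_exp_of_deriv (hδ : 0 < δ) (hd : ∀ s, HasDerivAt y (y' s) s)
    (h : y' =O[atTop] fun s => Real.exp (δ * s)) : y =O[atTop] fun s => Real.exp (δ * s) := by
  obtain ⟨C, hC0, S, hS0, hS⟩ := exists_forall_norm_sub_le_of_deriv_isBigO_exp hδ.ne' hd h
  refine IsBigO.of_bound (‖y S‖ + C / δ) ?_
  filter_upwards [eventually_ge_atTop S] with s hs
  rw [Real.norm_of_nonneg (Real.exp_pos _).le]
  have hexp : 1 ≤ Real.exp (δ * s) := Real.one_le_exp (mul_nonneg hδ.le (hS0.trans hs))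
  calc ‖y s‖ ≤ ‖y S‖ + ‖y s - y S‖ := norm_le_norm_add_norm_sub' _ _
    _ ≤ ‖y S‖ * 1 + C / δ * (Real.exp (δ * s) - Real.exp (δ * S)) := by
        rw [mul_one]
        gcongr
        exact hS S s le_rfl hs
    _ ≤ ‖y S‖ * Real.exp (δ * s) + C / δ * Real.exp (δ * s) := by
        have : 0 ≤ Real.exp (δ * S) := (Real.exp_pos _).le
        gcongr
        linarith
    _ = (‖y S‖ + C / δ) * Real.exp (δ * s) := by ring

lemma exists_isBigO_exp_sub_of_deriv [CompleteSpace E] (hδ : δ < 0)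
    (hd : ∀ s, HasDerivAt y (y' s) s) (h : y' =O[atTop] fun s => Real.exp (δ * s)) :
    ∃ L, (fun s => y s - L) =O[atTop] fun s => Real.exp (δ * s) := by
  obtain ⟨C, hC0, S, -, hS⟩ := exists_forall_norm_sub_le_of_deriv_isBigO_exp hδ.ne hd h
  have tail_le {s t : ℝ} (hs : S ≤ s) (hst : s ≤ t) : ‖y t - y s‖ ≤ C / -δ * Real.exp (δ * s) := by
    have : 0 ≤ C / -δ * Real.exp (δ * t) :=
      mul_nonneg (div_nonneg hC0 (by linarith)) (Real.exp_pos _).le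
    calc ‖y t - y s‖ ≤ C / δ * (Real.exp (δ * t) - Real.exp (δ * s)) := hS s t hs hst
      _ = C / -δ * Real.exp (δ * s) - C / -δ * Real.exp (δ * t) := by rw [div_neg]; ring
      _ ≤ C / -δ * Real.exp (δ * s) := by linarith
  have tail_tendsto : Tendsto (fun s => C / -δ * Real.exp (δ * s)) atTop (𝓝 0) := by
    simpa only [mul_zero] using (tendsto_exp_mul_atTop_of_neg hδ).const_mul (C / -δ)
  have hcauchy : CauchySeq y := by
    refine Metric.cauchySeq_iff'.mpr fun ε hε => ?_
    obtain ⟨N, hN⟩ := eventually_atTop.mp (tail_tendsto.eventually_lt_const hε)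
    refine ⟨max N S, fun t ht => ?_⟩
    rw [dist_eq_norm]
    exact (tail_le (le_max_right _ _) ht).trans_lt (hN _ (le_max_left _ _))
  obtain ⟨L, hL⟩ := cauchySeq_tendsto_of_complete hcauchy
  refine ⟨L, IsBigO.of_bound (C / -δ) ?_⟩
  filter_upwards [eventually_ge_atTop S] with s hs
  rw [Real.norm_of_nonneg (Real.exp_pos _).le, norm_sub_rev]
  refine le_of_tendsto (hL.sub_const (y s)).norm ?_
  filter_upwards [eventually_ge_atTop s] with t ht using tail_le hs ht

lemma isBigO_exp_of_deriv_of_tendsto_zero [CompleteSpace E] (hδ : δ < 0)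
    (hd : ∀ s, HasDerivAt y (y' s) s) (h : y' =O[atTop] fun s => Real.exp (δ * s))
    (h0 : Tendsto y atTop (𝓝 0)) : y =O[atTop] fun s => Real.exp (δ * s) := by
  obtain ⟨L, hL⟩ := exists_isBigO_exp_sub_of_deriv hδ hd h
  have hL0 : 0 - L = 0 := tendsto_nhds_unique (h0.sub_const L)
    (hL.trans_tendsto (tendsto_exp_mul_atTop_of_neg hδ))
  obtain rfl : L = 0 := by simpa using hL0
  simpa only [sub_zero] using hL

end ExponentialBounds

section LinearEquation

variable {ℓ N : ℝ → ℂ} {z : ℂ} {δ : ℝ}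

lemma isBigO_exp_mul_of_le {α β : ℝ} (h : α ≤ β) :
    (fun s : ℝ => Real.exp (α * s)) =O[atTop] fun s => Real.exp (β * s) := by
  refine IsBigO.of_bound' ?_
  filter_upwards [eventually_ge_atTop 0] with s hs
  rw [Real.norm_of_nonneg (Real.exp_pos _).le, Real.norm_of_nonneg (Real.exp_pos _).le]
  gcongr

lemma norm_cexp_mul_ofReal (z : ℂ) (s : ℝ) : ‖Complex.exp (z * s)‖ = Real.exp (z.re * s) := by
  rw [Complex.norm_exp, Complex.re_mul_ofReal]

lemma isBigO_cexp_mul {φ : ℝ → ℂ} (z : ℂ) (h : φ =O[atTop] fun s => Real.exp (δ * s)) :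
    (fun s : ℝ => Complex.exp (z * s) * φ s) =O[atTop] fun s => Real.exp ((z.re + δ) * s) := by
  have hz : (fun s : ℝ => Complex.exp (z * s)) =O[atTop] fun s => Real.exp (z.re * s) :=
    IsBigO.of_norm_left (by simp only [norm_cexp_mul_ofReal]; exact isBigO_refl _ _)
  refine (hz.mul h).congr_right fun s => ?_
  rw [← Real.exp_add, add_mul]

lemma hasDerivAt_cexp_mul_ofReal (z : ℂ) (s : ℝ) :
    HasDerivAt (fun s : ℝ => Complex.exp (z * s)) (z * Complex.exp (z * s)) s := by
  refine (((hasDerivAt_id' s).ofReal_comp.const_mul z).cexp).congr_deriv ?_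
  rw [Complex.ofReal_one, mul_one, mul_comm]

lemma hasDerivAt_cexp_neg_mul (hd : ∀ s, HasDerivAt ℓ (z * ℓ s + N s) s) (s : ℝ) :
    HasDerivAt (fun s : ℝ => Complex.exp (-z * s) * ℓ s) (Complex.exp (-z * s) * N s) s := by
  refine ((hasDerivAt_cexp_mul_ofReal (-z) s).fun_mul (hd s)).congr_deriv ?_
  ring

lemma cexp_mul_cexp_neg_mul (z : ℂ) (s : ℝ) (x : ℂ) :
    Complex.exp (z * s) * (Complex.exp (-z * s) * x) = x := by
  rw [← mul_assoc, ← Complex.exp_add, neg_mul, add_neg_cancel, Complex.exp_zero, one_mul]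

lemma linear_isBigO_exp_of_re_lt (hd : ∀ s, HasDerivAt ℓ (z * ℓ s + N s) s)
    (hN : N =O[atTop] fun s => Real.exp (δ * s)) (hz : z.re < δ) :
    ℓ =O[atTop] fun s => Real.exp (δ * s) := by
  have hδ : 0 < (-z).re + δ := by rw [Complex.neg_re]; linarith
  have h := isBigO_cexp_mul z
    (isBigO_exp_of_deriv hδ (hasDerivAt_cexp_neg_mul hd) (isBigO_cexp_mul (-z) hN))
  simpa only [cexp_mul_cexp_neg_mul, Complex.neg_re, add_neg_cancel_left] using h

lemma linear_exists_isBigO_exp_of_lt_re (hd : ∀ s, HasDerivAt ℓ (z * ℓ s + N s) s)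
    (hN : N =O[atTop] fun s => Real.exp (δ * s)) (hz : δ < z.re) :
    ∃ L : ℂ, (fun s => ℓ s - L * Complex.exp (z * s)) =O[atTop] fun s => Real.exp (δ * s) := by
  have hδ : (-z).re + δ < 0 := by rw [Complex.neg_re]; linarith
  obtain ⟨L, hL⟩ := exists_isBigO_exp_sub_of_deriv hδ (hasDerivAt_cexp_neg_mul hd)
    (isBigO_cexp_mul (-z) hN)
  refine ⟨L, ?_⟩
  simpa only [mul_sub, cexp_mul_cexp_neg_mul, mul_comm _ L, Complex.neg_re,
    add_neg_cancel_left] using isBigO_cexp_mul z hL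

lemma linear_isBigO_exp_of_tendsto_zero (hd : ∀ s, HasDerivAt ℓ (z * ℓ s + N s) s)
    (hN : N =O[atTop] fun s => Real.exp (δ * s)) (hδ : δ < 0) (hz : 0 ≤ z.re)
    (h0 : Tendsto ℓ atTop (𝓝 0)) : ℓ =O[atTop] fun s => Real.exp (δ * s) := by
  obtain ⟨L, hL⟩ := linear_exists_isBigO_exp_of_lt_re hd hN (hδ.trans_le hz)
  have hmode : Tendsto (fun s : ℝ => L * Complex.exp (z * s)) atTop (𝓝 0) := by
    simpa using h0.sub (hL.trans_tendsto (tendsto_exp_mul_atTop_of_neg hδ))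
  have hle : ‖L‖ ≤ 0 := by
    refine ge_of_tendsto (by simpa only [norm_zero] using hmode.norm) ?_
    filter_upwards [eventually_ge_atTop 0] with s hs
    rw [norm_mul, norm_cexp_mul_ofReal]
    exact le_mul_of_one_le_right (norm_nonneg L) (Real.one_le_exp (mul_nonneg hz hs))
  obtain rfl : L = 0 := norm_le_zero_iff.mp hle
  simpa only [zero_mul, sub_zero] using hL

end LinearEquation

section Roots

-- The other two roots solve `z ^ 2 + (2 + μ) z + (μ ^ 2 + 2 μ - 1) = 0`, whose discriminant is
-- `8 - (3 μ ^ 2 + 4 μ)`: the last inequality makes them nonreal.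
lemma exists_root_one_lt {c : ℝ} (hc : 1 / 1.58 ≤ c) :
    ∃ μ : ℝ, 1 < μ ∧ (μ ^ 2 - 1) * (μ + 2) = c ∧ 8 < 3 * μ ^ 2 + 4 * μ := by
  norm_num at hc
  obtain ⟨μ, ⟨hμ1, -⟩, hμc⟩ := intermediate_value_Icc (a := 1) (b := 1 + c) (by linarith)
    (f := fun x : ℝ => (x ^ 2 - 1) * (x + 2)) (by fun_prop)
    (show c ∈ Icc _ _ by constructor <;> nlinarith)
  dsimp only at hμc
  have hμ : 1 < μ := by
    refine lt_of_le_of_ne hμ1 ?_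
    rintro rfl
    linarith
  refine ⟨μ, hμ, hμc, ?_⟩
  by_contra! hle
  have hμ_lt : μ < 1.0973 := by
    by_contra! hge
    norm_num at hge
    nlinarith
  have hle' : (μ ^ 2 - 1) * (μ + 2) ≤ (7 * μ - 2) / 9 := by
    linarith [mul_le_mul_of_nonneg_left hle (zero_le_one.trans hμ1)]
  norm_num at hμ_lt
  linarith

/-- Given a real root `μ` of `(z ^ 2 - 1) (z + 2) = c` whose other two roots are nonreal, the one
of these with positive imaginary part; it is the mode that governs the approach to `f y / y = a`. -/
noncomputable def stableRoot (μ : ℝ) : ℂ := ⟨-(2 + μ) / 2, √(3 * μ ^ 2 / 4 + μ - 2)⟩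

variable {μ c : ℝ}

lemma stableRoot_quadratic (hμ : 8 < 3 * μ ^ 2 + 4 * μ) :
    stableRoot μ ^ 2 + (2 + μ) * stableRoot μ + (μ ^ 2 + 2 * μ - 1) = 0 := by
  have hsqrt : √(3 * μ ^ 2 / 4 + μ - 2) * √(3 * μ ^ 2 / 4 + μ - 2) = 3 * μ ^ 2 / 4 + μ - 2 :=
    Real.mul_self_sqrt (by linarith)
  simp only [pow_two] at hsqrt
  apply Complex.ext
  · simp only [stableRoot, neg_add_rev, pow_two, Complex.add_re, Complex.mul_re, Complex.re_ofNat,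
      Complex.ofReal_re, Complex.add_im, Complex.im_ofNat, Complex.ofReal_im, add_zero, zero_mul,
      sub_zero, Complex.sub_re, mul_zero, Complex.one_re, Complex.zero_re]
    linarith
  · simp only [stableRoot, neg_add_rev, pow_two, Complex.add_im, Complex.mul_im, Complex.add_re,
      Complex.re_ofNat, Complex.ofReal_re, Complex.im_ofNat, Complex.ofReal_im, add_zero, zero_mul,
      Complex.sub_im, mul_zero, Complex.one_im, sub_self, Complex.zero_im]
    ring

lemma stableRoot_cubic (hμ : 8 < 3 * μ ^ 2 + 4 * μ) (hc : (μ ^ 2 - 1) * (μ + 2) = c) :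
    (stableRoot μ ^ 2 - 1) * (stableRoot μ + 2) = c := by
  rw [← hc]
  push_cast
  linear_combination (stableRoot μ - μ) * stableRoot_quadratic hμ

lemma isLeadingRoot_stableRoot (hμ1 : 1 < μ) (hμ : 8 < 3 * μ ^ 2 + 4 * μ)
    (hc : (μ ^ 2 - 1) * (μ + 2) = c) : IsLeadingRoot c (stableRoot μ) where
  root := by linear_combination -(stableRoot_cubic hμ hc)
  re_neg := by dsimp only [stableRoot]; linarith
  re_max z hz hre := by
    have hfactor : (z - μ) * ((z - stableRoot μ) * (z + (2 + μ) + stableRoot μ)) = 0 := by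
      have hc' : ((μ : ℂ) ^ 2 - 1) * (μ + 2) = c := mod_cast congrArg Complex.ofReal hc
      linear_combination -hz - hc' - (z - μ) * stableRoot_quadratic hμ
    rcases mul_eq_zero.mp hfactor with h | h
    · rw [sub_eq_zero.mp h, Complex.ofReal_re] at hre
      linarith
    rcases mul_eq_zero.mp h with h | h
    · rw [sub_eq_zero.mp h]
    · have := congrArg Complex.re h
      simp only [stableRoot, Complex.add_re, Complex.re_ofNat, Complex.ofReal_re,
        Complex.zero_re] at this ⊢
      linarith
  im_nonneg := Real.sqrt_nonneg _

end Roots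

section LogSystem

/-- The profile equation with `α = 1`, `m = 4` as an autonomous system in `s = log y`, for the
variables `v = f / y`, `w = h / y = f' - f / y`, `U = y f''`, `G = g / y ^ 2`, where
`g = f ^ 4 f'''`, along a trajectory converging to `v = a`. -/
structure IsLogSystem (a : ℝ) (v w U G : ℝ → ℝ) : Prop where
  a_pos : 0 < a
  hasDerivAt_v (s : ℝ) : HasDerivAt v (w s) s
  hasDerivAt_w (s : ℝ) : HasDerivAt w (U s - w s) s
  hasDerivAt_U (s : ℝ) : HasDerivAt U (U s + (v s ^ 4)⁻¹ * G s) s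
  hasDerivAt_G (s : ℝ) : HasDerivAt G (w s - 2 * G s) s
  tendsto_v : Tendsto v atTop (𝓝 a)

/-- `w`, `U` and `G` are `O(exp (δ s))` as `s → ∞`; the rates of interest are negative. -/
structure HasRate (w U G : ℝ → ℝ) (δ : ℝ) : Prop where
  isBigO_w : w =O[atTop] fun s => Real.exp (δ * s)
  isBigO_U : U =O[atTop] fun s => Real.exp (δ * s)
  isBigO_G : G =O[atTop] fun s => Real.exp (δ * s)

/-- The value at `(w, U, G)` of the left eigenvector, for the eigenvalue `z`, of the linearization
`w' = U - w`, `U' = U + c G`, `G' = w - 2 G`, whose characteristic equation is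
`(z ^ 2 - 1) (z + 2) = c`. -/
noncomputable def eigenComponent (w U G : ℝ → ℝ) (z : ℂ) (s : ℝ) : ℂ :=
  ((U s - w s - G s : ℝ) : ℂ) + z * (w s : ℝ) + z ^ 2 * (G s : ℝ)

variable {a δ μ : ℝ} {v w U G : ℝ → ℝ} {z : ℂ}

lemma eigenComponent_im (w U G : ℝ → ℝ) (z : ℂ) (s : ℝ) :
    (eigenComponent w U G z s).im = z.im * (w s + 2 * z.re * G s) := by
  simp only [eigenComponent, Complex.ofReal_sub, pow_two, Complex.add_im, Complex.sub_im,
    Complex.ofReal_im, sub_self, Complex.mul_im, mul_zero, Complex.ofReal_re, zero_add,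
    Complex.mul_re]
  ring

lemma eq_eigenComponent_G (w U G : ℝ → ℝ) (s μ : ℝ) (hz : z.im ≠ 0) :
    G s = ((eigenComponent w U G μ s).re - (eigenComponent w U G z s).re
      - (μ - z.re) / z.im * (eigenComponent w U G z s).im) / ((μ - z.re) ^ 2 + z.im ^ 2) := by
  rw [eq_div_iff (by positivity), eigenComponent_im]
  simp only [eigenComponent, Complex.ofReal_sub, pow_two, Complex.add_re, Complex.sub_re,
    Complex.ofReal_re, Complex.mul_re, Complex.ofReal_im, mul_zero, sub_zero, Complex.mul_im,
    zero_mul, add_zero]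
  field_simp
  ring

lemma eq_eigenComponent_w (w U G : ℝ → ℝ) (s : ℝ) (hz : z.im ≠ 0) :
    w s = (eigenComponent w U G z s).im / z.im - 2 * z.re * G s := by
  rw [eigenComponent_im]
  field_simp
  ring

lemma eq_eigenComponent_U (w U G : ℝ → ℝ) (s μ : ℝ) :
    U s = (eigenComponent w U G μ s).re + (1 - μ) * w s + (1 - μ ^ 2) * G s := by
  simp only [eigenComponent, Complex.ofReal_sub, pow_two, Complex.add_re, Complex.sub_re,
    Complex.ofReal_re, Complex.mul_re, Complex.ofReal_im, mul_zero, sub_zero, Complex.mul_im,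
    zero_mul, add_zero]
  ring

lemma exists_w_eq_re_mul_eigenComponent (μ : ℝ) (hz : z.im ≠ 0) :
    ∃ (b : ℝ) (B : ℂ), ∀ (w U G : ℝ → ℝ) (s : ℝ),
      w s = b * (eigenComponent w U G μ s).re + (B * eigenComponent w U G z s).re := by
  let b := 2 * z.re / ((μ - z.re) ^ 2 + z.im ^ 2)
  refine ⟨-b, ⟨b, -(1 / z.im + b * ((μ - z.re) / z.im))⟩, fun w U G s => ?_⟩
  rw [eq_eigenComponent_w w U G s hz, eq_eigenComponent_G w U G s μ hz, Complex.mul_re]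
  ring

lemma isBigO_re {φ : ℝ → ℂ} {ψ : ℝ → ℝ} (h : φ =O[atTop] ψ) : (fun s => (φ s).re) =O[atTop] ψ :=
  (Complex.reCLM.isBigO_comp φ atTop).trans h

lemma isBigO_im {φ : ℝ → ℂ} {ψ : ℝ → ℝ} (h : φ =O[atTop] ψ) : (fun s => (φ s).im) =O[atTop] ψ :=
  (Complex.imCLM.isBigO_comp φ atTop).trans h

namespace HasRate

lemma mono {δ' : ℝ} (h : HasRate w U G δ) (hδ : δ ≤ δ') : HasRate w U G δ' where
  isBigO_w := h.isBigO_w.trans (isBigO_exp_mul_of_le hδ)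
  isBigO_U := h.isBigO_U.trans (isBigO_exp_mul_of_le hδ)
  isBigO_G := h.isBigO_G.trans (isBigO_exp_mul_of_le hδ)

lemma isBigO_eigenComponent (h : HasRate w U G δ) (z : ℂ) :
    eigenComponent w U G z =O[atTop] fun s => Real.exp (δ * s) :=
  ((Complex.isBigO_ofReal_left.mpr ((h.isBigO_U.sub h.isBigO_w).sub h.isBigO_G)).add
    ((Complex.isBigO_ofReal_left.mpr h.isBigO_w).const_mul_left z)).add
    ((Complex.isBigO_ofReal_left.mpr h.isBigO_G).const_mul_left (z ^ 2))

lemma of_eigenComponent (hz : z.im ≠ 0)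
    (hμ : eigenComponent w U G μ =O[atTop] fun s => Real.exp (δ * s))
    (he : eigenComponent w U G z =O[atTop] fun s => Real.exp (δ * s)) :
    HasRate w U G δ := by
  have hG : G =O[atTop] fun s => Real.exp (δ * s) := by
    refine ((((isBigO_re hμ).sub (isBigO_re he)).sub
      ((isBigO_im he).const_mul_left ((μ - z.re) / z.im))).const_mul_left
        ((μ - z.re) ^ 2 + z.im ^ 2)⁻¹).congr_left fun s => ?_
    rw [eq_eigenComponent_G w U G s μ hz, inv_mul_eq_div]
  have hw : w =O[atTop] fun s => Real.exp (δ * s) := by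
    refine (((isBigO_im he).const_mul_left z.im⁻¹).sub
      (hG.const_mul_left (2 * z.re))).congr_left fun s => ?_
    rw [eq_eigenComponent_w w U G s hz, inv_mul_eq_div]
  refine ⟨hw, ?_, hG⟩
  refine (((isBigO_re hμ).add (hw.const_mul_left (1 - μ))).add
    (hG.const_mul_left (1 - μ ^ 2))).congr_left fun s => ?_
  rw [eq_eigenComponent_U w U G s μ]

end HasRate

lemma hasDerivAt_re_mul_cexp (K z : ℂ) (s : ℝ) :
    HasDerivAt (fun s : ℝ => (K * Complex.exp (z * s)).re) (K * (z * Complex.exp (z * s))).re s :=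
  Complex.reCLM.hasFDerivAt.comp_hasDerivAt s ((hasDerivAt_cexp_mul_ofReal z s).const_mul K)

lemma tendsto_re_mul_cexp_of_re_neg (K : ℂ) (hz : z.re < 0) :
    Tendsto (fun s : ℝ => (K * Complex.exp (z * s)).re) atTop (𝓝 0) := by
  have hbound : (fun s : ℝ => K * Complex.exp (z * s)) =O[atTop] fun s => Real.exp (z.re * s) := by
    refine IsBigO.of_bound ‖K‖ (Eventually.of_forall fun s => ?_)
    rw [norm_mul, norm_cexp_mul_ofReal, Real.norm_of_nonneg (Real.exp_pos _).le]
  exact (isBigO_re hbound).trans_tendsto (tendsto_exp_mul_atTop_of_neg hz)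

namespace IsLogSystem

lemma hasDerivAt_eigenComponent {c : ℝ} (H : IsLogSystem a v w U G)
    (hz : (z ^ 2 - 1) * (z + 2) = c) (s : ℝ) :
    HasDerivAt (eigenComponent w U G z)
      (z * eigenComponent w U G z s + ((((v s ^ 4)⁻¹ - c) * G s : ℝ) : ℂ)) s := by
  have hw := (H.hasDerivAt_w s).ofReal_comp
  have hG := (H.hasDerivAt_G s).ofReal_comp
  have hUwG := (((H.hasDerivAt_U s).sub (H.hasDerivAt_w s)).sub (H.hasDerivAt_G s)).ofReal_comp
  refine ((hUwG.fun_add (hw.const_mul z)).fun_add (hG.const_mul (z ^ 2))).congr_deriv ?_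
  simp only [eigenComponent]
  push_cast
  linear_combination -(G s : ℂ) * hz

lemma isBigO_v_sub (H : IsLogSystem a v w U G) (hδ : δ < 0) (h : HasRate w U G δ) :
    (fun s => v s - a) =O[atTop] fun s => Real.exp (δ * s) :=
  isBigO_exp_of_deriv_of_tendsto_zero hδ (fun s => (H.hasDerivAt_v s).sub_const a) h.isBigO_w
    (by simpa using H.tendsto_v.sub_const a)

lemma isBigO_forcing (H : IsLogSystem a v w U G) (hδ : δ < 0) (h : HasRate w U G δ) :
    (fun s => ((((v s ^ 4)⁻¹ - (a ^ 4)⁻¹) * G s : ℝ) : ℂ)) =O[atTop]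
      fun s => Real.exp (2 * δ * s) := by
  have hinv : (fun x : ℝ => (x ^ 4)⁻¹ - (a ^ 4)⁻¹) =O[𝓝 a] fun x => x - a :=
    ((hasDerivAt_pow 4 a).fun_inv (pow_pos H.a_pos 4).ne').isBigO_sub
  have hinv_v : (fun s => (v s ^ 4)⁻¹ - (a ^ 4)⁻¹) =O[atTop] fun s => Real.exp (δ * s) :=
    (hinv.comp_tendsto H.tendsto_v).trans (H.isBigO_v_sub hδ h)
  refine Complex.isBigO_ofReal_left.mpr ((hinv_v.mul h.isBigO_G).congr_right fun s => ?_)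
  rw [← Real.exp_add]
  ring_nf

lemma isBigO_eigenComponent_unstable (H : IsLogSystem a v w U G) (hμ0 : 0 ≤ μ)
    (hμ : (μ ^ 2 - 1) * (μ + 2) = (a ^ 4)⁻¹) (hδ : δ < 0) (h : HasRate w U G δ) :
    eigenComponent w U G μ =O[atTop] fun s => Real.exp (2 * δ * s) :=
  linear_isBigO_exp_of_tendsto_zero (H.hasDerivAt_eigenComponent (mod_cast hμ))
    (H.isBigO_forcing hδ h) (by linarith) (by simpa using hμ0)
    ((h.isBigO_eigenComponent μ).trans_tendsto (tendsto_exp_mul_atTop_of_neg hδ))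

lemma hasRate_two_mul (H : IsLogSystem a v w U G) (hμ0 : 0 ≤ μ)
    (hμ : (μ ^ 2 - 1) * (μ + 2) = (a ^ 4)⁻¹) (hz : (z ^ 2 - 1) * (z + 2) = (a ^ 4)⁻¹)
    (hz_im : z.im ≠ 0) (hδ : δ < 0) (hδz : z.re < 2 * δ) (h : HasRate w U G δ) :
    HasRate w U G (2 * δ) :=
  .of_eigenComponent hz_im (H.isBigO_eigenComponent_unstable hμ0 hμ hδ h)
    (linear_isBigO_exp_of_re_lt (H.hasDerivAt_eigenComponent (mod_cast hz))
      (H.isBigO_forcing hδ h) hδz)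

lemma hasRate_two_thirds (H : IsLogSystem a v w U G) (hμ0 : 0 ≤ μ)
    (hμ : (μ ^ 2 - 1) * (μ + 2) = (a ^ 4)⁻¹) (hz : (z ^ 2 - 1) * (z + 2) = (a ^ 4)⁻¹)
    (hz_im : z.im ≠ 0) (hz_re : z.re < 0) (hδ : δ < 0) (h : HasRate w U G δ) :
    HasRate w U G (2 / 3 * z.re) := by
  set q := 2 / 3 * z.re with hq
  obtain ⟨n, hn⟩ := pow_unbounded_of_one_lt (q / δ) (one_lt_two (α := ℝ))
  have doubling (k : ℕ) (hk : HasRate w U G (q / 2 ^ k)) : HasRate w U G q := by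
    induction k with
    | zero => simpa using hk
    | succ k ih =>
      have hmul : 2 * (q / 2 ^ (k + 1)) = q / 2 ^ k := by rw [pow_succ]; field_simp
      have hle : -q / 2 ^ k ≤ -q := div_le_self (by linarith) (one_le_pow₀ one_le_two)
      rw [neg_div] at hle
      refine ih (hmul ▸ H.hasRate_two_mul hμ0 hμ hz hz_im ?_ ?_ hk)
      · exact div_neg_of_neg_of_pos (by linarith) (by positivity)
      · rw [hmul]
        linarith
  refine doubling n (h.mono ?_)
  rw [div_lt_iff_of_neg hδ] at hn
  rw [le_div_iff₀ (by positivity)]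
  linarith

lemma exists_isBigO_w_sub (H : IsLogSystem a v w U G) (hμ0 : 0 ≤ μ)
    (hμ : (μ ^ 2 - 1) * (μ + 2) = (a ^ 4)⁻¹) (hz : (z ^ 2 - 1) * (z + 2) = (a ^ 4)⁻¹)
    (hz_im : z.im ≠ 0) (hδ : δ < 0) (hδz : 2 * δ < z.re) (h : HasRate w U G δ) :
    ∃ L : ℂ, (fun s : ℝ => w s - (L * Complex.exp (z * s)).re) =O[atTop]
      fun s => Real.exp (2 * δ * s) := by
  obtain ⟨L, hL⟩ := linear_exists_isBigO_exp_of_lt_re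
    (H.hasDerivAt_eigenComponent (c := (a ^ 4)⁻¹) (mod_cast hz)) (H.isBigO_forcing hδ h) hδz
  obtain ⟨b, B, hw⟩ := exists_w_eq_re_mul_eigenComponent μ hz_im
  refine ⟨B * L, (((isBigO_re (H.isBigO_eigenComponent_unstable hμ0 hμ hδ h)).const_mul_left b).add
    (isBigO_re (hL.const_mul_left B))).congr_left fun s => ?_⟩
  rw [hw w U G s, mul_sub, Complex.sub_re, mul_assoc B L]
  ring

lemma exists_isLittleO_v_sub (H : IsLogSystem a v w U G) (hμ0 : 0 ≤ μ)
    (hμ : (μ ^ 2 - 1) * (μ + 2) = (a ^ 4)⁻¹) (hz : (z ^ 2 - 1) * (z + 2) = (a ^ 4)⁻¹)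
    (hz_im : z.im ≠ 0) (hz_re : z.re < 0) (hδ : δ < 0) (h : HasRate w U G δ) :
    ∃ K : ℂ, (fun s : ℝ => v s - (a + (K * Complex.exp (z * s)).re)) =o[atTop]
      fun s => Real.exp (z.re * s) := by
  obtain ⟨L, hL⟩ := H.exists_isBigO_w_sub hμ0 hμ hz hz_im (δ := 2 / 3 * z.re) (by linarith)
    (by linarith) (H.hasRate_two_thirds hμ0 hμ hz hz_im hz_re hδ h)
  have hz0 : z ≠ 0 := by rintro rfl; exact hz_re.false
  have hmode (s : ℝ) : HasDerivAt (fun s : ℝ => (L / z * Complex.exp (z * s)).re)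
      (L * Complex.exp (z * s)).re s := by
    refine (hasDerivAt_re_mul_cexp (L / z) z s).congr_deriv ?_
    rw [← mul_assoc, div_mul_cancel₀ L hz0]
  have hv := isBigO_exp_of_deriv_of_tendsto_zero (by linarith)
    (fun s => ((H.hasDerivAt_v s).sub_const a).fun_sub (hmode s)) hL
    (by simpa using (H.tendsto_v.sub_const a).sub (tendsto_re_mul_cexp_of_re_neg (L / z) hz_re))
  have hexp : (fun s : ℝ => Real.exp (2 * (2 / 3 * z.re) * s)) =o[atTop]
      fun s => Real.exp (z.re * s) := by
    refine Real.isLittleO_exp_comp_exp_comp.mpr ?_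
    refine (tendsto_id.const_mul_atTop (show 0 < -z.re / 3 by linarith)).congr fun s => ?_
    dsimp only [id]
    ring
  refine ⟨L / z, (hv.trans_isLittleO hexp).congr_left fun s => ?_⟩
  ring

end IsLogSystem

end LogSystem

section Regularity

variable {n : ℕ} {F F' Fn Fn' : ℝ → ℝ}

lemma contDiffOn_Ici_succ_of_hasDerivAt (hd : ∀ y, 0 ≤ y → HasDerivAt F (F' y) y)
    (h : ContDiffOn ℝ n F' (Ici 0)) : ContDiffOn ℝ (n + 1 : ℕ) F (Ici 0) := by
  push_cast
  rw [contDiffOn_succ_iff_derivWithin (uniqueDiffOn_Ici 0)]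
  refine ⟨fun y hy => (hd y hy).differentiableAt.differentiableWithinAt, by simp,
    h.congr fun y hy => ?_⟩
  exact (hd y hy).hasDerivWithinAt.derivWithin (uniqueDiffOn_Ici 0 y hy)

lemma iteratedDerivWithin_Ici_succ_eqOn (hd : ∀ y, 0 ≤ y → HasDerivAt Fn (Fn' y) y)
    (h : EqOn (iteratedDerivWithin n F (Ici 0)) Fn (Ici 0)) :
    EqOn (iteratedDerivWithin (n + 1) F (Ici 0)) Fn' (Ici 0) := fun y hy => by
  rw [iteratedDerivWithin_succ, derivWithin_congr h (h hy)]
  exact (hd y hy).hasDerivWithinAt.derivWithin (uniqueDiffOn_Ici 0 y hy)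

lemma iteratedDeriv_succ_eqOn_Ioi (hd : ∀ y, 0 < y → HasDerivAt Fn (Fn' y) y)
    (h : EqOn (iteratedDeriv n F) Fn (Ioi 0)) :
    EqOn (iteratedDeriv (n + 1) F) Fn' (Ioi 0) := fun y hy => by
  rw [iteratedDeriv_succ, (h.eventuallyEq_of_mem (Ioi_mem_nhds hy)).deriv_eq]
  exact (hd y hy).deriv

lemma hasDerivAt_const_mul_comp_mul {φ : ℝ → ℝ} {φ' k l y : ℝ} (hd : HasDerivAt φ φ' (l * y)) :
    HasDerivAt (fun y => k * φ (l * y)) (l * k * φ') y := by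
  refine ((hd.comp y ((hasDerivAt_id' y).const_mul l)).const_mul k).congr_deriv ?_
  ring

end Regularity

section Profile

lemma isSelfSimilarProfile_of_hasDerivAt {α m a : ℝ} {F F₁ F₂ F₃ : ℝ → ℝ}
    (hF : ContDiffOn ℝ 4 F (Ici 0)) (hpos : ∀ y, 0 ≤ y → 0 < F y)
    (hd₀ : ∀ y, 0 ≤ y → HasDerivAt F (F₁ y) y) (hd₁ : ∀ y, 0 ≤ y → HasDerivAt F₁ (F₂ y) y)
    (hd₂ : ∀ y, 0 ≤ y → HasDerivAt F₂ (F₃ y) y)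
    (hflux : ∀ y, 0 < y → HasDerivAt (fun s => F s ^ m * F₃ s) (-(α * (F y - y * F₁ y))) y)
    (h₀ : F 0 = 1) (h₁ : F₁ 0 = 0) (h₃ : F₃ 0 = 0)
    (hlim : Tendsto (fun y => F y / y) atTop (𝓝 a)) :
    IsSelfSimilarProfile α m (F₂ 0) a F := by
  have within₁ := iteratedDerivWithin_Ici_succ_eqOn (F := F) (n := 0) hd₀ fun y _ => by simp
  have within₂ := iteratedDerivWithin_Ici_succ_eqOn hd₁ within₁
  have within₃ := iteratedDerivWithin_Ici_succ_eqOn hd₂ within₂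
  have deriv₃ : EqOn (iteratedDeriv 3 F) F₃ (Ioi 0) :=
    iteratedDeriv_succ_eqOn_Ioi (fun y hy => hd₂ y hy.le) <|
      iteratedDeriv_succ_eqOn_Ioi (fun y hy => hd₁ y hy.le) <|
      iteratedDeriv_succ_eqOn_Ioi (n := 0) (fun y hy => hd₀ y hy.le) fun y _ => by simp
  refine ⟨hF, hpos, fun y hy => ?_, h₀, (within₁ self_mem_Ici).trans h₁, within₂ self_mem_Ici,
    (within₃ self_mem_Ici).trans h₃, hlim⟩
  have flux_eq : (fun s => F s ^ m * iteratedDeriv 3 F s) =ᶠ[𝓝 y] fun s => F s ^ m * F₃ s := by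
    filter_upwards [Ioi_mem_nhds hy] with s hs using by rw [deriv₃ hs]
  rw [flux_eq.deriv_eq, (hflux y hy).deriv, (hd₀ y hy.le).deriv, add_neg_cancel]

namespace IsNeutral

variable {m κ a l : ℝ} {f p u g h r : ℝ → ℝ}

lemma contDiffOn (H : IsNeutral m κ f p u g h r) : ContDiffOn ℝ 4 f (Ici 0) := by
  have h_cont : ContDiffOn ℝ (0 : ℕ) h (Ici 0) :=
    contDiffOn_zero.mpr fun y hy => (H.hasDerivAt_h hy).continuousAt.continuousWithinAt
  have p_cont : ContDiffOn ℝ (0 : ℕ) p (Ici 0) :=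
    contDiffOn_zero.mpr fun y hy => (H.hasDerivAt_p hy).continuousAt.continuousWithinAt
  have g_contDiff := contDiffOn_Ici_succ_of_hasDerivAt (fun _ => H.hasDerivAt_g) h_cont
  have f_contDiff := contDiffOn_Ici_succ_of_hasDerivAt (fun _ => H.hasDerivAt_f) p_cont
  have r_contDiff : ContDiffOn ℝ (0 + 1 : ℕ) r (Ici 0) :=
    (f_contDiff.rpow_const_of_ne fun y hy => (H.f_pos hy).ne').congr fun y hy => H.r_eq_rpow hy
  exact contDiffOn_Ici_succ_of_hasDerivAt (fun _ => H.hasDerivAt_f) <|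
    contDiffOn_Ici_succ_of_hasDerivAt (fun _ => H.hasDerivAt_p) <|
    contDiffOn_Ici_succ_of_hasDerivAt (fun _ => H.hasDerivAt_u) (g_contDiff.mul r_contDiff)

lemma f_rpow_mul_r (H : IsNeutral m κ f p u g h r) {t : ℝ} (ht : 0 ≤ t) : f t ^ m * r t = 1 := by
  rw [H.r_eq_rpow ht, ← Real.rpow_add (H.f_pos ht), add_neg_cancel, Real.rpow_zero]

lemma hasDerivAt_flux_comp_mul (H : IsNeutral m κ f p u g h r) (hl : 0 < l) {y : ℝ}
    (hy : 0 < y) :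
    HasDerivAt (fun s => f (l * s) ^ m * (l * (l * l) * (g (l * s) * r (l * s))))
      (-(l ^ 4 * (f (l * y) - y * (l * p (l * y))))) y := by
  have flux_eq : (fun s => f (l * s) ^ m * (l * (l * l) * (g (l * s) * r (l * s)))) =ᶠ[𝓝 y]
      fun s => l * (l * l) * g (l * s) := by
    filter_upwards [Ioi_mem_nhds hy] with s hs
    linear_combination l * (l * l) * g (l * s) * H.f_rpow_mul_r (mul_pos hl hs).le
  refine ((hasDerivAt_const_mul_comp_mul (H.hasDerivAt_g
    (mul_pos hl hy).le)).congr_of_eventuallyEq flux_eq).congr_deriv ?_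
  rw [H.h_eq]
  ring

lemma isSelfSimilarProfile (H : IsNeutral m κ f p u g h r) (ha : Tendsto p atTop (𝓝 a))
    (hl : 0 < l) :
    IsSelfSimilarProfile (l ^ 4) m (l ^ 2 * κ) (l * a) fun y => f (l * y) := by
  have mul_nonneg_of {y : ℝ} (hy : 0 ≤ y) : 0 ≤ l * y := mul_nonneg hl.le hy
  have hlim : Tendsto (fun y => f (l * y) / y) atTop (𝓝 (l * a)) := by
    refine (((H.tendsto_f_div ha).comp
      (tendsto_id.const_mul_atTop hl)).const_mul l).congr fun y => ?_
    rw [Function.comp, id, mul_div_assoc', mul_div_mul_left _ _ hl.ne']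
  have profile := isSelfSimilarProfile_of_hasDerivAt
    (F := fun y => f (l * y)) (F₁ := fun y => l * p (l * y)) (F₂ := fun y => l * l * u (l * y))
    (F₃ := fun y => l * (l * l) * (g (l * y) * r (l * y)))
    (H.contDiffOn.comp (contDiff_const.mul contDiff_id).contDiffOn fun _ => mul_nonneg_of)
    (fun y hy => H.f_pos (mul_nonneg_of hy))
    (fun y hy => by
      simpa using hasDerivAt_const_mul_comp_mul (k := 1) (H.hasDerivAt_f (mul_nonneg_of hy)))
    (fun y hy => hasDerivAt_const_mul_comp_mul (H.hasDerivAt_p (mul_nonneg_of hy)))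
    (fun y hy => hasDerivAt_const_mul_comp_mul (H.hasDerivAt_u (mul_nonneg_of hy)))
    (fun y hy => H.hasDerivAt_flux_comp_mul hl hy)
    (by rw [mul_zero, H.f_zero]) (by rw [mul_zero, H.p_zero, mul_zero])
    (by rw [mul_zero, H.g_zero, zero_mul, mul_zero]) hlim
  rwa [mul_zero, H.u_zero, ← pow_two] at profile

lemma isLogSystem (H : IsNeutral 4 κ f p u g h r) (ha0 : 0 < a) (ha : Tendsto p atTop (𝓝 a)) :
    IsLogSystem a (fun s => f (Real.exp s) / Real.exp s) (fun s => h (Real.exp s) / Real.exp s)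
      (fun s => Real.exp s * u (Real.exp s)) (fun s => g (Real.exp s) / Real.exp s ^ 2) where
  a_pos := ha0
  hasDerivAt_v s := by
    refine ((H.hasDerivAt_f_div (Real.exp_pos s)).comp s (Real.hasDerivAt_exp s)).congr_deriv ?_
    field_simp
  hasDerivAt_w s := by
    have exp_pos := Real.exp_pos s
    refine (((H.hasDerivAt_h exp_pos.le).comp s (Real.hasDerivAt_exp s)).fun_div
      (Real.hasDerivAt_exp s) exp_pos.ne').congr_deriv ?_
    simp only [Function.comp]
    field_simp
  hasDerivAt_U s := by
    have exp_pos := Real.exp_pos s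
    refine ((Real.hasDerivAt_exp s).fun_mul
      ((H.hasDerivAt_u exp_pos.le).comp s (Real.hasDerivAt_exp s))).congr_deriv ?_
    have f_pos := H.f_pos exp_pos.le
    simp only [Function.comp]
    rw [H.r_eq_inv_pow_four exp_pos.le]
    field_simp
  hasDerivAt_G s := by
    have exp_pos := Real.exp_pos s
    refine (((H.hasDerivAt_g exp_pos.le).comp s (Real.hasDerivAt_exp s)).fun_div
      ((Real.hasDerivAt_exp s).fun_pow 2) (by positivity)).congr_deriv ?_
    simp only [Function.comp]
    push_cast
    field_simp
  tendsto_v := (H.tendsto_f_div ha).comp Real.tendsto_exp_atTop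

end IsNeutral

lemma isBigO_exp_of_sq_le_div {φ : ℝ → ℝ} {C : ℝ} (h : ∀ᶠ t in atTop, φ t ^ 2 ≤ C / t) :
    (fun s => φ (Real.exp s)) =O[atTop] fun s => Real.exp (-(1 / 2) * s) := by
  refine IsBigO.of_bound (√C) ?_
  filter_upwards [Real.tendsto_exp_atTop.eventually h] with s hs
  have hexp : C / Real.exp s = C * Real.exp (-(1 / 2) * s) ^ 2 := by
    rw [← Real.exp_nat_mul, div_eq_mul_inv, ← Real.exp_neg]
    congr 2
    push_cast
    ring
  rw [Real.norm_eq_abs, Real.norm_of_nonneg (Real.exp_pos _).le]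
  simpa only [hexp, Real.sqrt_mul' C (sq_nonneg _), Real.sqrt_sq (Real.exp_pos _).le] using
    Real.abs_le_sqrt hs

lemma isLittleO_cpow_of_isLittleO_cexp {a : ℝ} {f : ℝ → ℝ} {z K : ℂ}
    (h : (fun s : ℝ => f (Real.exp s) / Real.exp s - (a + (K * Complex.exp (z * s)).re)) =o[atTop]
      fun s => Real.exp (z.re * s)) :
    (fun y : ℝ => f y - (a * y + (K * (y : ℂ) ^ (1 + z)).re)) =o[atTop]
      fun y : ℝ => y ^ (1 + z.re) := by
  refine ((isBigO_refl id atTop).mul_isLittleO (h.comp_tendsto Real.tendsto_log_atTop)).congr' ?_ ?_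
  · filter_upwards [eventually_gt_atTop 0] with y hy
    have hy_ne : (y : ℂ) ≠ 0 := mod_cast hy.ne'
    simp only [Function.comp, id, Real.exp_log hy]
    rw [Complex.cpow_add _ _ hy_ne, Complex.cpow_one, Complex.cpow_def_of_ne_zero hy_ne,
      ← Complex.ofReal_log hy.le, mul_left_comm K (y : ℂ), Complex.re_ofReal_mul, mul_comm z]
    field_simp
  · filter_upwards [eventually_gt_atTop 0] with y hy
    simp only [Function.comp, id]
    rw [Real.rpow_add hy, Real.rpow_one, Real.rpow_def_of_pos hy, mul_comm z.re]

lemma isLittleO_cpow_comp_mul {a l : ℝ} {f : ℝ → ℝ} {z K : ℂ} (hl : 0 < l)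
    (h : (fun y : ℝ => f y - (a * y + (K * (y : ℂ) ^ (1 + z)).re)) =o[atTop]
      fun y : ℝ => y ^ (1 + z.re)) :
    (fun y : ℝ => f (l * y) - (l * a * y + (K * (l : ℂ) ^ (1 + z) * (y : ℂ) ^ (1 + z)).re))
      =o[atTop] fun y : ℝ => y ^ (1 + z.re) := by
  have hscale : (fun y : ℝ => (l * y) ^ (1 + z.re)) =O[atTop] fun y : ℝ => y ^ (1 + z.re) := by
    refine IsBigO.of_bound (l ^ (1 + z.re)) ?_
    filter_upwards [eventually_gt_atTop 0] with y hy
    rw [Real.mul_rpow hl.le hy.le, norm_mul, Real.norm_of_nonneg (Real.rpow_nonneg hl.le _)]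
  refine ((h.comp_tendsto (tendsto_id.const_mul_atTop hl)).trans_isBigO hscale).congr' ?_
    EventuallyEq.rfl
  filter_upwards [eventually_gt_atTop 0] with y hy
  simp only [Function.comp, id]
  rw [Complex.ofReal_mul, Complex.mul_cpow_ofReal_nonneg hl.le hy.le]
  ring_nf

namespace IsNeutral

variable {κ a : ℝ} {f p u g h r : ℝ → ℝ}

lemma hasRate_neg_half (H : IsNeutral 4 κ f p u g h r) (ha0 : 0 < a)
    (ha : Tendsto p atTop (𝓝 a)) :
    HasRate (fun s => h (Real.exp s) / Real.exp s) (fun s => Real.exp s * u (Real.exp s))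
      (fun s => g (Real.exp s) / Real.exp s ^ 2) (-(1 / 2)) := by
  obtain ⟨C, hC⟩ := H.exists_forall_sq_le_div ha0 ha
  exact ⟨isBigO_exp_of_sq_le_div (φ := fun t => h t / t) (hC.mono fun t ht => ht.1),
    isBigO_exp_of_sq_le_div (φ := fun t => t * u t) (hC.mono fun t ht => ht.2.1),
    isBigO_exp_of_sq_le_div (φ := fun t => g t / t ^ 2) (hC.mono fun t ht => ht.2.2)⟩

lemma exists_isLeadingRoot_isLittleO (H : IsNeutral 4 κ f p u g h r) (ha0 : 0 < a)
    (ha : Tendsto p atTop (𝓝 a)) :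
    ∃ z K : ℂ, IsLeadingRoot (1 / a ^ 4) z ∧ z.re < -1 ∧
      (fun y : ℝ => f y - (a * y + (K * (y : ℂ) ^ (1 + z)).re)) =o[atTop]
        fun y : ℝ => y ^ (1 + z.re) := by
  obtain ⟨μ, hμ1, hμc, hμ⟩ := exists_root_one_lt
    (one_div_le_one_div_of_le (by positivity) (H.limit_pow_four_le ha0 ha))
  have hre : (stableRoot μ).re < -1 := by dsimp only [stableRoot]; linarith
  have him : (stableRoot μ).im ≠ 0 := (Real.sqrt_pos.mpr (by linarith)).ne'
  obtain ⟨K, hK⟩ := (H.isLogSystem ha0 ha).exists_isLittleO_v_sub (by linarith)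
    (hμc.trans (one_div _)) (by simpa using stableRoot_cubic hμ hμc) him (by linarith)
    (by norm_num) (H.hasRate_neg_half ha0 ha)
  exact ⟨stableRoot μ, K, isLeadingRoot_stableRoot hμ1 hμ hμc, hre,
    isLittleO_cpow_of_isLittleO_cexp hK⟩

end IsNeutral

end Profile

lemma exists_pos_pow_four_eq {α : ℝ} (hα : 0 < α) : ∃ l : ℝ, 0 < l ∧ l ^ 4 = α :=
  ⟨α ^ (1 / 4 : ℝ), Real.rpow_pos_of_pos hα _, by
    rw [← Real.rpow_natCast, ← Real.rpow_mul hα.le]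
    norm_num⟩

lemma sq_mul_mem_Ioo_sqrt {b l κ : ℝ} (hb : 0 ≤ b) (hl : 0 < l) (hκ : κ ∈ Ioo 0 (√b)) :
    l ^ 2 * κ ∈ Ioo 0 (√(b * l ^ 4)) := by
  have hsqrt : √(b * l ^ 4) = l ^ 2 * √b := by
    rw [Real.sqrt_mul hb, show l ^ 4 = (l ^ 2) ^ 2 by ring, Real.sqrt_sq (by positivity), mul_comm]
  rw [hsqrt]
  exact ⟨mul_pos (by positivity) hκ.1, mul_lt_mul_of_pos_left hκ.2 (by positivity)⟩

theorem mainTheorem1_general :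
    (∀ m α : ℝ, 0 < m → 0 < α →
      ∃ κ ∈ Ioo (0 : ℝ) (Real.sqrt (12 * α)), ∃ a : ℝ, 0 < a ∧
        ∃ f : ℝ → ℝ, IsSelfSimilarProfile α m κ a f) ∧
    (∀ b : ℝ, 0 < b →
      ∃ κ ∈ Ioo (0 : ℝ) (Real.sqrt (12 * b)), ∃ a : ℝ, 0 < a ∧
        ∃ f : ℝ → ℝ, IsSelfSimilarProfile b 4 κ a f ∧
          ∃ z₀ K : ℂ, IsLeadingRoot (b / a ^ 4) z₀ ∧ z₀.re < -1 ∧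
            (fun y : ℝ => f y - (a * y + (K * (y : ℂ) ^ (1 + z₀)).re))
              =o[atTop] fun y : ℝ => y ^ (1 + z₀.re)) := by
  constructor
  · intro m α hm hα
    obtain ⟨κ, hκ, f, p, u, g, h, r, H⟩ := exists_isNeutral hm
    obtain ⟨a, ha0, ha⟩ := H.exists_tendsto_p
    obtain ⟨l, hl, rfl⟩ := exists_pos_pow_four_eq hα
    exact ⟨_, sq_mul_mem_Ioo_sqrt (by norm_num) hl hκ, _, mul_pos hl ha0, _,
      H.isSelfSimilarProfile ha hl⟩
  · intro b hb
    obtain ⟨κ, hκ, f, p, u, g, h, r, H⟩ := exists_isNeutral (m := 4) (by norm_num)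
    obtain ⟨a, ha0, ha⟩ := H.exists_tendsto_p
    obtain ⟨l, hl, rfl⟩ := exists_pos_pow_four_eq hb
    obtain ⟨z, K, hz, hz_re, hK⟩ := H.exists_isLeadingRoot_isLittleO ha0 ha
    have hc : l ^ 4 / (l * a) ^ 4 = 1 / a ^ 4 := by field_simp
    exact ⟨_, sq_mul_mem_Ioo_sqrt (by norm_num) hl hκ, _, mul_pos hl ha0, _,
      H.isSelfSimilarProfile ha hl, z, _, hc ▸ hz, hz_re, isLittleO_cpow_comp_mul hl hK⟩

theorem mainTheorem1 :
    (∀ m : ℝ, 0 < m → m < 4 →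
      ∃ κ ∈ Ioo (0 : ℝ) (Real.sqrt (12 * (1 / (4 - m)))), ∃ a : ℝ, 0 < a ∧
        ∃ f : ℝ → ℝ, IsSelfSimilarProfile (1 / (4 - m)) m κ a f) ∧
    (∀ b : ℝ, 0 < b →
      ∃ κ ∈ Ioo (0 : ℝ) (Real.sqrt (12 * b)), ∃ a : ℝ, 0 < a ∧
        ∃ f : ℝ → ℝ, IsSelfSimilarProfile b 4 κ a f ∧
          ∃ z₀ K : ℂ, IsLeadingRoot (b / a ^ 4) z₀ ∧ z₀.re < -1 ∧
            (fun y : ℝ => f y - (a * y + (K * (y : ℂ) ^ (1 + z₀)).re))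
              =o[atTop] fun y : ℝ => y ^ (1 + z₀.re)) :=
  ⟨fun m hm hm4 => mainTheorem1_general.1 m _ hm (one_div_pos.mpr (sub_pos.mpr hm4)),
    mainTheorem1_general.2⟩
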